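/- Let $(V,\omega)$ be a nonzero finite-dimensional complex symplectic vector space and $\Gamma\subset Sp(V)$ a finite group. Let $S=\{s\in\Gamma : \operatorname{rk}(\mathrm{Id}-s)=2\}$ be the set of symplectic reflections in $\Gamma$, and for $s\in S$ let $\omega_s$ be the skew-symmetric bilinear form on $V$ that coincides with $\omega$ on $\operatorname{Im}(\mathrm{Id}-s)$ and has $\operatorname{Ker}(\mathrm{Id}-s)$ as its radical. For $t\in\mathbb{C}$ and a function $c:S\to\mathbb{C}$, $s\mapsto c_s$, invariant under conjugation by $\Gamma$, let $$H_{t,c}=(TV\#\Gamma)\big/\Big\langle x\otimes y-y\otimes x-t\,\omega(x,y)\cdot 1-\sum_{s\in S}c_s\,\omega_s(x,y)\cdot s\ :\ x,y\in V\Big\rangle,$$ where $TV\#\Gamma$ is the smash product of the tensor algebra of $V$ with the group algebra $\mathbb{C}\Gamma$ and $\langle\ldots\rangle$ is the two-sided ideal generated by the indicated elements. Let $\mathbf{e}=\frac{1}{|\Gamma|}\sum_{g\in\Gamma}g\in\mathbb{C}\Gamma$, viewed as an element of $H_{t,c}$. Then, for every $t\in\mathbb{C}$ and every conjugation-invariant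 $c:S\to\mathbb{C}$, the spherical subalgebra $\mathbf{e}H_{t,c}\mathbf{e}\subset H_{t,c}$ is commutative if and only if $t=0$. -/

import Mathlib

namespace SymplecticReflection

noncomputable section

universe u

/-- The symplectic group `Sp(V, ω)`: linear automorphisms of `V` preserving `ω`. -/
def Sp {V : Type u} [AddCommGroup V] [Module ℂ V] (ω : LinearMap.BilinForm ℂ V) :
    Subgroup (V ≃ₗ[ℂ] V) where
  carrier := {g | ∀ x y, ω (g x) (g y) = ω x y}
  mul_mem' {g h} hg hh x y := by
    simp only [LinearEquiv.mul_apply]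
    exact (hg _ _).trans (hh _ _)
  one_mem' _ _ := rfl
  inv_mem' {g} hg x y := by
    have h := hg (g⁻¹ x) (g⁻¹ y)
    have e : ∀ z, g (g⁻¹ z) = z := fun z => g.apply_symm_apply z
    rw [e, e] at h
    exact h.symm

/-- The endomorphism `Id - s` of `V`. -/
def idSub {V : Type u} [AddCommGroup V] [Module ℂ V] (s : V ≃ₗ[ℂ] V) : V →ₗ[ℂ] V :=
  LinearMap.id - (s : V →ₗ[ℂ] V)

lemma idSub_apply {V : Type u} [AddCommGroup V] [Module ℂ V] (s : V ≃ₗ[ℂ] V) (x : V) :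
    idSub s x = x - s x := rfl

/-- For `s` of finite order, `V = Im (Id - s) ⊕ Ker (Id - s)`. -/
lemma isCompl_range_ker {V : Type u} [AddCommGroup V] [Module ℂ V] (s : V ≃ₗ[ℂ] V)
    (hs : IsOfFinOrder s) :
    IsCompl (LinearMap.range (idSub s)) (LinearMap.ker (idSub s)) := by
  have hn : (orderOf s : ℂ) ≠ 0 := by exact_mod_cast hs.orderOf_pos.ne'
  have hfix : ∀ x : V, s x = x → ∀ i : ℕ, (s ^ i) x = x := by
    intro x hx i
    induction i with
    | zero => rfl
    | succ k ih => rw [pow_succ, LinearEquiv.mul_apply, hx, ih]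
  have hinv : ∀ x : V, ∑ i ∈ Finset.range (orderOf s), (s ^ i) (s x)
      = ∑ i ∈ Finset.range (orderOf s), (s ^ i) x := by
    intro x
    have h1 : ∀ i, (s ^ i) (s x) = (s ^ (i + 1)) x := fun i => by
      rw [pow_succ, LinearEquiv.mul_apply]
    simp only [h1]
    have h2 := Finset.sum_range_succ (fun i => (s ^ i) x) (orderOf s)
    rw [Finset.sum_range_succ', pow_orderOf_eq_one, pow_zero] at h2
    exact add_right_cancel h2
  have hinv' : ∀ x : V, s (∑ i ∈ Finset.range (orderOf s), (s ^ i) x)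
      = ∑ i ∈ Finset.range (orderOf s), (s ^ i) x := by
    intro x
    rw [map_sum, ← hinv x]
    refine Finset.sum_congr rfl fun i _ => ?_
    rw [← LinearEquiv.mul_apply, ← LinearEquiv.mul_apply, ← pow_succ, ← pow_succ']
  have hrange : ∀ (x : V) (i : ℕ), x - (s ^ i) x ∈ LinearMap.range (idSub s) := by
    intro x i
    induction i with
    | zero => simp
    | succ k ih =>
      have h : x - (s ^ (k + 1)) x = (x - (s ^ k) x) + idSub s ((s ^ k) x) := by
        rw [idSub_apply, pow_succ', LinearEquiv.mul_apply]; abel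
      rw [h]
      exact add_mem ih ⟨_, rfl⟩
  refine isCompl_iff.mpr ⟨?_, ?_⟩
  · rw [Submodule.disjoint_def]
    rintro x ⟨y, rfl⟩ hx
    rw [LinearMap.mem_ker] at hx
    have hx' : s (idSub s y) = idSub s y := (sub_eq_zero.mp hx).symm
    have h0 : ∑ i ∈ Finset.range (orderOf s), (s ^ i) (idSub s y) = 0 := by
      simp only [idSub_apply, map_sub, Finset.sum_sub_distrib]
      rw [hinv y, sub_self]
    rw [Finset.sum_congr rfl fun i _ => hfix _ hx' i, Finset.sum_const, Finset.card_range,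
      ← Nat.cast_smul_eq_nsmul ℂ] at h0
    exact (smul_eq_zero.mp h0).resolve_left hn
  · rw [codisjoint_iff, eq_top_iff]
    intro x _
    refine Submodule.mem_sup.mpr
      ⟨(orderOf s : ℂ)⁻¹ • ∑ i ∈ Finset.range (orderOf s), (x - (s ^ i) x),
        Submodule.smul_mem _ _ (Submodule.sum_mem _ fun i _ => hrange x i),
        (orderOf s : ℂ)⁻¹ • ∑ i ∈ Finset.range (orderOf s), (s ^ i) x,
        Submodule.smul_mem _ _ ?_, ?_⟩
    · rw [LinearMap.mem_ker, idSub_apply, hinv', sub_self]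
    · rw [← smul_add, ← Finset.sum_add_distrib]
      simp only [sub_add_cancel, Finset.sum_const, Finset.card_range]
      rw [← Nat.cast_smul_eq_nsmul ℂ, smul_smul, inv_mul_cancel₀ hn, one_smul]

/-- For `s` of finite order, the form `ω_s` on `V` which coincides with `ω` on `Im (Id - s)` and
vanishes as soon as one argument lies in `Ker (Id - s)`. -/
def reflForm {V : Type u} [AddCommGroup V] [Module ℂ V] (ω : LinearMap.BilinForm ℂ V)
    (s : V ≃ₗ[ℂ] V) (hs : IsOfFinOrder s) : LinearMap.BilinForm ℂ V :=
  ω.compl₁₂ (Submodule.projection _ _ (isCompl_range_ker s hs))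
    (Submodule.projection _ _ (isCompl_range_ker s hs))

lemma reflForm_of_mem_range {V : Type u} [AddCommGroup V] [Module ℂ V]
    (ω : LinearMap.BilinForm ℂ V) (s : V ≃ₗ[ℂ] V) (hs : IsOfFinOrder s) {x y : V}
    (hx : x ∈ LinearMap.range (idSub s)) (hy : y ∈ LinearMap.range (idSub s)) :
    reflForm ω s hs x y = ω x y := by
  simp only [reflForm, LinearMap.compl₁₂_apply]
  rw [Submodule.projection_apply_of_mem_left _ hx, Submodule.projection_apply_of_mem_left _ hy]

/-- For symplectic `s` the radical of `ω_s` is exactly `Ker (Id - s)`. -/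
lemma reflForm_radical {V : Type u} [AddCommGroup V] [Module ℂ V]
    (ω : LinearMap.BilinForm ℂ V) (hω : ω.Nondegenerate) (s : V ≃ₗ[ℂ] V) (hs : IsOfFinOrder s)
    (hsω : s ∈ Sp ω) (x : V) :
    (∀ y, reflForm ω s hs x y = 0) ↔ x ∈ LinearMap.ker (idSub s) := by
  have hP := Submodule.projectionOnto_apply_eq_zero_iff (isCompl_range_ker s hs) (x := x)
  have horth : ∀ a ∈ LinearMap.range (idSub s), ∀ b ∈ LinearMap.ker (idSub s), ω a b = 0 := by
    rintro a ⟨z, rfl⟩ b hb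
    have hb' : s b = b := (sub_eq_zero.mp (LinearMap.mem_ker.mp hb)).symm
    have h := hsω z b
    rw [hb'] at h
    rw [idSub_apply, map_sub, LinearMap.sub_apply, h, sub_self]
  rw [← hP, ← Submodule.coe_eq_zero, Submodule.coe_projectionOnto_apply]
  constructor
  · intro h
    refine hω.1 _ fun y => ?_
    have hy : y ∈ LinearMap.range (idSub s) ⊔ LinearMap.ker (idSub s) := by
      rw [(isCompl_range_ker s hs).sup_eq_top]; trivial
    obtain ⟨a, ha, b, hb, rfl⟩ := Submodule.mem_sup.mp hy
    rw [map_add, horth _ (Submodule.projection_apply_mem _ _) b hb, add_zero]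
    have h' := h a
    simp only [reflForm, LinearMap.compl₁₂_apply] at h'
    rwa [Submodule.projection_apply_of_mem_left _ ha] at h'
  · intro h y
    simp only [reflForm, LinearMap.compl₁₂_apply]
    rw [h, map_zero, LinearMap.zero_apply]

/-- The set `S` of symplectic reflections of `Γ`: elements `s` with `rk (Id - s) = 2`. -/
def reflections {V : Type u} [AddCommGroup V] [Module ℂ V] (Γ : Subgroup (V ≃ₗ[ℂ] V)) : Set Γ :=
  {s | Module.finrank ℂ (LinearMap.range (idSub (s : V ≃ₗ[ℂ] V))) = 2}

/-- The space `C` of functions on `S` invariant under conjugation by `Γ`. -/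
def reflParams {V : Type u} [AddCommGroup V] [Module ℂ V] (Γ : Subgroup (V ≃ₗ[ℂ] V)) :
    Submodule ℂ (reflections Γ → ℂ) where
  carrier := {c | ∀ (g : Γ) (s s' : reflections Γ), (s' : Γ) = g * s * g⁻¹ → c s' = c s}
  add_mem' {c d} hc hd g s s' h := by
    simp only [Pi.add_apply, hc g s s' h, hd g s s' h]
  zero_mem' _ _ _ _ := rfl
  smul_mem' r c hc g s s' h := by
    simp only [Pi.smul_apply, hc g s s' h]

/-- The algebra automorphism of the tensor algebra `TV` induced by `g : V ≃ V`
(as an algebra endomorphism). -/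
def tensorMap {V : Type u} [AddCommGroup V] [Module ℂ V] (g : V ≃ₗ[ℂ] V) :
    TensorAlgebra ℂ V →ₐ[ℂ] TensorAlgebra ℂ V :=
  TensorAlgebra.lift ℂ ((TensorAlgebra.ι ℂ).comp (g : V →ₗ[ℂ] V))

lemma tensorMap_one {V : Type u} [AddCommGroup V] [Module ℂ V] :
    tensorMap (1 : V ≃ₗ[ℂ] V) = AlgHom.id ℂ _ := by
  ext x
  simp [tensorMap]

lemma tensorMap_mul {V : Type u} [AddCommGroup V] [Module ℂ V] (g h : V ≃ₗ[ℂ] V) :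
    tensorMap (g * h) = (tensorMap g).comp (tensorMap h) := by
  ext x
  simp [tensorMap]

/-- The action of `Γ` on `TV` by algebra automorphisms extending its action on `V`. -/
instance tensorAction {V : Type u} [AddCommGroup V] [Module ℂ V] (Γ : Subgroup (V ≃ₗ[ℂ] V)) :
    MulSemiringAction Γ (TensorAlgebra ℂ V) where
  smul g a := tensorMap (g : V ≃ₗ[ℂ] V) a
  one_smul a := DFunLike.congr_fun tensorMap_one a
  mul_smul g h a := DFunLike.congr_fun (tensorMap_mul (g : V ≃ₗ[ℂ] V) h) a
  smul_zero g := map_zero (tensorMap (g : V ≃ₗ[ℂ] V))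
  smul_add g := map_add (tensorMap (g : V ≃ₗ[ℂ] V))
  smul_one g := map_one (tensorMap (g : V ≃ₗ[ℂ] V))
  smul_mul g := map_mul (tensorMap (g : V ≃ₗ[ℂ] V))

instance tensorAction_comm {V : Type u} [AddCommGroup V] [Module ℂ V]
    (Γ : Subgroup (V ≃ₗ[ℂ] V)) : SMulCommClass Γ ℂ (TensorAlgebra ℂ V) where
  smul_comm g r a := map_smul (tensorMap (g : V ≃ₗ[ℂ] V)) r a

/-- The smash product `TV # Γ`: formal sums `∑ a_g g` with `a_g ∈ TV`, `g ∈ Γ`, multiplied by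
`(a g) (b h) = (a (g • b)) (g h)`. -/
abbrev Smash {V : Type u} [AddCommGroup V] [Module ℂ V] (Γ : Subgroup (V ≃ₗ[ℂ] V)) : Type u :=
  SkewMonoidAlgebra (TensorAlgebra ℂ V) Γ

/-- The inclusion of `V` in `TV # Γ`. -/
def vec {V : Type u} [AddCommGroup V] [Module ℂ V] (Γ : Subgroup (V ≃ₗ[ℂ] V)) (x : V) : Smash Γ :=
  SkewMonoidAlgebra.single 1 (TensorAlgebra.ι ℂ x)

/-- The inclusion of the group algebra `ℂΓ` in `TV # Γ`. -/
def grp {V : Type u} [AddCommGroup V] [Module ℂ V] (Γ : Subgroup (V ≃ₗ[ℂ] V)) :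
    MonoidAlgebra ℂ Γ →ₐ[ℂ] Smash Γ :=
  MonoidAlgebra.lift ℂ (Smash Γ) Γ (SkewMonoidAlgebra.of (TensorAlgebra ℂ V) Γ)

/-- The relations `x ⊗ y - y ⊗ x = κ(x, y)`, for `x, y ∈ V`. -/
inductive Rel {V : Type u} [AddCommGroup V] [Module ℂ V] (Γ : Subgroup (V ≃ₗ[ℂ] V))
    (κ : V → V → MonoidAlgebra ℂ Γ) : Smash Γ → Smash Γ → Prop
  | comm (x y : V) : Rel Γ κ (vec Γ x * vec Γ y - vec Γ y * vec Γ x) (grp Γ (κ x y))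

/-- The algebra `H_κ`: the quotient of `TV # Γ` by the two-sided ideal generated by the elements
`x ⊗ y - y ⊗ x - κ(x, y)`. -/
abbrev HAlg {V : Type u} [AddCommGroup V] [Module ℂ V] (Γ : Subgroup (V ≃ₗ[ℂ] V))
    (κ : V → V → MonoidAlgebra ℂ Γ) : Type u :=
  RingQuot (Rel Γ κ)

/-- The pairing `κ(x, y) = t ω(x, y) 1 + ∑_{s ∈ S} c_s ω_s(x, y) s`. -/
def kappa {V : Type u} [AddCommGroup V] [Module ℂ V] (ω : LinearMap.BilinForm ℂ V)
    (Γ : Subgroup (V ≃ₗ[ℂ] V)) [Finite Γ] (t : ℂ) (c : reflParams Γ) (x y : V) :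
    MonoidAlgebra ℂ Γ :=
  (t * ω x y) • (1 : MonoidAlgebra ℂ Γ) +
    ∑ᶠ s : reflections Γ,
      ((c : reflections Γ → ℂ) s *
        reflForm ω ((s : Γ) : V ≃ₗ[ℂ] V)
          (Γ.subtype.isOfFinOrder (isOfFinOrder_of_finite (s : Γ))) x y) •
        MonoidAlgebra.of ℂ Γ (s : Γ)

/-- The symplectic reflection algebra `H_{t,c}`. -/
abbrev SRAlg {V : Type u} [AddCommGroup V] [Module ℂ V] (ω : LinearMap.BilinForm ℂ V)
    (Γ : Subgroup (V ≃ₗ[ℂ] V)) [Finite Γ] (t : ℂ) (c : reflParams Γ) : Type u :=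
  HAlg Γ (kappa ω Γ t c)

/-- The symmetriser `e = |Γ|⁻¹ ∑_{g ∈ Γ} g` in `ℂΓ`. -/
def symmetriser {V : Type u} [AddCommGroup V] [Module ℂ V] (Γ : Subgroup (V ≃ₗ[ℂ] V)) :
    MonoidAlgebra ℂ Γ :=
  (Nat.card Γ : ℂ)⁻¹ • ∑ᶠ g : Γ, MonoidAlgebra.of ℂ Γ g

/-- The symmetriser viewed as an element of `H_{t,c}`. -/
def eH {V : Type u} [AddCommGroup V] [Module ℂ V] (ω : LinearMap.BilinForm ℂ V)
    (Γ : Subgroup (V ≃ₗ[ℂ] V)) [Finite Γ] (t : ℂ) (c : reflParams Γ) : SRAlg ω Γ t c :=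
  RingQuot.mkAlgHom ℂ (Rel Γ (kappa ω Γ t c)) (grp Γ (symmetriser Γ))

/-- The spherical subalgebra `e H_{t,c} e = {e h e : h ∈ H_{t,c}}` (it need not contain the unit
of `H_{t,c}`). -/
def sphericalSubalgebra {V : Type u} [AddCommGroup V] [Module ℂ V] (ω : LinearMap.BilinForm ℂ V)
    (Γ : Subgroup (V ≃ₗ[ℂ] V)) [Finite Γ] (t : ℂ) (c : reflParams Γ) :
    NonUnitalSubalgebra ℂ (SRAlg ω Γ t c) where
  carrier := Set.range fun h => eH ω Γ t c * h * eH ω Γ t c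
  add_mem' := by
    rintro _ _ ⟨a, rfl⟩ ⟨b, rfl⟩
    exact ⟨a + b, by simp only [mul_add, add_mul]⟩
  zero_mem' := ⟨0, by simp only [mul_zero, zero_mul]⟩
  mul_mem' := by
    rintro _ _ ⟨a, rfl⟩ ⟨b, rfl⟩
    exact ⟨a * eH ω Γ t c * eH ω Γ t c * b, by simp only [mul_assoc]⟩
  smul_mem' := by
    rintro r _ ⟨a, rfl⟩
    exact ⟨r • a, by simp only [mul_smul_comm, smul_mul_assoc]⟩

end

end SymplecticReflection

/-!
The proof compares the spherical subalgebra `e H e` with the algebra of invariants `(SV)^Γ`.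

The pairing `κ = t ω + ∑ c_s ω_s s` is equivariant and satisfies the Jacobi identity, because the
range of `Id - s` is a plane for every symplectic reflection `s`. Hence `H` has a
Poincaré-Birkhoff-Witt basis (`SmashData.J_inf_F`), and `f ↦ f e` identifies `(SV)^Γ` with `e H e`
as filtered vector spaces, through a `Γ`-equivariant lift of polynomials to `TV # Γ`. The product of
`e H e` becomes a deformed product `star` on `(SV)^Γ`: it is the commutative product up to terms of
lower degree, and the commutator of invariants of degrees `m` and `n` is `t {f, h}`, with the Poisson
bracket of `ω`, up to terms of degree at most `m + n - 3` (`SmashData.isDeformedProduct`). The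
reflections do not contribute to the part of degree `m + n - 2`: by the Jacobi identity, the
contribution of `s`, multiplied by `s z - z`, is a combination of `s f - f` and `s h - h`
(`SmashData.mul_wordBr`), which are zero.

If `e H e` is commutative, then `t {f, h} = 0` for all invariants. A derivation of `SV` is
determined by its values on the invariants (`IsLinearAction.derivation_eq`), so `t ω = 0`, and
`t = 0`.

If `t = 0`, all commutators of `star` lower the degree by at least three. If they lower it by
`k ≥ 3`, then their parts of degree exactly `m + n - k` form a skew biderivation of `(SV)^Γ`. No
nontrivial element of `Γ` fixes a hyperplane pointwise, since `Γ` is symplectic; therefore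
derivations of `(SV)^Γ` extend to `SV`, and so does this biderivation
(`IsLinearAction.bracket_eq_zero`). On two vectors of `V` it takes values of degree `2 - k < 0`, so
it is zero and the commutators lower the degree by `k + 1` (`IsDeformedProduct.comm_lowers`).
Consequently they lower the degree by any amount, and are zero.

Derivations of `SV` are controlled by the orbit polynomial `p = ∏_g (X - g y)` of a vector `y` with
trivial stabiliser, whose coefficients are invariants: differentiating `p(y) = 0` gives
`p'(y) D y = -∑ y ^ i D c_i`. This determines `D y`, bounds its degree, and bounds its denominator
by `p'(y) = ∏_{g ≠ 1} (y - g y)`. If no `g ≠ 1` fixes a hyperplane, then for each prime `q` of `SV`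
the vectors `y` for which `q` does not divide `p'(y)` span `V`, so `D` has no denominator at all.
-/

/-! ### The smash product and the Poincaré–Birkhoff–Witt theorem -/

namespace SymplecticReflection

noncomputable section

open Module

/-- A smash product `A = TV # Γ` together with the data of a pairing `κ = ∑_g k_g g`. The algebra
`A` is described by its basis: the products of a word in the basis `b` of `V` and an element
of `Γ`. The forms `k_g` are alternating and `Γ`-equivariant, and each of them satisfies the
Jacobi identity `k_s(x, y) (s z - z) + cyclic = 0`; these are the conditions under which the
quotient of `A` by the relations `x y - y x = κ(x, y)` has the size of `SV # Γ`. -/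
structure SmashData (ι V Γ A : Type*) [AddCommGroup V] [Module ℂ V] [Group Γ] [Ring A]
    [Algebra ℂ A] where
  b : Basis ι ℂ V
  act : Γ →* (V ≃ₗ[ℂ] V)
  vec : V →ₗ[ℂ] A
  gr : Γ →* A
  gr_vec : ∀ g x, gr g * vec x = vec (act g x) * gr g
  basis : Basis (List ι × Γ) ℂ A
  basis_apply : ∀ w g, basis (w, g) = (w.map fun i => vec (b i)).prod * gr g
  k : Γ → LinearMap.BilinForm ℂ V
  k_self : ∀ g x, k g x x = 0
  jacobi : ∀ s x y z, k s x y • (act s z - z) + k s y z • (act s x - x)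
    + k s z x • (act s y - y) = 0
  k_conj : ∀ h g x y, k (h * g * h⁻¹) (act h x) (act h y) = k g x y

namespace SmashData

variable {ι V Γ A : Type*} [AddCommGroup V] [Module ℂ V] [Group Γ] [Ring A] [Algebra ℂ A]
variable (S : SmashData ι V Γ A)

lemma k_swap (g : Γ) (x y : V) : S.k g x y = -S.k g y x := by
  have h := S.k_self g (x + y)
  simp only [map_add, LinearMap.add_apply, S.k_self, zero_add, add_zero] at h
  exact eq_neg_of_add_eq_zero_right h

/-- The product in `A` of a list of vectors. -/
def lp (l : List V) : A := (l.map S.vec).prod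

/-- The product in `A` of a word in the basis vectors. -/
def word (w : List ι) : A := (w.map fun i => S.vec (S.b i)).prod

@[simp] lemma word_nil : S.word [] = 1 := rfl

@[simp] lemma word_cons (i : ι) (w : List ι) : S.word (i :: w) = S.vec (S.b i) * S.word w := by
  simp [word]

lemma word_append (u w : List ι) : S.word (u ++ w) = S.word u * S.word w := by
  simp [word]

lemma basis_eq (w : List ι) (g : Γ) : S.basis (w, g) = S.word w * S.gr g := S.basis_apply w g

/-- The elements of `A` of tensor degree at most `n`. -/
def F (n : ℕ) : Submodule ℂ A :=
  Submodule.span ℂ {z | ∃ w g, w.length ≤ n ∧ z = S.word w * S.gr g}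

lemma word_mem_F {w : List ι} {n : ℕ} (h : w.length ≤ n) (g : Γ) : S.word w * S.gr g ∈ S.F n :=
  Submodule.subset_span ⟨w, g, h, rfl⟩

lemma word_mem_F' {w : List ι} {n : ℕ} (h : w.length ≤ n) : S.word w ∈ S.F n := by
  simpa using S.word_mem_F h 1

lemma F_mono {m n : ℕ} (h : m ≤ n) : S.F m ≤ S.F n :=
  Submodule.span_mono fun _ ⟨w, g, hw, e⟩ => ⟨w, g, hw.trans h, e⟩

lemma F_induction {n : ℕ} {p : A → Prop} (h0 : p 0) (ha : ∀ x y, p x → p y → p (x + y))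
    (hs : ∀ (r : ℂ) x, p x → p (r • x))
    (hw : ∀ w g, w.length ≤ n → p (S.word w * S.gr g)) {z : A} (hz : z ∈ S.F n) : p z := by
  refine Submodule.span_induction ?_ h0 (fun x y _ _ => ha x y) (fun r x _ => hs r x) hz
  rintro _ ⟨w, g, h, rfl⟩
  exact hw w g h

lemma vec_mem_of_basis {p : Submodule ℂ A} (f : A →ₗ[ℂ] A)
    (h : ∀ i, f (S.vec (S.b i)) ∈ p) (x : V) : f (S.vec x) ∈ p := by
  have : (⊤ : Submodule ℂ V) ≤ p.comap (f ∘ₗ S.vec) := by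
    rw [← S.b.span_eq, Submodule.span_le]
    rintro _ ⟨i, rfl⟩
    exact h i
  exact this trivial

lemma vec_mul_mem_F {n : ℕ} {z : A} (hz : z ∈ S.F n) (x : V) : S.vec x * z ∈ S.F (n + 1) := by
  refine S.vec_mem_of_basis (LinearMap.mulRight ℂ z) (fun i => ?_) x
  refine S.F_induction (p := fun z => S.vec (S.b i) * z ∈ S.F (n + 1)) (by simp)
    (fun x y hx hy => by rw [mul_add]; exact add_mem hx hy)
    (fun r x hx => by rw [mul_smul_comm]; exact Submodule.smul_mem _ _ hx) ?_ hz
  intro w g hw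
  rw [← mul_assoc, ← word_cons]
  exact S.word_mem_F (by simpa using hw) g

lemma lp_mul_mem_F {n : ℕ} {z : A} (hz : z ∈ S.F n) (l : List V) :
    S.lp l * z ∈ S.F (n + l.length) := by
  induction l with
  | nil => simpa [lp] using hz
  | cons x l ih =>
    have h := S.vec_mul_mem_F ih x
    simpa [lp, mul_assoc, add_assoc] using h

lemma gr_mul_lp (g : Γ) (l : List V) : S.gr g * S.lp l = S.lp (l.map (S.act g)) * S.gr g := by
  induction l with
  | nil => simp [lp]
  | cons x l ih =>
    simp only [lp, List.map_cons, List.prod_cons] at ih ⊢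
    rw [← mul_assoc, S.gr_vec, mul_assoc, ih, mul_assoc]

lemma word_eq_lp (w : List ι) : S.word w = S.lp (w.map S.b) := by
  simp [word, lp, Function.comp_def]

lemma mul_mem_F {m n : ℕ} {y z : A} (hy : y ∈ S.F m) (hz : z ∈ S.F n) : y * z ∈ S.F (m + n) := by
  refine S.F_induction (p := fun y => y * z ∈ S.F (m + n)) (by simp)
    (fun x y hx hy => by rw [add_mul]; exact add_mem hx hy)
    (fun r x hx => by rw [smul_mul_assoc]; exact Submodule.smul_mem _ _ hx) ?_ hy
  intro w g hw
  refine S.F_induction (p := fun z => S.word w * S.gr g * z ∈ S.F (m + n)) (by simp)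
    (fun x y hx hy => by rw [mul_add]; exact add_mem hx hy)
    (fun r x hx => by rw [mul_smul_comm]; exact Submodule.smul_mem _ _ hx) ?_ hz
  intro w' g' hw'
  have e : S.word w * S.gr g * (S.word w' * S.gr g')
      = S.lp ((w.map S.b) ++ (w'.map S.b).map (S.act g)) * S.gr (g * g') := by
    have h := S.gr_mul_lp g (w'.map S.b)
    rw [word_eq_lp, word_eq_lp, mul_assoc, ← mul_assoc (S.gr g), h]
    simp [lp, mul_assoc]
  rw [e]
  have h1 : S.gr (g * g') ∈ S.F 0 := by simpa using S.word_mem_F (w := []) (n := 0) le_rfl (g * g')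
  exact S.F_mono (by simp; omega) (S.lp_mul_mem_F h1 _)

lemma gr_mem_F (g : Γ) : S.gr g ∈ S.F 0 := by
  simpa using S.word_mem_F (w := []) (n := 0) le_rfl g

lemma vec_mem_F (x : V) : S.vec x ∈ S.F 1 := by
  have := S.vec_mul_mem_F (S.gr_mem_F 1) x
  simpa using this

lemma mem_F_some (z : A) : ∃ n, z ∈ S.F n := by
  have h : z ∈ Submodule.span ℂ (Set.range S.basis) := by rw [S.basis.span_eq]; trivial
  refine Submodule.span_induction ?_ ⟨0, zero_mem _⟩ ?_ ?_ h
  · rintro _ ⟨⟨w, g⟩, rfl⟩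
    exact ⟨w.length, by rw [basis_eq]; exact S.word_mem_F le_rfl g⟩
  · rintro x y _ _ ⟨m, hm⟩ ⟨n, hn⟩
    exact ⟨max m n, add_mem (S.F_mono (le_max_left _ _) hm) (S.F_mono (le_max_right _ _) hn)⟩
  · rintro r x _ ⟨n, hn⟩
    exact ⟨n, Submodule.smul_mem _ _ hn⟩

variable [Fintype Γ]

/-- The pairing `κ(x, y) = ∑_g k_g(x, y) g`. -/
def κ : V →ₗ[ℂ] V →ₗ[ℂ] A :=
  ∑ g, (S.k g).compr₂ (LinearMap.toSpanSingleton ℂ A (S.gr g))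

lemma κ_apply (x y : V) : S.κ x y = ∑ g, S.k g x y • S.gr g := by
  simp [κ]

lemma κ_swap (x y : V) : S.κ x y = -S.κ y x := by
  simp only [κ_apply]
  rw [← Finset.sum_neg_distrib]
  exact Finset.sum_congr rfl fun g _ => by rw [S.k_swap, neg_smul]

lemma κ_self (x : V) : S.κ x x = 0 := by simp [κ_apply, S.k_self]

lemma κ_mem_F (x y : V) : S.κ x y ∈ S.F 0 := by
  rw [κ_apply]
  exact Submodule.sum_mem _ fun g _ => Submodule.smul_mem _ _ (S.gr_mem_F g)

lemma gr_mul_κ (h : Γ) (x y : V) : S.gr h * S.κ x y = S.κ (S.act h x) (S.act h y) * S.gr h := by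
  simp only [κ_apply, Finset.mul_sum, Finset.sum_mul]
  refine Fintype.sum_equiv (MulAut.conj h).toEquiv _ _ fun g => ?_
  simp only [MulEquiv.toEquiv_eq_coe, EquivLike.coe_coe, MulAut.conj_apply]
  rw [S.k_conj, mul_smul_comm, smul_mul_assoc, ← map_mul, ← map_mul]
  simp

/-- The defining relator `x y - y x - κ(x, y)`. -/
def rel : V →ₗ[ℂ] V →ₗ[ℂ] A :=
  (LinearMap.mul ℂ A).compl₁₂ S.vec S.vec - ((LinearMap.mul ℂ A).compl₁₂ S.vec S.vec).flip - S.κ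

lemma rel_apply (x y : V) : S.rel x y = S.vec x * S.vec y - S.vec y * S.vec x - S.κ x y := by
  simp [rel]

lemma gr_mul_rel (h : Γ) (x y : V) :
    S.gr h * S.rel x y = S.rel (S.act h x) (S.act h y) * S.gr h := by
  simp only [rel_apply, mul_sub, sub_mul, gr_mul_κ]
  rw [← mul_assoc, ← mul_assoc, S.gr_vec, S.gr_vec, mul_assoc, mul_assoc, S.gr_vec, S.gr_vec]
  simp only [mul_assoc]

/-- The Jacobi identity for `κ`. -/
lemma κ_jacobi (x y z : V) :
    (S.κ x y * S.vec z - S.vec z * S.κ x y) + (S.κ y z * S.vec x - S.vec x * S.κ y z)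
      + (S.κ z x * S.vec y - S.vec y * S.κ z x) = 0 := by
  have e : ∀ x y z : V, S.κ x y * S.vec z - S.vec z * S.κ x y
      = ∑ s, S.vec (S.k s x y • (S.act s z - z)) * S.gr s := by
    intro x y z
    rw [κ_apply, Finset.sum_mul, Finset.mul_sum, ← Finset.sum_sub_distrib]
    refine Finset.sum_congr rfl fun s _ => ?_
    rw [smul_mul_assoc, S.gr_vec, mul_smul_comm, map_smul, map_sub, smul_mul_assoc, sub_mul,
      smul_sub]
  rw [e, e, e, ← Finset.sum_add_distrib, ← Finset.sum_add_distrib]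
  refine Finset.sum_eq_zero fun s _ => ?_
  rw [← add_mul, ← add_mul, ← map_add, ← map_add, S.jacobi, map_zero, zero_mul]

/-- The consequences of the defining relations that can be derived within tensor degree `n`. The
union of the `J n` is the two-sided ideal generated by the relators. -/
def J (n : ℕ) : Submodule ℂ A :=
  Submodule.span ℂ {z | ∃ u i j w g, u.length + w.length + 2 ≤ n ∧
    z = S.word u * S.rel (S.b i) (S.b j) * (S.word w * S.gr g)}

lemma J_mono {m n : ℕ} (h : m ≤ n) : S.J m ≤ S.J n :=
  Submodule.span_mono fun _ ⟨u, i, j, w, g, hw, e⟩ => ⟨u, i, j, w, g, hw.trans h, e⟩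

lemma mul_rel_mul_mem_J {p q n : ℕ} (h : p + q + 2 ≤ n) {y z : A} (hy : y ∈ S.F p)
    (hz : z ∈ S.F q) (x x' : V) : y * S.rel x x' * z ∈ S.J n := by
  have h1 : ∀ u : List ι, u.length ≤ p → ∀ z ∈ S.F q, ∀ x x',
      S.word u * S.rel x x' * z ∈ S.J n := by
    intro u hu z hz x x'
    refine S.F_induction (p := fun z => S.word u * S.rel x x' * z ∈ S.J n) (by simp)
      (fun x y hx hy => by rw [mul_add]; exact add_mem hx hy)
      (fun r x hx => by rw [mul_smul_comm]; exact Submodule.smul_mem _ _ hx) ?_ hz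
    intro w g hw
    have key : ∀ (B : V →ₗ[ℂ] V →ₗ[ℂ] A), (∀ i j, B (S.b i) (S.b j) ∈ S.J n) →
        B x x' ∈ S.J n := by
      intro B hB
      have t1 : ∀ i, (⊤ : Submodule ℂ V) ≤ (S.J n).comap (B (S.b i)) := fun i => by
        rw [← S.b.span_eq, Submodule.span_le]
        rintro _ ⟨j, rfl⟩
        exact hB i j
      have t2 : (⊤ : Submodule ℂ V) ≤ (S.J n).comap (B.flip x') := by
        rw [← S.b.span_eq, Submodule.span_le]
        rintro _ ⟨i, rfl⟩
        exact t1 i trivial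
      exact t2 trivial
    refine key (S.rel.compr₂ (LinearMap.mulRight ℂ (S.word w * S.gr g) ∘ₗ
      LinearMap.mulLeft ℂ (S.word u))) fun i j => ?_
    exact Submodule.subset_span ⟨u, i, j, w, g, by omega, rfl⟩
  refine S.F_induction (p := fun y => y * S.rel x x' * z ∈ S.J n) (by simp)
    (fun x y hx hy => by rw [add_mul, add_mul]; exact add_mem hx hy)
    (fun r x hx => by rw [smul_mul_assoc, smul_mul_assoc]; exact Submodule.smul_mem _ _ hx) ?_ hy
  intro u g hu
  rw [mul_assoc (S.word u), S.gr_mul_rel, ← mul_assoc, mul_assoc]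
  exact h1 u hu _ (by simpa using S.mul_mem_F (S.gr_mem_F g) hz) _ _

lemma mul_J_mul {p q n : ℕ} {y z a : A} (hy : y ∈ S.F p) (hz : z ∈ S.F q) (ha : a ∈ S.J n) :
    y * a * z ∈ S.J (p + n + q) := by
  refine Submodule.span_induction (p := fun a _ => y * a * z ∈ S.J (p + n + q)) ?_ (by simp)
    (fun x y _ _ hx hy => by rw [mul_add, add_mul]; exact add_mem hx hy)
    (fun r x _ hx => by rw [mul_smul_comm, smul_mul_assoc]; exact Submodule.smul_mem _ _ hx) ha
  rintro _ ⟨u, i, j, w, g, h, rfl⟩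
  have e : y * (S.word u * S.rel (S.b i) (S.b j) * (S.word w * S.gr g)) * z
      = (y * S.word u) * S.rel (S.b i) (S.b j) * (S.word w * S.gr g * z) := by
    simp only [mul_assoc]
  rw [e]
  exact S.mul_rel_mul_mem_J (p := p + u.length) (q := w.length + q) (by omega)
    (S.mul_mem_F hy (S.word_mem_F' le_rfl)) (S.mul_mem_F (S.word_mem_F le_rfl g) hz) _ _

lemma mul_J {p n m : ℕ} {y a : A} (hy : y ∈ S.F p) (ha : a ∈ S.J n) (h : p + n ≤ m) :
    y * a ∈ S.J m := by
  have := S.mul_J_mul hy (S.word_mem_F' (w := []) (n := 0) le_rfl) ha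
  exact S.J_mono (by simpa using h) (by simpa using this)

lemma J_mul {p n m : ℕ} {y a : A} (hy : y ∈ S.F p) (ha : a ∈ S.J n) (h : n + p ≤ m) :
    a * y ∈ S.J m := by
  have := S.mul_J_mul (S.word_mem_F' (w := []) (n := 0) le_rfl) hy ha
  exact S.J_mono (by simpa using h) (by simpa using this)

lemma rel_mem_F (x y : V) : S.rel x y ∈ S.F 2 := by
  rw [rel_apply]
  have h : ∀ x y, S.vec x * S.vec y ∈ S.F 2 := by
    intro x y
    have h := S.mul_mem_F (S.vec_mem_F x) (S.vec_mem_F y)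
    rwa [one_add_one_eq_two] at h
  exact sub_mem (sub_mem (h x y) (h y x)) (S.F_mono (by omega) (S.κ_mem_F x y))

lemma word_κ_word_mem_F (u w : List ι) (g : Γ) (x y : V) :
    S.word u * S.κ x y * (S.word w * S.gr g) ∈ S.F (u.length + 0 + w.length) :=
  S.mul_mem_F (S.mul_mem_F (S.word_mem_F' le_rfl) (S.κ_mem_F x y)) (S.word_mem_F le_rfl g)

lemma word_rel_word_eq (u w : List ι) (i j : ι) (g : Γ) :
    S.word u * S.rel (S.b i) (S.b j) * (S.word w * S.gr g)
      = S.word (u ++ i :: j :: w) * S.gr g - S.word (u ++ j :: i :: w) * S.gr g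
        - S.word u * S.κ (S.b i) (S.b j) * (S.word w * S.gr g) := by
  simp only [rel_apply, word_append, word_cons]
  noncomm_ring

lemma gr_right_mem_J {n : ℕ} {a : A} (h : a ∈ S.J n) (g : Γ) : a * S.gr g ∈ S.J n :=
  S.J_mul (S.gr_mem_F g) h le_rfl

variable [LinearOrder ι]

/-- The terms of lower degree produced when the basis vector `x_i`, standing in front of a sorted
word, is moved into its place by the defining relations. -/
def cost (i : ι) : List ι → A
  | [] => 0
  | k :: v => if i ≤ k then 0 else S.κ (S.b i) (S.b k) * S.word v + S.vec (S.b k) * cost i v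

/-- The terms of lower degree produced when a word is sorted by insertion, by means of the defining
relations. -/
def psi : List ι → A
  | [] => 0
  | i :: w => S.vec (S.b i) * psi w + S.cost i (w.insertionSort (· ≤ ·))

lemma cost_mem_F (i : ι) (v : List ι) : ∀ n, v.length ≤ n + 1 → S.cost i v ∈ S.F n := by
  induction v with
  | nil => intro n _; exact zero_mem _
  | cons k v ih =>
    intro n hn
    simp only [cost]
    split_ifs with h
    · exact zero_mem _
    · simp only [List.length_cons, add_le_add_iff_right] at hn
      refine add_mem ?_ ?_
      · simpa using S.mul_mem_F (S.κ_mem_F _ _) (S.word_mem_F' hn)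
      · cases n with
        | zero =>
          rw [List.length_eq_zero_iff.mp (Nat.le_zero.mp hn)]
          simp [cost]
        | succ n => exact S.vec_mul_mem_F (ih n hn) _

lemma psi_mem_F (w : List ι) : ∀ n, w.length ≤ n + 2 → S.psi w ∈ S.F n := by
  induction w with
  | nil => intro n _; exact zero_mem _
  | cons i w ih =>
    intro n hn
    simp only [List.length_cons] at hn
    refine add_mem ?_ (S.cost_mem_F i _ n (by rw [List.length_insertionSort]; omega))
    cases n with
    | zero =>
      match w, hn with
      | [], _ => simp [psi]
      | [j], _ => simp [psi, cost]
    | succ n => exact S.vec_mul_mem_F (ih n (by omega)) _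

lemma word_sub_insert_mem_J (i : ι) (v : List ι) :
    S.word (i :: v) - S.word (v.orderedInsert (· ≤ ·) i) - S.cost i v ∈ S.J (v.length + 1) := by
  induction v with
  | nil => simp [cost]
  | cons k v ih =>
    simp only [cost, List.orderedInsert_cons]
    split_ifs with h
    · simp
    · have e : S.word (i :: k :: v) - S.word (k :: v.orderedInsert (· ≤ ·) i)
          - (S.κ (S.b i) (S.b k) * S.word v + S.vec (S.b k) * S.cost i v)
          = 1 * S.rel (S.b i) (S.b k) * S.word v + S.vec (S.b k) *
            (S.word (i :: v) - S.word (v.orderedInsert (· ≤ ·) i) - S.cost i v) := by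
        simp only [word_cons, rel_apply]
        noncomm_ring
      rw [e]
      refine add_mem ?_ (S.mul_J (S.vec_mem_F _) ih (by simp; omega))
      exact S.mul_rel_mul_mem_J (p := 0) (q := v.length) (by simp)
        (S.word_mem_F' (w := []) le_rfl) (S.word_mem_F' le_rfl) _ _

lemma word_sub_sort_mem_J (w : List ι) :
    S.word w - S.word (w.insertionSort (· ≤ ·)) - S.psi w ∈ S.J w.length := by
  induction w with
  | nil => simp [psi]
  | cons i w ih =>
    have h := S.word_sub_insert_mem_J i (w.insertionSort (· ≤ ·))
    have h2 := S.mul_J (S.vec_mem_F (S.b i)) ih (m := w.length + 1) (by omega)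
    rw [List.length_insertionSort] at h
    have := add_mem h h2
    rw [word_cons] at this
    simp only [List.length_cons, psi, List.insertionSort_cons, word_cons]
    convert this using 1
    noncomm_ring

/-- The overlap of two insertions: this is where the Jacobi identity enters. -/
lemma cost_overlap (i j : ι) (v : List ι) :
    S.vec (S.b i) * S.cost j v + S.cost i (v.orderedInsert (· ≤ ·) j)
      - S.vec (S.b j) * S.cost i v - S.cost j (v.orderedInsert (· ≤ ·) i)
      - S.κ (S.b i) (S.b j) * S.word v ∈ S.J (v.length + 1) := by
  -- by antisymmetry it is enough to treat `j < i`
  wlog hij : j < i generalizing i j with H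
  · rcases lt_or_eq_of_le (not_lt.mp hij) with h | rfl
    · have := neg_mem (H j i h)
      convert this using 1
      rw [S.κ_swap (S.b j)]
      noncomm_ring
    · simp [S.κ_self]
  induction v with
  | nil => simp [cost, not_le.mpr hij, hij.le]
  | cons k v ih =>
    by_cases hk : j ≤ k
    · rw [List.orderedInsert_cons, if_pos hk]
      have e1 : S.cost j (k :: v) = 0 := by simp [cost, hk]
      have e2 : S.cost j ((k :: v).orderedInsert (· ≤ ·) i) = 0 := by
        rw [List.orderedInsert_cons]
        split_ifs
        · simp [cost, hij.le]
        · simp [cost, hk]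
      have e3 : S.cost i (j :: k :: v)
          = S.κ (S.b i) (S.b j) * S.word (k :: v) + S.vec (S.b j) * S.cost i (k :: v) := by
        rw [cost, if_neg (not_le.mpr hij)]
      rw [e1, e2, e3]
      simp
    · have hik : ¬ i ≤ k := fun h => hk (hij.le.trans h)
      rw [List.orderedInsert_cons, if_neg hk, List.orderedInsert_cons, if_neg hik]
      simp only [cost, if_neg hk, if_neg hik]
      have h1 := S.mul_J (S.vec_mem_F (S.b k)) ih (m := v.length + 1 + 1) (by omega)
      have h2 := S.mul_J (S.κ_mem_F (S.b i) (S.b k)) (S.word_sub_insert_mem_J j v)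
        (m := v.length + 1 + 1) (by omega)
      have h3 := S.mul_J (S.κ_mem_F (S.b j) (S.b k)) (S.word_sub_insert_mem_J i v)
        (m := v.length + 1 + 1) (by omega)
      have hc : ∀ i j k : ι, S.rel (S.b i) (S.b k) * S.cost j v ∈ S.J (v.length + 1 + 1) := by
        intro i j k
        rcases Nat.eq_zero_or_pos v.length with h0 | h0
        · rw [List.length_eq_zero_iff.mp h0]
          simp [cost]
        · have := S.mul_rel_mul_mem_J (p := 0) (q := v.length - 1) (n := v.length + 1 + 1)
            (by omega) (S.word_mem_F' (w := []) le_rfl)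
            (S.cost_mem_F j v (v.length - 1) (by omega)) (S.b i) (S.b k)
          simpa using this
      have h4 := hc i j k
      have h5 := hc j i k
      have hJ := S.κ_jacobi (S.b i) (S.b j) (S.b k)
      rw [S.κ_swap (S.b k) (S.b i)] at hJ
      have hJ' := congrArg (· * S.word v) hJ
      simp only [zero_mul] at hJ'
      have := sub_mem (add_mem (sub_mem h1 h2) (add_mem h3 h4)) h5
      simp only [List.length_cons]
      rw [← sub_zero (_ - _ + _ - _)] at this
      rw [← hJ'] at this
      convert this using 1
      simp only [rel_apply, word_cons]
      noncomm_ring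

/-- Exchanging two adjacent letters changes the correction `psi` as the defining relation
prescribes, up to consequences of lower degree. -/
lemma psi_swap (u : List ι) (i j : ι) (w : List ι) :
    S.psi (u ++ i :: j :: w) - S.psi (u ++ j :: i :: w)
      - S.word u * S.κ (S.b i) (S.b j) * S.word w ∈ S.J (u.length + w.length + 1) := by
  induction u with
  | nil =>
    have h1 := S.cost_overlap i j (w.insertionSort (· ≤ ·))
    have h2 := S.mul_J (S.κ_mem_F (S.b i) (S.b j)) (S.word_sub_sort_mem_J w)
      (m := w.length + 1) (by omega)
    have h3 : S.rel (S.b i) (S.b j) * S.psi w ∈ S.J (w.length + 1) := by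
      match w with
      | [] => simp [psi]
      | [l] => simp [psi, cost]
      | k :: l :: w =>
        have := S.mul_rel_mul_mem_J (p := 0) (q := w.length) (n := w.length + 2 + 1)
          (by omega) (S.word_mem_F' (w := []) le_rfl)
          (S.psi_mem_F (k :: l :: w) w.length (by simp)) (S.b i) (S.b j)
        simpa using this
    rw [List.length_insertionSort] at h1
    have := add_mem (sub_mem h1 h2) h3
    simp only [List.nil_append, List.length_nil, zero_add, word_nil, psi, List.insertionSort_cons]
    convert this using 1
    simp only [rel_apply]
    noncomm_ring
  | cons k u ih =>
    have hs : (u ++ i :: j :: w).insertionSort (· ≤ ·)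
        = (u ++ j :: i :: w).insertionSort (· ≤ ·) := by
      refine List.Perm.eq_of_pairwise (le := (· ≤ ·)) (fun a b _ _ => le_antisymm) ?_ ?_ ?_
      · exact List.pairwise_insertionSort _ _
      · exact List.pairwise_insertionSort _ _
      · exact (List.perm_insertionSort _ _).trans
          (((List.Perm.swap j i w).append_left u).trans (List.perm_insertionSort _ _).symm)
    have := S.mul_J (S.vec_mem_F (S.b k)) ih (m := u.length + 1 + w.length + 1) (by omega)
    simp only [List.cons_append, List.length_cons, psi, word_cons, hs]
    convert this using 1
    noncomm_ring

/-- A consequence of the relations derived in degree `n + 1` which has degree at most `n` can be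
derived in degree `n`. -/
lemma J_succ_inf_F {n : ℕ} {z : A} (hJ : z ∈ S.J (n + 1)) (hF : z ∈ S.F n) : z ∈ S.J n := by
  -- `Q` replaces the words of length `n + 1` by their corrections and fixes the shorter words
  obtain ⟨Q, hQ⟩ : ∃ Q : A →ₗ[ℂ] A, ∀ w g, Q (S.word w * S.gr g)
      = if w.length = n + 1 then S.psi w * S.gr g else S.word w * S.gr g :=
    ⟨S.basis.constr ℂ fun p =>
      if p.1.length = n + 1 then S.psi p.1 * S.gr p.2 else S.word p.1 * S.gr p.2,
      fun w g => by rw [← basis_eq, Module.Basis.constr_basis, basis_eq]⟩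
  have hQF : ∀ m ≤ n, ∀ y ∈ S.F m, Q y = y := by
    intro m hm y hy
    refine S.F_induction (p := fun y => Q y = y) (map_zero _)
      (fun x y hx hy => by rw [map_add, hx, hy]) (fun r x hx => by rw [map_smul, hx]) ?_ hy
    intro w g hw
    rw [hQ, if_neg (by omega)]
  have hQJ : S.J (n + 1) ≤ (S.J n).comap Q := by
    refine Submodule.span_le.mpr ?_
    rintro _ ⟨u, i, j, w, g, h, rfl⟩
    rw [SetLike.mem_coe, Submodule.mem_comap]
    rcases Nat.lt_or_ge (u.length + w.length + 2) (n + 1) with h' | h'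
    · have hm : S.word u * S.rel (S.b i) (S.b j) * (S.word w * S.gr g) ∈ S.F n := by
        have h1 := S.mul_mem_F (S.word_mem_F' (w := u) le_rfl) (S.rel_mem_F (S.b i) (S.b j))
        have h2 := S.mul_mem_F h1 (S.word_mem_F (w := w) le_rfl g)
        exact S.F_mono (by omega) h2
      rw [hQF n le_rfl _ hm]
      exact Submodule.subset_span ⟨u, i, j, w, g, by omega, rfl⟩
    · have hk : S.word u * S.κ (S.b i) (S.b j) * (S.word w * S.gr g)
          ∈ S.F (u.length + 0 + w.length) :=
        S.word_κ_word_mem_F u w g (S.b i) (S.b j)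
      rw [S.word_rel_word_eq, map_sub, map_sub, hQ, hQ, hQF _ (by omega) _ hk,
        if_pos (by simp; omega), if_pos (by simp; omega)]
      have := S.gr_right_mem_J (S.psi_swap u i j w) g
      refine S.J_mono (by omega : u.length + w.length + 1 ≤ n) ?_
      convert this using 1
      noncomm_ring
  have := hQJ hJ
  rwa [Submodule.mem_comap, hQF n le_rfl z hF] at this

/-- The Poincaré-Birkhoff-Witt property: a consequence of the relations which has degree at
most `n` can be derived in degree `n`. -/
lemma J_inf_F {m n : ℕ} {z : A} (hJ : z ∈ S.J m) (hF : z ∈ S.F n) : z ∈ S.J n := by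
  induction m with
  | zero => exact S.J_mono (Nat.zero_le n) hJ
  | succ m ih =>
    rcases Nat.lt_or_ge m n with h | h
    · exact S.J_mono h hJ
    · exact ih (S.J_succ_inf_F hJ (S.F_mono h hF))

end SmashData

end

end SymplecticReflection

/-! ### Symbols and commutators of words -/

namespace SymplecticReflection

noncomputable section

open Module

namespace SmashData

open MvPolynomial

variable {ι V Γ A : Type*} [AddCommGroup V] [Module ℂ V] [Group Γ] [Ring A] [Algebra ℂ A]
variable (S : SmashData ι V Γ A)

/-- A vector of `V` as a linear polynomial in the basis vectors: the polynomial algebra on `ι` plays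
the role of the symmetric algebra `SV`. -/
def lin : V →ₗ[ℂ] MvPolynomial ι ℂ := S.b.constr ℂ X

@[simp] lemma lin_basis (i : ι) : S.lin (S.b i) = X i := by simp [lin]

/-- The action of `Γ` on the symmetric algebra of `V`, realised as a polynomial algebra. -/
def σ (g : Γ) : MvPolynomial ι ℂ →ₐ[ℂ] MvPolynomial ι ℂ :=
  aeval fun i => S.lin (S.act g (S.b i))

@[simp] lemma σ_X (g : Γ) (i : ι) : S.σ g (X i) = S.lin (S.act g (S.b i)) := by simp [σ]

lemma σ_lin (g : Γ) (x : V) : S.σ g (S.lin x) = S.lin (S.act g x) := by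
  have : (S.σ g).toLinearMap ∘ₗ S.lin = S.lin ∘ₗ (S.act g : V →ₗ[ℂ] V) :=
    S.b.ext fun i => by simp
  exact LinearMap.congr_fun this x

lemma σ_one : S.σ 1 = AlgHom.id ℂ _ := by
  ext i : 1
  simp

lemma σ_mul (g h : Γ) : S.σ (g * h) = (S.σ g).comp (S.σ h) := by
  ext i : 1
  simp [σ_lin]

/-- The monomial of a word. -/
def mon (w : List ι) : MvPolynomial ι ℂ := (w.map X).prod

@[simp] lemma mon_nil : (mon [] : MvPolynomial ι ℂ) = 1 := rfl

@[simp] lemma mon_cons (i : ι) (w : List ι) : mon (i :: w) = X i * mon w := by simp [mon]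

lemma mon_append (u w : List ι) : (mon (u ++ w) : MvPolynomial ι ℂ) = mon u * mon w := by
  simp [mon]

lemma mon_isHomogeneous (w : List ι) : (mon w : MvPolynomial ι ℂ).IsHomogeneous w.length := by
  induction w with
  | nil => simpa using isHomogeneous_one ι ℂ
  | cons i w ih =>
    rw [mon_cons, List.length_cons, add_comm]
    exact (isHomogeneous_X ℂ i).mul ih

/-- The symbol `A → SV`, which makes the vectors commute and forgets the group elements. -/
def Θ : A →ₗ[ℂ] MvPolynomial ι ℂ := S.basis.constr ℂ fun p => mon p.1

@[simp] lemma Θ_word_gr (w : List ι) (g : Γ) : S.Θ (S.word w * S.gr g) = mon w := by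
  rw [← basis_eq, Θ, Basis.constr_basis]

@[simp] lemma Θ_word (w : List ι) : S.Θ (S.word w) = mon w := by
  simpa using S.Θ_word_gr w 1

lemma ext_basis {M : Type*} [AddCommGroup M] [Module ℂ M] {f f' : A →ₗ[ℂ] M}
    (h : ∀ w g, f (S.word w * S.gr g) = f' (S.word w * S.gr g)) : f = f' :=
  S.basis.ext fun p => by
    rw [show p = (p.1, p.2) from rfl, basis_eq]
    exact h _ _

lemma Θ_mul_gr (z : A) (g : Γ) : S.Θ (z * S.gr g) = S.Θ z := by
  have : S.Θ ∘ₗ LinearMap.mulRight ℂ (S.gr g) = S.Θ :=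
    S.ext_basis fun w h => by
      simp only [LinearMap.comp_apply, LinearMap.mulRight_apply, Θ_word_gr]
      rw [mul_assoc, ← map_mul, Θ_word_gr]
  exact LinearMap.congr_fun this z

lemma Θ_vec_mul (x : V) (z : A) : S.Θ (S.vec x * z) = S.lin x * S.Θ z := by
  have h : ∀ i, S.Θ ∘ₗ LinearMap.mulLeft ℂ (S.vec (S.b i))
      = LinearMap.mulLeft ℂ (X i) ∘ₗ S.Θ := fun i => S.ext_basis fun w g => by
    simp only [LinearMap.comp_apply, LinearMap.mulLeft_apply, Θ_word_gr]
    rw [← mul_assoc, ← word_cons, Θ_word_gr, mon_cons]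
  have h2 : S.Θ ∘ₗ LinearMap.mulRight ℂ z ∘ₗ S.vec
      = LinearMap.mulRight ℂ (S.Θ z) ∘ₗ S.lin := S.b.ext fun i => by
    simpa using LinearMap.congr_fun (h i) z
  exact LinearMap.congr_fun h2 x

lemma Θ_word_mul (w : List ι) (z : A) : S.Θ (S.word w * z) = mon w * S.Θ z := by
  induction w with
  | nil => simp
  | cons i w ih => rw [word_cons, mul_assoc, Θ_vec_mul, ih, lin_basis, mon_cons, mul_assoc]

lemma Θ_gr_mul (g : Γ) (z : A) : S.Θ (S.gr g * z) = S.σ g (S.Θ z) := by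
  have h : S.Θ ∘ₗ LinearMap.mulLeft ℂ (S.gr g) = (S.σ g).toLinearMap ∘ₗ S.Θ :=
    S.ext_basis fun w h => by
      simp only [LinearMap.comp_apply, LinearMap.mulLeft_apply, Θ_word_gr]
      rw [← mul_assoc, Θ_mul_gr]
      induction w with
      | nil => simpa using S.Θ_word_gr [] g
      | cons i w ih =>
        simp only [AlgHom.toLinearMap_apply] at ih ⊢
        rw [word_cons, ← mul_assoc, S.gr_vec, mul_assoc, Θ_vec_mul, ih, mon_cons, map_mul, σ_X]
  exact LinearMap.congr_fun h z

lemma Θ_totalDegree {n : ℕ} {z : A} (hz : z ∈ S.F n) : (S.Θ z).totalDegree ≤ n := by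
  refine S.F_induction (p := fun z => (S.Θ z).totalDegree ≤ n) (by simp)
    (fun x y hx hy => ?_) (fun r x hx => ?_) ?_ hz
  · rw [map_add]
    exact (totalDegree_add _ _).trans (max_le hx hy)
  · rw [map_smul]
    exact (totalDegree_smul_le _ _).trans hx
  · intro w g hw
    rw [Θ_word_gr]
    exact (mon_isHomogeneous w).totalDegree_le.trans hw

/-- The elements of `A` which are combinations of words of length at most `n`. -/
def W (n : ℕ) : Submodule ℂ A := Submodule.span ℂ (S.word '' {w | w.length ≤ n})

lemma W_le_F (n : ℕ) : S.W n ≤ S.F n := by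
  refine Submodule.span_le.mpr ?_
  rintro _ ⟨w, hw, rfl⟩
  exact S.word_mem_F' hw

/-- The symbol map is multiplicative as long as no group element stands on the left. -/
lemma Θ_W_mul {n : ℕ} {y : A} (hy : y ∈ S.W n) (z : A) : S.Θ (y * z) = S.Θ y * S.Θ z := by
  refine Submodule.span_induction (p := fun y _ => S.Θ (y * z) = S.Θ y * S.Θ z) ?_ (by simp)
    (fun x y _ _ hx hy => by rw [add_mul, map_add, hx, hy, map_add, add_mul])
    (fun r x _ hx => by rw [smul_mul_assoc, map_smul, hx, map_smul, smul_mul_assoc]) hy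
  rintro _ ⟨w, hw, rfl⟩
  rw [Θ_word_mul, Θ_word]

lemma σ_sub_X (s : Γ) (j : ι) : S.lin (S.act s (S.b j) - S.b j) = S.σ s (X j) - X j := by
  rw [map_sub, lin_basis, σ_X]

/-- The contribution of `s` to the symbol of the commutator of a vector and a word. -/
def vecBr (s : Γ) (x : V) : List ι → MvPolynomial ι ℂ
  | [] => 0
  | j :: w => S.k s x (S.b j) • S.σ s (mon w) + X j * vecBr s x w

/-- The contribution of `s` to the symbol of the commutator of two words. -/
def wordBr (s : Γ) : List ι → List ι → MvPolynomial ι ℂ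
  | [], _ => 0
  | i :: w, w' => X i * wordBr s w w' + S.vecBr s (S.b i) w' * S.σ s (mon w)

lemma lin_jacobi (s : Γ) (x y z : V) :
    S.k s x y • S.lin (S.act s z - z) = S.k s z y • S.lin (S.act s x - x)
      - S.k s z x • S.lin (S.act s y - y) := by
  have := congrArg S.lin (S.jacobi s x y z)
  rw [S.k_swap s y z] at this
  simp only [map_add, map_smul, map_zero, neg_smul, map_neg] at this
  linear_combination (exp := 1) this

lemma mul_vecBr (s : Γ) (x z : V) (w : List ι) :
    S.lin (S.act s z - z) * S.vecBr s x w
      = S.lin (S.act s x - x) * S.vecBr s z w - S.k s z x • (S.σ s (mon w) - mon w) := by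
  induction w with
  | nil => simp [vecBr]
  | cons j w ih =>
    have h := S.lin_jacobi s x (S.b j) z
    rw [σ_sub_X] at h
    simp only [vecBr, mon_cons, map_mul, smul_eq_C_mul] at h ih ⊢
    linear_combination S.σ s (mon w) * h + X j * ih

/-- Multiplied by `s z - z`, the contribution of `s` to the commutator symbol becomes a
combination of `s f - f` and `s h - h`, by the Jacobi identity. -/
lemma mul_wordBr (s : Γ) (z : V) (w w' : List ι) :
    S.lin (S.act s z - z) * S.wordBr s w w'
      = S.vecBr s z w' * (S.σ s (mon w) - mon w) - S.vecBr s z w * (S.σ s (mon w') - mon w') := by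
  induction w with
  | nil => simp [wordBr, vecBr]
  | cons i w ih =>
    have h := S.mul_vecBr s (S.b i) z w'
    rw [σ_sub_X] at h
    simp only [wordBr, vecBr, mon_cons, map_mul, smul_eq_C_mul] at h ih ⊢
    linear_combination S.σ s (mon w) * h + X i * ih

variable [Fintype Γ]

/-- The symbol of a relator of degree `n` has no part of degree `n`, since the symbol map makes the
vectors commute. -/
lemma Θ_J {n : ℕ} {z : A} (hz : z ∈ S.J n) : homogeneousComponent n (S.Θ z) = 0 := by
  refine Submodule.span_induction (p := fun z _ => homogeneousComponent n (S.Θ z) = 0) ?_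
    (by simp) (fun x y _ _ hx hy => by rw [map_add, map_add, hx, hy, add_zero])
    (fun r x _ hx => by rw [map_smul, map_smul, hx, smul_zero]) hz
  rintro _ ⟨u, i, j, w, g, h, rfl⟩
  have h1 := S.Θ_totalDegree (S.word_κ_word_mem_F u w g (S.b i) (S.b j))
  have h2 : (mon (u ++ i :: j :: w) : MvPolynomial ι ℂ) = mon (u ++ j :: i :: w) := by
    simp only [mon_append, mon_cons]
    ring
  rw [S.word_rel_word_eq, map_sub, map_sub, map_sub, Θ_word_gr, Θ_word_gr, h2, sub_self, map_zero,
    homogeneousComponent_eq_zero _ _ (by omega), sub_zero]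

/-- The commutator of a vector and a word, computed by the Leibniz rule from `[x, x_j] = κ(x, x_j)`.
It has degree one less than the word. -/
def vecComm (x : V) : List ι → A
  | [] => 0
  | j :: w => S.κ x (S.b j) * S.word w + S.vec (S.b j) * vecComm x w

/-- The commutator of two words, computed by the Leibniz rule from `vecComm`. -/
def wordComm : List ι → List ι → A
  | [], _ => 0
  | i :: w, w' => S.vec (S.b i) * wordComm w w' + S.vecComm (S.b i) w' * S.word w

lemma vecComm_mem_F (x : V) (w : List ι) : ∀ n, w.length ≤ n + 1 → S.vecComm x w ∈ S.F n := by
  induction w with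
  | nil => intro n _; exact zero_mem _
  | cons j w ih =>
    intro n hn
    simp only [List.length_cons, add_le_add_iff_right] at hn
    refine add_mem ?_ ?_
    · simpa using S.mul_mem_F (S.κ_mem_F _ _) (S.word_mem_F' hn)
    · cases n with
      | zero =>
        rw [List.length_eq_zero_iff.mp (Nat.le_zero.mp hn)]
        simp [vecComm]
      | succ n => exact S.vec_mul_mem_F (ih n hn) _

lemma wordComm_mem_F (w w' : List ι) :
    ∀ n, w.length + w'.length ≤ n + 2 → S.wordComm w w' ∈ S.F n := by
  induction w with
  | nil => intro n _; exact zero_mem _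
  | cons i w ih =>
    intro n hn
    simp only [List.length_cons] at hn
    refine add_mem ?_ ?_
    · cases n with
      | zero =>
        rcases w with _ | ⟨j, w⟩
        · simp [wordComm]
        · simp only [List.length_cons] at hn
          obtain rfl : w = [] := List.length_eq_zero_iff.mp (by omega)
          obtain rfl : w' = [] := List.length_eq_zero_iff.mp (by omega)
          simp [wordComm, vecComm]
      | succ n => exact S.vec_mul_mem_F (ih n (by omega)) _
    · rcases Nat.eq_zero_or_pos w'.length with h | h
      · rw [List.length_eq_zero_iff.mp h]
        simp [vecComm]
      · have := S.mul_mem_F (S.vecComm_mem_F (S.b i) w' (w'.length - 1) (by omega))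
          (S.word_mem_F' (w := w) le_rfl)
        exact S.F_mono (by omega) this

lemma vecComm_mem_J (x : V) (w : List ι) :
    S.vec x * S.word w - S.word w * S.vec x - S.vecComm x w ∈ S.J (w.length + 1) := by
  induction w with
  | nil => simp [vecComm]
  | cons j w ih =>
    have h1 := S.mul_J (S.vec_mem_F (S.b j)) ih (m := w.length + 1 + 1) (by omega)
    have h2 := S.mul_rel_mul_mem_J (p := 0) (q := w.length) (n := w.length + 1 + 1) (by omega)
      (S.word_mem_F' (w := []) le_rfl) (S.word_mem_F' le_rfl) x (S.b j)
    have := add_mem h1 h2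
    simp only [List.length_cons, vecComm, word_cons]
    convert this using 1
    simp only [rel_apply, word_nil]
    noncomm_ring

lemma wordComm_mem_J (w w' : List ι) :
    S.word w * S.word w' - S.word w' * S.word w - S.wordComm w w'
      ∈ S.J (w.length + w'.length) := by
  induction w with
  | nil => simp [wordComm]
  | cons i w ih =>
    have h1 := S.mul_J (S.vec_mem_F (S.b i)) ih (m := w.length + 1 + w'.length) (by omega)
    have h2 := S.J_mul (S.word_mem_F' (w := w) le_rfl) (S.vecComm_mem_J (S.b i) w')
      (m := w.length + 1 + w'.length) (by omega)
    have := add_mem h1 h2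
    simp only [List.length_cons, wordComm, word_cons]
    convert this using 1
    noncomm_ring

lemma Θ_vecComm (x : V) (w u : List ι) :
    S.Θ (S.vecComm x w * S.word u) = ∑ s, S.vecBr s x w * S.σ s (mon u) := by
  induction w with
  | nil => simp [vecComm, vecBr]
  | cons j w ih =>
    rw [vecComm, add_mul, map_add, mul_assoc (S.vec _), Θ_vec_mul, ih, mul_assoc (S.κ _ _),
      ← word_append, κ_apply, Finset.sum_mul, map_sum, Finset.mul_sum, ← Finset.sum_add_distrib]
    refine Finset.sum_congr rfl fun s _ => ?_
    rw [smul_mul_assoc, map_smul, Θ_gr_mul, Θ_word, mon_append, map_mul, lin_basis, vecBr, add_mul,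
      smul_mul_assoc, mul_assoc]

lemma Θ_wordComm (w w' : List ι) : S.Θ (S.wordComm w w') = ∑ s, S.wordBr s w w' := by
  induction w with
  | nil => simp [wordComm, wordBr]
  | cons i w ih =>
    rw [wordComm, map_add, Θ_vec_mul, ih, Θ_vecComm, Finset.mul_sum, ← Finset.sum_add_distrib]
    simp [wordBr]

end SmashData

end

end SymplecticReflection

/-! ### The Poisson bracket of symbols -/

namespace SymplecticReflection

noncomputable section

open Module

namespace SmashData

open MvPolynomial

variable {ι V Γ A : Type*} [AddCommGroup V] [Module ℂ V] [Group Γ] [Ring A] [Algebra ℂ A]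
variable (S : SmashData ι V Γ A)

lemma lin_injective : Function.Injective S.lin := by
  have h : ∀ x, S.lin x = Finsupp.linearCombination ℂ X (S.b.repr x) :=
    fun x => S.b.constr_apply ℂ _ x
  intro x y hxy
  rw [h, h] at hxy
  exact S.b.repr.injective (linearIndependent_X ι ℂ hxy)

/-- The Hamiltonian vector field of a vector, for the form `k_1`. -/
def ham (x : V) : Derivation ℂ (MvPolynomial ι ℂ) (MvPolynomial ι ℂ) :=
  mkDerivation ℂ fun j => C (S.k 1 x (S.b j))

lemma ham_X (x : V) (j : ι) : S.ham x (X j) = C (S.k 1 x (S.b j)) := mkDerivation_X _ _ _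

lemma vecBr_one (x : V) (w : List ι) : S.vecBr 1 x w = S.ham x (mon w) := by
  induction w with
  | nil => simp [vecBr]
  | cons j w ih =>
    rw [vecBr, ih, mon_cons, Derivation.leibniz, ham_X, σ_one, smul_eq_C_mul, smul_eq_mul,
      smul_eq_mul, AlgHom.id_apply]
    ring

variable [Fintype ι]

/-- The Poisson bracket on `SV` defined by the form `k_1`. -/
def pois : MvPolynomial ι ℂ →ₗ[ℂ] MvPolynomial ι ℂ →ₗ[ℂ] MvPolynomial ι ℂ :=
  ∑ i, ((LinearMap.mul ℂ (MvPolynomial ι ℂ)).compl₁₂ (pderiv i).toLinearMap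
    (S.ham (S.b i)).toLinearMap)

lemma pois_apply (f h : MvPolynomial ι ℂ) :
    S.pois f h = ∑ i, pderiv i f * S.ham (S.b i) h := by
  simp [pois]

lemma pois_mul (f f' h : MvPolynomial ι ℂ) :
    S.pois (f * f') h = f * S.pois f' h + f' * S.pois f h := by
  simp only [pois_apply, Finset.mul_sum, ← Finset.sum_add_distrib, Derivation.leibniz, smul_eq_mul]
  exact Finset.sum_congr rfl fun i _ => by ring

lemma pois_one (h : MvPolynomial ι ℂ) : S.pois 1 h = 0 := by
  simp [pois_apply]

lemma pois_X (i : ι) (h : MvPolynomial ι ℂ) : S.pois (X i) h = S.ham (S.b i) h := by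
  classical
  rw [pois_apply, Finset.sum_eq_single i]
  · simp
  · intro j _ hj
    rw [pderiv_X_of_ne hj.symm, zero_mul]
  · simp

lemma wordBr_one (w w' : List ι) : S.wordBr 1 w w' = S.pois (mon w) (mon w') := by
  induction w with
  | nil => simp [wordBr, pois_one]
  | cons i w ih =>
    rw [wordBr, ih, vecBr_one, σ_one, mon_cons, pois_mul, pois_X, AlgHom.id_apply]
    ring

omit [Fintype ι] in
lemma exists_sum_of_mem_W {n : ℕ} {y : A} (hy : y ∈ S.W n) :
    ∃ (I : Finset (List ι)) (a : List ι → ℂ), (∀ w ∈ I, w.length ≤ n) ∧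
      y = ∑ w ∈ I, a w • S.word w := by
  obtain ⟨l, hl, rfl⟩ := (Finsupp.mem_span_image_iff_linearCombination ℂ).mp hy
  exact ⟨l.support, l, fun w hw => (Finsupp.mem_supported _ _).mp hl hw, rfl⟩

variable [Fintype Γ]

/-- The commutator of two elements with invariant symbols is, modulo the relations, an element
of degree two less whose symbol is the Poisson bracket of the symbols: the reflections do not
contribute. -/
lemma exists_commutator (hinj : Function.Injective S.act) {m n d : ℕ} (hd : m + n ≤ d + 2)
    {y z : A} (hy : y ∈ S.W m) (hz : z ∈ S.W n) (hy' : ∀ s, S.σ s (S.Θ y) = S.Θ y)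
    (hz' : ∀ s, S.σ s (S.Θ z) = S.Θ z) :
    ∃ K ∈ S.F d, y * z - z * y - K ∈ S.J (m + n) ∧ S.Θ K = S.pois (S.Θ y) (S.Θ z) := by
  obtain ⟨I, a, hI, rfl⟩ := S.exists_sum_of_mem_W hy
  obtain ⟨I', a', hI', rfl⟩ := S.exists_sum_of_mem_W hz
  simp only [map_sum, map_smul, Θ_word] at hy' hz'
  refine ⟨∑ w ∈ I, ∑ w' ∈ I', (a w * a' w') • S.wordComm w w', ?_, ?_, ?_⟩
  · refine Submodule.sum_mem _ fun w hw => Submodule.sum_mem _ fun w' hw' =>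
      Submodule.smul_mem _ _ (S.wordComm_mem_F _ _ _ ?_)
    have := hI w hw
    have := hI' w' hw'
    omega
  · have e : (∑ w ∈ I, a w • S.word w) * (∑ w' ∈ I', a' w' • S.word w')
        - (∑ w' ∈ I', a' w' • S.word w') * (∑ w ∈ I, a w • S.word w)
        - ∑ w ∈ I, ∑ w' ∈ I', (a w * a' w') • S.wordComm w w'
        = ∑ w ∈ I, ∑ w' ∈ I', (a w * a' w') •
          (S.word w * S.word w' - S.word w' * S.word w - S.wordComm w w') := by
      rw [Finset.sum_mul_sum, Finset.sum_mul_sum, Finset.sum_comm (s := I') (t := I)]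
      simp only [← Finset.sum_sub_distrib]
      refine Finset.sum_congr rfl fun w _ => Finset.sum_congr rfl fun w' _ => ?_
      rw [smul_mul_smul_comm, smul_mul_smul_comm, mul_comm (a' w'), smul_sub, smul_sub]
    rw [e]
    refine Submodule.sum_mem _ fun w hw => Submodule.sum_mem _ fun w' hw' =>
      Submodule.smul_mem _ _ (S.J_mono ?_ (S.wordComm_mem_J _ _))
    have := hI w hw
    have := hI' w' hw'
    omega
  · have hs : ∀ s : Γ, s ≠ 1 →
        ∑ w ∈ I, ∑ w' ∈ I', (a w * a' w') • S.wordBr s w w' = 0 := by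
      intro s hs
      obtain ⟨z, hz⟩ : ∃ z, S.act s z ≠ z := by
        by_contra! h
        exact hs (hinj (by rw [map_one]; exact LinearEquiv.ext h))
      have h0 : S.lin (S.act s z - z) ≠ 0 := fun h =>
        hz (sub_eq_zero.mp (S.lin_injective (h.trans (map_zero _).symm)))
      refine (mul_eq_zero.mp ?_).resolve_left h0
      have e : ∀ w w', S.lin (S.act s z - z) * ((a w * a' w') • S.wordBr s w w')
          = (a' w' • S.vecBr s z w') * (a w • S.σ s (mon w) - a w • mon w)
            - (a w • S.vecBr s z w) * (a' w' • S.σ s (mon w') - a' w' • mon w') := by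
        intro w w'
        rw [mul_smul_comm, mul_wordBr]
        simp only [smul_eq_C_mul, map_mul]
        ring
      simp only [Finset.mul_sum, e, Finset.sum_sub_distrib]
      rw [Finset.sum_comm]
      simp only [← Finset.mul_sum, ← Finset.sum_mul, Finset.sum_sub_distrib]
      rw [hy' s, hz' s]
      simp
    have hp : S.pois (∑ w ∈ I, a w • mon w) (∑ w' ∈ I', a' w' • mon w')
        = ∑ w ∈ I, ∑ w' ∈ I', (a w * a' w') • S.pois (mon w) (mon w') := by
      rw [LinearMap.map_sum₂]
      refine Finset.sum_congr rfl fun w _ => ?_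
      rw [map_sum]
      refine Finset.sum_congr rfl fun w' _ => ?_
      rw [map_smul, map_smul, LinearMap.smul_apply, smul_smul, mul_comm]
    simp only [map_sum, map_smul, Θ_wordComm, Θ_word] at hp ⊢
    rw [hp]
    have : ∀ w w', (a w * a' w') • ∑ s, S.wordBr s w w'
        = ∑ s, (a w * a' w') • S.wordBr s w w' := fun w w' => Finset.smul_sum
    simp only [this]
    rw [Finset.sum_congr (rfl : I = I) fun w _ => Finset.sum_comm, Finset.sum_comm,
      Finset.sum_eq_single (1 : Γ)]
    · exact Finset.sum_congr rfl fun w _ => Finset.sum_congr rfl fun w' _ => by rw [wordBr_one]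
    · intro s _ h
      exact hs s h
    · simp

end SmashData

end

end SymplecticReflection

/-! ### Derivations are determined by their values on the invariants -/

namespace SymplecticReflection

noncomputable section

open Module

section Derivations

/-- A derivation extends along an algebraic extension to a field of characteristic zero. -/
theorem exists_derivation_extension {k R K : Type*} [Field k] [CharZero k] [CommRing R]
    [IsDomain R] [Field K] [Algebra k R] [Algebra k K] [Algebra R K] [IsScalarTower k R K]
    [FaithfulSMul R K] [Algebra.IsAlgebraic R K] (D : Derivation k R K) :
    ∃ D' : Derivation k K K, ∀ r, D' (algebraMap R K r) = D r := by
  let : Algebra (FractionRing R) K := FractionRing.liftAlgebra R K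
  have : IsScalarTower R (FractionRing R) K := FractionRing.isScalarTower_liftAlgebra R K
  have : CharZero R := charZero_of_injective_algebraMap (algebraMap k R).injective
  have : CharZero (FractionRing R) :=
    charZero_of_injective_algebraMap (IsFractionRing.injective R (FractionRing R))
  have : Algebra.IsAlgebraic (FractionRing R) K :=
    (IsFractionRing.comap_isAlgebraic_iff (A := R)).mp inferInstance
  have : Algebra.FormallyEtale R (FractionRing R) :=
    Algebra.FormallyEtale.of_isLocalization (nonZeroDivisors R)
  have : Algebra.FormallyEtale (FractionRing R) K := Algebra.FormallyEtale.of_isSeparable _ _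
  have : Algebra.FormallyEtale R K := Algebra.FormallyEtale.comp R (FractionRing R) K
  let φ : TensorProduct R K (Ω[R⁄k]) →ₗ[K] K :=
    (LinearMap.liftBaseChangeEquiv K) D.liftKaehlerDifferential
  let ψ := φ ∘ₗ (KaehlerDifferential.tensorKaehlerEquivOfFormallyEtale k R K).symm.toLinearMap
  refine ⟨ψ.compDer (KaehlerDifferential.D k K), fun r => ?_⟩
  have h := KaehlerDifferential.tensorKaehlerEquivOfFormallyEtale_symm_D_algebraMap k R K r
  exact (congrArg φ h).trans (by simp [φ])

/-- Differentiating the value of a polynomial at a point. -/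
lemma derivation_eval {k R M : Type*} [CommRing k] [CommRing R] [Algebra k R] [AddCommGroup M]
    [Module R M] [Module k M] [IsScalarTower k R M] (D : Derivation k R M) (q : Polynomial R)
    (x : R) {N : ℕ} (hN : q.natDegree < N) :
    D (q.eval x) = ∑ i ∈ Finset.range N, x ^ i • D (q.coeff i) + q.derivative.eval x • D x := by
  rw [Polynomial.derivative_eval, q.sum_over_range' (by simp) N hN,
    Polynomial.eval_eq_sum_range' hN, map_sum, Finset.sum_smul, ← Finset.sum_add_distrib]
  refine Finset.sum_congr rfl fun i _ => ?_
  rw [Derivation.leibniz, Derivation.leibniz_pow, add_comm]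
  congr 1
  rw [← Nat.cast_smul_eq_nsmul R, smul_smul, smul_smul, mul_assoc]

/-- The vectors outside finitely many proper subspaces span the space. -/
lemma span_compl_eq_top {V α : Type*} [AddCommGroup V] [Module ℂ V] [Finite α]
    (p : α → Submodule ℂ V) (hp : ∀ a, p a ≠ ⊤) :
    Submodule.span ℂ {y | ∀ a, y ∉ p a} = ⊤ := by
  by_contra h
  have hc : ⋃ a : Option α, ((a.elim (Submodule.span ℂ {y | ∀ a, y ∉ p a}) p : Submodule ℂ V)
      : Set V) = Set.univ := by
    refine Set.eq_univ_of_forall fun y => Set.mem_iUnion.mpr ?_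
    by_cases hy : ∀ a, y ∉ p a
    · exact ⟨none, Submodule.subset_span hy⟩
    · push Not at hy
      obtain ⟨a, ha⟩ := hy
      exact ⟨some a, ha⟩
  obtain ⟨a, ha⟩ := Subspace.exists_eq_top_of_iUnion_eq_univ hc
  cases a with
  | none => exact h ha
  | some a => exact hp a ha

end Derivations

section LinearAction

open MvPolynomial

/-- An action of `Γ` on a polynomial algebra by linear substitutions: `lin` identifies a faithful
representation `V` of `Γ` with the space of polynomials of degree one. -/
structure IsLinearAction {ι V Γ : Type*} [AddCommGroup V] [Module ℂ V] [Group Γ]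
    [MulSemiringAction Γ (MvPolynomial ι ℂ)] (act : Γ →* (V ≃ₗ[ℂ] V))
    (lin : V →ₗ[ℂ] MvPolynomial ι ℂ) : Prop where
  smul_lin : ∀ g x, g • lin x = lin (act g x)
  lin_injective : Function.Injective lin
  lin_isHomogeneous : ∀ x, (lin x).IsHomogeneous 1
  X_mem_range : ∀ i, X i ∈ LinearMap.range lin
  act_injective : Function.Injective act

variable {ι V Γ : Type*} [AddCommGroup V] [Module ℂ V] [Group Γ]
  [MulSemiringAction Γ (MvPolynomial ι ℂ)] {act : Γ →* (V ≃ₗ[ℂ] V)}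
  {lin : V →ₗ[ℂ] MvPolynomial ι ℂ}

/-- The vectors with trivial stabiliser. -/
def regularVectors (act : Γ →* (V ≃ₗ[ℂ] V)) : Set V := {y | ∀ g, g ≠ 1 → act g y ≠ y}

namespace IsLinearAction

lemma derivation_ext (H : IsLinearAction act lin) {M : Type*} [AddCommGroup M]
    [Module (MvPolynomial ι ℂ) M] [Module ℂ M] [IsScalarTower ℂ (MvPolynomial ι ℂ) M]
    {D D' : Derivation ℂ (MvPolynomial ι ℂ) M} {s : Set V} (hs : Submodule.span ℂ s = ⊤)
    (h : ∀ y ∈ s, D (lin y) = D' (lin y)) : D = D' := by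
  have h' : (⊤ : Submodule ℂ V)
      ≤ LinearMap.eqLocus (D.toLinearMap ∘ₗ lin) (D'.toLinearMap ∘ₗ lin) := by
    rw [← hs]
    exact Submodule.span_le.mpr h
  refine MvPolynomial.derivation_ext fun i => ?_
  obtain ⟨x, hx⟩ := H.X_mem_range i
  rw [← hx]
  exact h' (trivial : x ∈ ⊤)

lemma span_regularVectors (H : IsLinearAction act lin) [Finite Γ] :
    Submodule.span ℂ (regularVectors act) = ⊤ := by
  have := span_compl_eq_top (α := {g : Γ // g ≠ 1})
    (fun g => LinearMap.ker (idSub (act g))) (fun g hg => g.2 (H.act_injective ?_))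
  · refine this ▸ congrArg _ (Set.ext fun y =>
      ⟨fun hy g h => hy g g.2 ?_, fun hy g hg h => hy ⟨g, hg⟩ ?_⟩)
    · exact (sub_eq_zero.mp (LinearMap.mem_ker.mp h)).symm
    · exact LinearMap.mem_ker.mpr (sub_eq_zero.mpr h.symm)
  · rw [map_one]
    ext x
    have : x ∈ LinearMap.ker (idSub (act g)) := by rw [hg]; trivial
    exact (sub_eq_zero.mp (LinearMap.mem_ker.mp this)).symm

variable [Fintype Γ]

open MulSemiringAction in
lemma derivative_charpoly (x : MvPolynomial ι ℂ) [DecidableEq Γ] :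
    (charpoly Γ x).derivative.eval x = ∏ g ∈ Finset.univ.erase (1 : Γ), (x - g • x) := by
  rw [charpoly_eq, Polynomial.derivative_prod_finset, Polynomial.eval_finsetSum,
    Finset.sum_eq_single (1 : Γ)]
  · simp [Polynomial.eval_prod]
  · intro g _ hg
    rw [Polynomial.eval_mul, Polynomial.eval_prod,
      Finset.prod_eq_zero (i := (1 : Γ)) (by simpa using hg.symm) (by simp), zero_mul]
  · simp

lemma natDegree_charpoly (x : MvPolynomial ι ℂ) :
    (MulSemiringAction.charpoly Γ x).natDegree = Fintype.card Γ := by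
  rw [MulSemiringAction.charpoly_eq, Polynomial.natDegree_prod_of_monic _ _
    (fun g _ => Polynomial.monic_X_sub_C _)]
  simp

/-- The value `p'(y)` of the derivative of the orbit polynomial `p = ∏_g (X - g y)` of a vector `y`;
it is nonzero when `y` has trivial stabiliser. -/
def orbitDisc (y : V) (lin : V →ₗ[ℂ] MvPolynomial ι ℂ) (Γ : Type*) [Group Γ] [Fintype Γ]
    [MulSemiringAction Γ (MvPolynomial ι ℂ)] : MvPolynomial ι ℂ :=
  (MulSemiringAction.charpoly Γ (lin y)).derivative.eval (lin y)

lemma orbitDisc_eq (H : IsLinearAction act lin) [DecidableEq Γ] (y : V) :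
    orbitDisc y lin Γ = ∏ g ∈ Finset.univ.erase (1 : Γ), lin (y - act g y) := by
  rw [orbitDisc, derivative_charpoly]
  exact Finset.prod_congr rfl fun g _ => by rw [H.smul_lin, map_sub]

lemma orbitDisc_ne_zero (H : IsLinearAction act lin) {y : V} (hy : y ∈ regularVectors act) :
    orbitDisc y lin Γ ≠ 0 := by
  classical
  rw [H.orbitDisc_eq]
  refine Finset.prod_ne_zero_iff.mpr fun g hg h => hy g (Finset.ne_of_mem_erase hg) ?_
  have := H.lin_injective (h.trans (map_zero lin).symm)
  exact (sub_eq_zero.mp this).symm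

lemma orbitDisc_isHomogeneous (H : IsLinearAction act lin) (y : V) :
    (orbitDisc y lin Γ).IsHomogeneous (Fintype.card Γ - 1) := by
  classical
  rw [H.orbitDisc_eq]
  have := IsHomogeneous.prod (Finset.univ.erase (1 : Γ)) (fun g => lin (y - act g y)) (fun _ => 1)
    (fun g _ => H.lin_isHomogeneous _)
  simpa using this

/-- The value of a derivation at a vector, computed from its values on the coefficients of the
orbit polynomial. -/
lemma orbitDisc_smul {M : Type*} [AddCommGroup M]
    [Module (MvPolynomial ι ℂ) M] [Module ℂ M] [IsScalarTower ℂ (MvPolynomial ι ℂ) M]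
    (D : Derivation ℂ (MvPolynomial ι ℂ) M) (y : V) :
    orbitDisc y lin Γ • D (lin y) = -∑ i ∈ Finset.range (Fintype.card Γ + 1),
      lin y ^ i • D ((MulSemiringAction.charpoly Γ (lin y)).coeff i) := by
  have h := derivation_eval D (MulSemiringAction.charpoly Γ (lin y)) (lin y)
    (N := Fintype.card Γ + 1) (by rw [natDegree_charpoly]; omega)
  rw [MulSemiringAction.eval_charpoly, map_zero] at h
  rw [orbitDisc, eq_neg_iff_add_eq_zero, add_comm]
  exact h.symm

/-- A derivation is determined by its values on the invariants. -/
lemma derivation_eq (H : IsLinearAction act lin) {M : Type*} [AddCommGroup M]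
    [Module (MvPolynomial ι ℂ) M] [Module ℂ M] [IsScalarTower ℂ (MvPolynomial ι ℂ) M]
    [Module.IsTorsionFree (MvPolynomial ι ℂ) M]
    {D D' : Derivation ℂ (MvPolynomial ι ℂ) M}
    (h : ∀ f, (∀ g : Γ, g • f = f) → D f = D' f) : D = D' := by
  refine H.derivation_ext H.span_regularVectors fun y hy => ?_
  refine smul_right_injective M (H.orbitDisc_ne_zero hy) ?_
  simp only [orbitDisc_smul]
  refine congrArg _ (Finset.sum_congr rfl fun i _ => ?_)
  rw [h _ fun g => MulSemiringAction.smul_coeff_charpoly _ _ _]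

end IsLinearAction

end LinearAction

end

end SymplecticReflection

/-! ### Biderivations of negative degree on the invariants -/

namespace SymplecticReflection

noncomputable section

open Module MvPolynomial

section LowDegree

variable {ι : Type*}

/-- The polynomials of degree at most `d - k`; this is zero when `d < k`. -/
def lowDeg (ι : Type*) (k d : ℕ) : Submodule ℂ (MvPolynomial ι ℂ) :=
  restrictSupport ℂ {α | α.degree + k ≤ d}

lemma mem_lowDeg {k d : ℕ} {f : MvPolynomial ι ℂ} :
    f ∈ lowDeg ι k d ↔ ∀ α ∈ f.support, α.degree + k ≤ d := Iff.rfl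

lemma mem_lowDeg_iff_homogeneousComponent {k d : ℕ} {f : MvPolynomial ι ℂ} :
    f ∈ lowDeg ι k d ↔ ∀ j, d < j + k → homogeneousComponent j f = 0 := by
  rw [mem_lowDeg]
  constructor
  · intro h j hj
    ext α
    rw [coeff_homogeneousComponent, coeff_zero]
    split_ifs with hα
    · by_contra h0
      have := h α (mem_support_iff.mpr h0)
      omega
    · rfl
  · intro h α hα
    by_contra h0
    have := congrArg (coeff α) (h α.degree (by omega))
    rw [coeff_homogeneousComponent, if_pos rfl, coeff_zero] at this
    exact mem_support_iff.mp hα this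

lemma mem_lowDeg_iff {k d : ℕ} {f : MvPolynomial ι ℂ} (hf : f ≠ 0) :
    f ∈ lowDeg ι k d ↔ f.totalDegree + k ≤ d := by
  rw [mem_lowDeg]
  constructor
  · intro h
    obtain ⟨α, hα, h'⟩ := Finset.exists_mem_eq_sup f.support (support_nonempty.mpr hf)
      fun s => s.sum fun _ e => e
    rw [totalDegree, h']
    exact h α hα
  · intro h α hα
    exact (Nat.add_le_add_right (le_totalDegree hα) k).trans h

lemma mem_lowDeg_zero {d : ℕ} {f : MvPolynomial ι ℂ} :
    f ∈ lowDeg ι 0 d ↔ f.totalDegree ≤ d := by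
  rcases eq_or_ne f 0 with rfl | hf
  · simp
  · rw [mem_lowDeg_iff hf, add_zero]

lemma lowDeg_le {k d k' d' : ℕ} (h : d + k' ≤ d' + k) : lowDeg ι k d ≤ lowDeg ι k' d' :=
  fun f hf => mem_lowDeg.mpr fun α hα => by
    have := mem_lowDeg.mp hf α hα
    omega

lemma mul_mem_lowDeg {j k d e : ℕ} {f h : MvPolynomial ι ℂ} (hf : f ∈ lowDeg ι j d)
    (hh : h ∈ lowDeg ι k e) : f * h ∈ lowDeg ι (j + k) (d + e) := by
  classical
  refine mem_lowDeg.mpr fun α hα => ?_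
  obtain ⟨β, hβ, γ, hγ, rfl⟩ := Finset.mem_add.mp (support_mul f h hα)
  have h1 := mem_lowDeg.mp hf β hβ
  have h2 := mem_lowDeg.mp hh γ hγ
  rw [map_add]
  omega

lemma eq_zero_of_mem_lowDeg {k d : ℕ} (h : d < k) {f : MvPolynomial ι ℂ}
    (hf : f ∈ lowDeg ι k d) : f = 0 := by
  by_contra h0
  have := (mem_lowDeg_iff h0).mp hf
  omega

lemma mem_lowDeg_of_isHomogeneous {d : ℕ} {f : MvPolynomial ι ℂ} (hf : f.IsHomogeneous d) :
    f ∈ lowDeg ι 0 d := mem_lowDeg_zero.mpr hf.totalDegree_le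

lemma mem_lowDeg_of_mul {k d e : ℕ} {f h : MvPolynomial ι ℂ} (hh : h.IsHomogeneous e)
    (h0 : h ≠ 0) (hf : h * f ∈ lowDeg ι k (d + e)) : f ∈ lowDeg ι k d := by
  rcases eq_or_ne f 0 with rfl | hf0
  · exact zero_mem _
  · rw [mem_lowDeg_iff (mul_ne_zero h0 hf0), totalDegree_mul_of_isDomain h0 hf0,
      hh.totalDegree h0] at hf
    rw [mem_lowDeg_iff hf0]
    omega

end LowDegree

namespace IsLinearAction

variable {ι V Γ : Type*} [AddCommGroup V] [Module ℂ V] [Group Γ]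
  [MulSemiringAction Γ (MvPolynomial ι ℂ)] {act : Γ →* (V ≃ₗ[ℂ] V)}
  {lin : V →ₗ[ℂ] MvPolynomial ι ℂ}

lemma pow_lin_mem_lowDeg (H : IsLinearAction act lin) (y : V) (i : ℕ) :
    lin y ^ i ∈ lowDeg ι 0 i := by
  refine mem_lowDeg_of_isHomogeneous ?_
  simpa using (H.lin_isHomogeneous y).pow i

lemma exists_const_of_dvd (H : IsLinearAction act lin) {q : MvPolynomial ι ℂ} (hq : Prime q)
    {v : V} (hv : v ≠ 0) (h : q ∣ lin v) :
    q.totalDegree = 1 ∧ ∃ r : ℂ, r ≠ 0 ∧ lin v = C r * q := by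
  obtain ⟨c, hc⟩ := h
  have hv' : lin v ≠ 0 := fun h => hv (H.lin_injective (h.trans (map_zero lin).symm))
  have hc0 : c ≠ 0 := fun h => hv' (by rw [hc, h, mul_zero])
  have hd : q.totalDegree + c.totalDegree = 1 := by
    rw [← totalDegree_mul_of_isDomain hq.ne_zero hc0, ← hc]
    exact (H.lin_isHomogeneous v).totalDegree hv'
  have hq1 : q.totalDegree ≠ 0 := by
    intro h0
    rw [totalDegree_eq_zero_iff_eq_C] at h0
    refine hq.not_isUnit ?_
    rw [h0]
    refine (IsUnit.mk0 _ fun h1 => hq.ne_zero ?_).map C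
    rw [h0, h1, map_zero]
  have hc1 : c.totalDegree = 0 := by omega
  rw [totalDegree_eq_zero_iff_eq_C] at hc1
  refine ⟨by omega, coeff 0 c, fun h => hc0 (by rw [hc1, h, map_zero]), ?_⟩
  rw [hc, mul_comm]
  exact congrArg (· * q) hc1

variable [Fintype Γ]

lemma coeff_charpoly_mem_lowDeg (H : IsLinearAction act lin) (y : V) (i : ℕ) :
    (MulSemiringAction.charpoly Γ (lin y)).coeff i ∈ lowDeg ι i (Fintype.card Γ) := by
  classical
  rw [MulSemiringAction.charpoly_eq, ← Finset.card_univ]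
  induction (Finset.univ : Finset Γ) using Finset.induction_on generalizing i with
  | empty =>
    rw [Finset.prod_empty, Polynomial.coeff_one]
    split_ifs with h
    · subst h
      exact mem_lowDeg_of_isHomogeneous (isHomogeneous_one ι ℂ)
    · exact zero_mem _
  | insert g s hg ih =>
    rw [Finset.prod_insert hg, Finset.card_insert_of_notMem hg, sub_mul, Polynomial.coeff_sub,
      Polynomial.coeff_C_mul]
    refine sub_mem ?_ ?_
    · cases i with
      | zero =>
        rw [Polynomial.coeff_X_mul_zero]
        exact zero_mem _
      | succ i =>
        rw [Polynomial.coeff_X_mul]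
        exact lowDeg_le (by omega) (ih i)
    · rw [H.smul_lin]
      exact lowDeg_le (by omega)
        (mul_mem_lowDeg (mem_lowDeg_of_isHomogeneous (H.lin_isHomogeneous _)) (ih i))

/-- A derivation which lowers the degrees of invariants also lowers the degrees of vectors. -/
lemma derivation_lin_mem_lowDeg (H : IsLinearAction act lin)
    (D : Derivation ℂ (MvPolynomial ι ℂ) (MvPolynomial ι ℂ)) {k n : ℕ}
    (hD : ∀ f, (∀ g : Γ, g • f = f) → ∀ m, f ∈ lowDeg ι 0 m → D f ∈ lowDeg ι k (m + n)) (x : V) :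
    D (lin x) ∈ lowDeg ι k (1 + n) := by
  suffices h : (⊤ : Submodule ℂ V) ≤ (lowDeg ι k (1 + n)).comap (D.toLinearMap ∘ₗ lin) from
    h (trivial : x ∈ ⊤)
  rw [← H.span_regularVectors]
  refine Submodule.span_le.mpr fun y hy => ?_
  refine mem_lowDeg_of_mul (H.orbitDisc_isHomogeneous y) (H.orbitDisc_ne_zero hy) ?_
  have h := orbitDisc_smul (Γ := Γ) (lin := lin) D y
  rw [smul_eq_mul] at h
  change _ * D (lin y) ∈ _
  rw [h]
  refine neg_mem (Submodule.sum_mem _ fun i hi => ?_)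
  have hi' : i ≤ Fintype.card Γ := Nat.lt_succ_iff.mp (Finset.mem_range.mp hi)
  have hc := hD _ (MulSemiringAction.smul_coeff_charpoly (G := Γ) (lin y) i)
    (Fintype.card Γ - i) (lowDeg_le (by omega) (H.coeff_charpoly_mem_lowDeg y i))
  have hpos : 0 < Fintype.card Γ := Fintype.card_pos
  rw [smul_eq_mul]
  exact lowDeg_le (by omega) (mul_mem_lowDeg (H.pow_lin_mem_lowDeg y i) hc)

/-- For a prime `q`, the vectors `y` such that `q` divides no `y - g y` span `V`, provided no
`g ≠ 1` acts as a reflection. -/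
lemma span_not_dvd (H : IsLinearAction act lin)
    (hcodim : ∀ g, g ≠ 1 → ∀ v : V, ¬ LinearMap.range (idSub (act g)) ≤ Submodule.span ℂ {v})
    {q : MvPolynomial ι ℂ} (hq : Prime q) :
    Submodule.span ℂ {y | ∀ g : {g : Γ // g ≠ 1}, ¬ q ∣ lin (y - act g y)} = ⊤ := by
  refine span_compl_eq_top (α := {g : Γ // g ≠ 1})
    (fun g => ((Ideal.span {q}).restrictScalars ℂ).comap (lin ∘ₗ idSub (act g))) (fun g hg => ?_)
    |>.symm.trans ?_ |>.symm
  · have hd : ∀ y, q ∣ lin (y - act g y) := fun y => by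
      have : y ∈ ((Ideal.span {q}).restrictScalars ℂ).comap (lin ∘ₗ idSub (act g)) := by
        rw [hg]; trivial
      exact Ideal.mem_span_singleton.mp this
    have h1 : ∃ y, y - act g y ≠ 0 := by
      by_contra! h
      exact hcodim g g.2 0 (by rintro _ ⟨y, rfl⟩; rw [idSub_apply, h]; exact zero_mem _)
    obtain ⟨y, hy⟩ := h1
    refine hcodim g g.2 (y - act g y) ?_
    rintro _ ⟨x, rfl⟩
    rw [idSub_apply]
    obtain ⟨-, r, hr, e⟩ := H.exists_const_of_dvd hq hy (hd y)
    by_cases hx : x - act g x = 0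
    · rw [hx]; exact zero_mem _
    obtain ⟨-, r', hr', e'⟩ := H.exists_const_of_dvd hq hx (hd x)
    refine Submodule.mem_span_singleton.mpr ⟨r' * r⁻¹, H.lin_injective ?_⟩
    rw [map_smul, e, e', smul_eq_C_mul, ← mul_assoc, ← map_mul, mul_assoc, inv_mul_cancel₀ hr,
      mul_one]
  · refine congrArg _ (Set.ext fun y => forall_congr' fun g => not_congr ?_)
    exact Ideal.mem_span_singleton

/-- If no element of `Γ` acts as a reflection, a derivation which is regular on the invariants is
regular: its possible poles would lie on the hyperplanes where the quotient map ramifies. -/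
theorem exists_regular_derivation [Finite ι] (H : IsLinearAction act lin)
    (hcodim : ∀ g, g ≠ 1 → ∀ v : V, ¬ LinearMap.range (idSub (act g)) ≤ Submodule.span ℂ {v})
    (D : Derivation ℂ (MvPolynomial ι ℂ) (FractionRing (MvPolynomial ι ℂ)))
    (hD : ∀ f, (∀ g : Γ, g • f = f) →
      ∃ h, D f = algebraMap (MvPolynomial ι ℂ) (FractionRing (MvPolynomial ι ℂ)) h) :
    ∃ D₀ : Derivation ℂ (MvPolynomial ι ℂ) (MvPolynomial ι ℂ),
      ∀ f, D f = algebraMap _ _ (D₀ f) := by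
  classical
  set P := MvPolynomial ι ℂ
  set K := FractionRing P
  have hreg : ∀ x : V, ∃ h, D (lin x) = algebraMap P K h := by
    intro x
    -- no prime `q` divides the denominator of `D x`
    have hu : IsUnit (IsFractionRing.den P (D (lin x)) : P) := by
      by_contra hu
      obtain ⟨q, hq, hqd⟩ := WfDvdMonoid.exists_irreducible_factor hu
        (nonZeroDivisors.ne_zero (IsFractionRing.den P (D (lin x))).2)
      have hq' : Prime q := UniqueFactorizationMonoid.irreducible_iff_prime.mp hq
      -- the vectors at which `D` has a denominator prime to `q`
      let T : Submodule ℂ V :=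
        { carrier := {x | ∃ h : P, ¬ q ∣ h ∧ ∃ f, h • D (lin x) = algebraMap P K f}
          zero_mem' := ⟨1, fun h => hq'.not_isUnit (isUnit_of_dvd_one h), 0, by simp⟩
          add_mem' := by
            rintro x y ⟨h, hh, f, hf⟩ ⟨h', hh', f', hf'⟩
            refine ⟨h * h', fun h => (hq'.dvd_or_dvd h).elim hh hh', h' * f + h * f', ?_⟩
            rw [map_add lin, map_add D, smul_add, map_add, map_mul, map_mul, ← hf, ← hf',
              Algebra.smul_def, Algebra.smul_def, Algebra.smul_def, Algebra.smul_def, map_mul]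
            ring
          smul_mem' := by
            rintro r x ⟨h, hh, f, hf⟩
            refine ⟨h, hh, r • f, ?_⟩
            rw [map_smul lin, D.map_smul, smul_comm, hf, Algebra.smul_def,
              Algebra.smul_def, map_mul, ← IsScalarTower.algebraMap_apply] }
      have hT : (⊤ : Submodule ℂ V) ≤ T := by
        rw [← H.span_not_dvd hcodim hq']
        refine Submodule.span_le.mpr fun y hy => ⟨orbitDisc y lin Γ, ?_, ?_⟩
        · rw [H.orbitDisc_eq, hq'.dvd_finsetProd_iff]
          rintro ⟨g, hg, h⟩
          exact hy ⟨g, Finset.ne_of_mem_erase hg⟩ h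
        · choose c hc using fun i =>
            hD _ (MulSemiringAction.smul_coeff_charpoly (G := Γ) (lin y) i)
          refine ⟨-∑ i ∈ Finset.range (Fintype.card Γ + 1), lin y ^ i * c i, ?_⟩
          rw [orbitDisc_smul, map_neg, map_sum]
          refine congrArg _ (Finset.sum_congr rfl fun i _ => ?_)
          rw [hc, Algebra.smul_def, map_mul]
      obtain ⟨h, hh, f, hf⟩ := hT (trivial : x ∈ ⊤)
      refine hh (hqd.trans ?_)
      refine (IsFractionRing.num_den_reduced P (D (lin x))).symm.dvd_of_dvd_mul_right
        (⟨f, ?_⟩ : _ ∣ h * IsFractionRing.num P (D (lin x)))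
      apply IsFractionRing.injective P K
      have hz := IsFractionRing.mk'_num_den' P (D (lin x))
      have hd0 : algebraMap P K (IsFractionRing.den P (D (lin x)) : P) ≠ 0 :=
        IsFractionRing.to_map_ne_zero_of_mem_nonZeroDivisors (IsFractionRing.den P (D (lin x))).2
      rw [map_mul, map_mul, ← hf, Algebra.smul_def, (div_eq_iff hd0).mp hz]
      ring
    obtain ⟨h, hh⟩ := IsFractionRing.isInteger_of_isUnit_den hu
    exact ⟨h, hh.symm⟩
  choose x hx using H.X_mem_range
  choose h hh using hreg
  refine ⟨mkDerivation ℂ fun i => h (x i), fun f => ?_⟩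
  have : D = (Algebra.linearMap P K).compDer (mkDerivation ℂ fun i => h (x i)) := by
    refine MvPolynomial.derivation_ext fun i => ?_
    rw [← hx i, hh]
    change _ = algebraMap P K (mkDerivation ℂ _ (lin (x i)))
    rw [hx i, mkDerivation_X]
  rw [this]
  rfl

/-- If no element of `Γ` acts as a reflection, every derivation of the algebra of invariants is the
restriction of a derivation of the polynomial algebra. -/
lemma exists_derivation_eq [Finite ι] [SMulCommClass Γ ℂ (MvPolynomial ι ℂ)]
    (H : IsLinearAction act lin)
    (hcodim : ∀ g, g ≠ 1 → ∀ v : V, ¬ LinearMap.range (idSub (act g)) ≤ Submodule.span ℂ {v})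
    (d : MvPolynomial ι ℂ →ₗ[ℂ] MvPolynomial ι ℂ)
    (hd : ∀ f, (∀ g : Γ, g • f = f) → ∀ f', (∀ g : Γ, g • f' = f') →
      d (f * f') = f * d f' + f' * d f) :
    ∃ D : Derivation ℂ (MvPolynomial ι ℂ) (MvPolynomial ι ℂ),
      ∀ f, (∀ g : Γ, g • f = f) → D f = d f := by
  set P := MvPolynomial ι ℂ
  set K := FractionRing P
  let R : Subalgebra ℂ P := FixedPoints.subalgebra ℂ P Γ
  have hR : ∀ r : R, ∀ g : Γ, g • (r : P) = r := fun r => r.2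
  have : Algebra.IsInvariant R P Γ := ⟨fun f hf => ⟨⟨f, hf⟩, rfl⟩⟩
  have : Algebra.IsIntegral R P := Algebra.IsInvariant.isIntegral R P Γ
  have : FaithfulSMul R P := inferInstance
  have : FaithfulSMul R K := (faithfulSMul_iff_algebraMap_injective R K).mpr <| by
    rw [IsScalarTower.algebraMap_eq R P K]
    exact (IsFractionRing.injective P K).comp Subtype.val_injective
  have : Algebra.IsAlgebraic R P := inferInstance
  have : Algebra.IsAlgebraic P K := IsLocalization.isAlgebraic K (nonZeroDivisors P)
  have : Algebra.IsAlgebraic R K := Algebra.IsAlgebraic.trans R P K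
  let D₁ : Derivation ℂ R K := Derivation.mk'
    ((Algebra.linearMap P K).restrictScalars ℂ ∘ₗ d ∘ₗ R.val.toLinearMap) fun a b => by
      change algebraMap P K (d ((a : P) * b)) = _
      rw [hd a (hR a) b (hR b), map_add, map_mul, map_mul, Algebra.smul_def, Algebra.smul_def]
      rfl
  obtain ⟨D', hD'⟩ := exists_derivation_extension D₁
  have hD₂ : ∀ f : P, (∀ g : Γ, g • f = f) → D'.compAlgebraMap P f = algebraMap P K (d f) :=
    fun f hf => hD' ⟨f, hf⟩
  obtain ⟨D₀, hD₀⟩ := H.exists_regular_derivation (Γ := Γ) hcodim (D'.compAlgebraMap P)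
    fun f hf => ⟨d f, hD₂ f hf⟩
  exact ⟨D₀, fun f hf => IsFractionRing.injective P K ((hD₀ f).symm.trans (hD₂ f hf))⟩

/-- There is no nonzero biderivation of the algebra of invariants which lowers the total degree by
three or more: it would come from a bivector field of negative degree on `V*`. -/
theorem bracket_eq_zero [Finite ι] [SMulCommClass Γ ℂ (MvPolynomial ι ℂ)]
    (H : IsLinearAction act lin)
    (hcodim : ∀ g, g ≠ 1 → ∀ v : V, ¬ LinearMap.range (idSub (act g)) ≤ Submodule.span ℂ {v})
    (β : MvPolynomial ι ℂ →ₗ[ℂ] MvPolynomial ι ℂ →ₗ[ℂ] MvPolynomial ι ℂ) {k : ℕ} (hk : 3 ≤ k)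
    (hskew : ∀ f, (∀ g : Γ, g • f = f) → ∀ h, (∀ g : Γ, g • h = h) → β f h = -β h f)
    (hleib : ∀ f, (∀ g : Γ, g • f = f) → ∀ f', (∀ g : Γ, g • f' = f') →
      ∀ h, (∀ g : Γ, g • h = h) → β (f * f') h = f * β f' h + f' * β f h)
    (hdeg : ∀ f, (∀ g : Γ, g • f = f) → ∀ h, (∀ g : Γ, g • h = h) → ∀ m n,
      f ∈ lowDeg ι 0 m → h ∈ lowDeg ι 0 n → β f h ∈ lowDeg ι k (m + n))
    {f h : MvPolynomial ι ℂ} (hf : ∀ g : Γ, g • f = f) (hh : ∀ g : Γ, g • h = h) :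
    β f h = 0 := by
  classical
  revert f h
  set P := MvPolynomial ι ℂ
  set K := FractionRing P
  -- the vector field `E b = {·, b}`
  have hE : ∀ b : {b : P // ∀ g : Γ, g • b = b}, ∃ D : Derivation ℂ P P,
      ∀ f, (∀ g : Γ, g • f = f) → D f = β f b := fun b =>
    H.exists_derivation_eq hcodim (β.flip b) fun f hf f' hf' => hleib f hf f' hf' b b.2
  choose E hE using hE
  have hEdeg : ∀ (b : {b : P // ∀ g : Γ, g • b = b}) (n : ℕ), (b : P) ∈ lowDeg ι 0 n → ∀ x : V,
      E b (lin x) ∈ lowDeg ι k (1 + n) := fun b n hb x =>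
    H.derivation_lin_mem_lowDeg (Γ := Γ) (E b)
      (fun f hf m hm => by rw [hE b f hf]; exact hdeg f hf b b.2 m n hm hb) x
  -- as `E b` may be tested on a spanning set of vectors, it suffices to show `{x, b} = 0` for
  -- a regular vector `x`, although `x` itself is not an invariant
  have hzero : ∀ b, E b = 0 := by
    intro b
    refine H.derivation_ext H.span_regularVectors fun x hx => ?_
    have hp := H.orbitDisc_ne_zero hx
    have hp' : algebraMap P K (orbitDisc x lin Γ) ≠ 0 := fun h =>
      hp (IsFractionRing.injective P K (h.trans (map_zero _).symm))
    let c : ℕ → {b : P // ∀ g : Γ, g • b = b} := fun i =>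
      ⟨(MulSemiringAction.charpoly Γ (lin x)).coeff i,
        MulSemiringAction.smul_coeff_charpoly (lin x) i⟩
    -- `G / p'(x)` is the vector field `{·, x}`
    let G : Derivation ℂ P P := -∑ i ∈ Finset.range (Fintype.card Γ + 1), lin x ^ i • E (c i)
    have hG : ∀ a : {b : P // ∀ g : Γ, g • b = b},
        G a = -(orbitDisc x lin Γ * E a (lin x)) := by
      intro a
      rw [← smul_eq_mul (orbitDisc x lin Γ), orbitDisc_smul]
      have hs : (∑ i ∈ Finset.range (Fintype.card Γ + 1), lin x ^ i • E (c i)) (a : P)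
          = ∑ i ∈ Finset.range (Fintype.card Γ + 1), lin x ^ i • E (c i) (a : P) :=
        (congrFun (map_sum (Derivation.coeFnAddMonoidHom (R := ℂ) (A := P) (M := P)) _ _)
          (a : P)).trans (Finset.sum_apply _ _ _)
      rw [Derivation.neg_apply, hs, neg_neg, ← Finset.sum_neg_distrib]
      refine Finset.sum_congr rfl fun i _ => ?_
      rw [hE (c i) a a.2, hskew a a.2 (c i) (c i).2, hE a (c i) (c i).2, smul_neg, neg_neg]
    let L : P →ₗ[P] K := (algebraMap P K (orbitDisc x lin Γ))⁻¹ • Algebra.linearMap P K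
    have hL : ∀ a : {b : P // ∀ g : Γ, g • b = b},
        L.compDer G a = algebraMap P K (-E a (lin x)) := by
      intro a
      change (algebraMap P K (orbitDisc x lin Γ))⁻¹ * algebraMap P K (G a) = _
      rw [hG, map_neg, map_mul, map_neg, mul_neg, ← mul_assoc, inv_mul_cancel₀ hp', one_mul]
    obtain ⟨G₀, hG₀⟩ := H.exists_regular_derivation (Γ := Γ) hcodim (L.compDer G)
      fun f hf => ⟨_, hL ⟨f, hf⟩⟩
    have hG₁ : ∀ a : {b : P // ∀ g : Γ, g • b = b}, G₀ a = -E a (lin x) := fun a =>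
      IsFractionRing.injective P K ((hG₀ a).symm.trans (hL a))
    -- `G₀ = {·, x}` sends vectors to polynomials of degree at most `2 - k < 0`
    have hG₂ : G₀ = 0 := by
      refine H.derivation_ext Submodule.span_univ fun y _ => ?_
      refine eq_zero_of_mem_lowDeg (k := k) (d := 1 + 1) (by omega)
        (H.derivation_lin_mem_lowDeg (Γ := Γ) G₀ (fun f hf m hm => ?_) y)
      rw [hG₁ ⟨f, hf⟩, add_comm]
      exact neg_mem (hEdeg ⟨f, hf⟩ m hm x)
    have := hG₁ b
    rw [hG₂, Derivation.zero_apply, eq_comm, neg_eq_zero] at this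
    exact this
  intro f h hf hh
  rw [← hE ⟨h, hh⟩ f hf, hzero, Derivation.zero_apply]

end IsLinearAction

end

end SymplecticReflection

/-! ### Deformed products on the invariants -/

namespace SymplecticReflection

noncomputable section

open Module MvPolynomial

section HomogeneousParts

variable {ι : Type*}

/-- The homogeneous polynomials of degree `d - k`; this is zero when `d < k`. -/
def homogDeg (ι : Type*) (k d : ℕ) : Submodule ℂ (MvPolynomial ι ℂ) :=
  restrictSupport ℂ {α | α.degree + k = d}

lemma mem_homogDeg {k d : ℕ} {f : MvPolynomial ι ℂ} :
    f ∈ homogDeg ι k d ↔ ∀ α ∈ f.support, α.degree + k = d := Iff.rfl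

lemma mem_homogDeg_zero {d : ℕ} {f : MvPolynomial ι ℂ} :
    f ∈ homogDeg ι 0 d ↔ f.IsHomogeneous d := by
  rw [mem_homogDeg]
  refine forall_congr' fun α => ?_
  rw [MvPolynomial.mem_support_iff, add_zero, Finsupp.degree_eq_weight_one]
  rfl

lemma mul_mem_homogDeg {j k d e : ℕ} {f h : MvPolynomial ι ℂ} (hf : f ∈ homogDeg ι j d)
    (hh : h ∈ homogDeg ι k e) : f * h ∈ homogDeg ι (j + k) (d + e) := by
  classical
  refine mem_homogDeg.mpr fun α hα => ?_
  obtain ⟨β, hβ, γ, hγ, rfl⟩ := Finset.mem_add.mp (support_mul f h hα)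
  have h1 := mem_homogDeg.mp hf β hβ
  have h2 := mem_homogDeg.mp hh γ hγ
  rw [map_add]
  omega

lemma eq_zero_of_mem_homogDeg {k d : ℕ} {f : MvPolynomial ι ℂ} (hf : f ∈ homogDeg ι k d)
    (hf' : f ∈ lowDeg ι (k + 1) d) : f = 0 := by
  by_contra h
  obtain ⟨α, hα⟩ := support_nonempty.mpr h
  have h1 := mem_homogDeg.mp hf α hα
  have h2 := mem_lowDeg.mp hf' α hα
  omega

/-- The homogeneous part of degree `d - k`, or zero when `d < k`. -/
def part (ι : Type*) (k d : ℕ) : MvPolynomial ι ℂ →ₗ[ℂ] MvPolynomial ι ℂ :=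
  if k ≤ d then homogeneousComponent (d - k) else 0

lemma part_mem_homogDeg (k d : ℕ) (f : MvPolynomial ι ℂ) : part ι k d f ∈ homogDeg ι k d := by
  rw [part]
  split_ifs with h
  · refine mem_homogDeg.mpr fun α hα => ?_
    rw [MvPolynomial.mem_support_iff, coeff_homogeneousComponent] at hα
    have : α.degree = d - k := by
      by_contra h'
      exact hα (if_neg h')
    omega
  · exact zero_mem _

lemma sub_part_mem_lowDeg {k d : ℕ} {f : MvPolynomial ι ℂ} (hf : f ∈ lowDeg ι k d) :
    f - part ι k d f ∈ lowDeg ι (k + 1) d := by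
  rcases Nat.lt_or_ge d k with h | h
  · rw [eq_zero_of_mem_lowDeg h hf, map_zero, sub_zero]
    exact zero_mem _
  · rw [mem_lowDeg_iff_homogeneousComponent] at hf ⊢
    intro j hj
    rw [part, if_pos h, map_sub]
    rcases Nat.lt_or_ge d (j + k) with h' | h'
    · rw [hf j h', zero_sub, neg_eq_zero,
        homogeneousComponent_of_mem (homogeneousComponent_mem (d - k) f), if_neg (by omega)]
    · obtain rfl : j = d - k := by omega
      rw [homogeneousComponent_of_mem (homogeneousComponent_mem (d - k) f), if_pos rfl, sub_self]

/-- Linear maps on homogeneous polynomials are determined by their values on monomials. -/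
lemma eqOn_homogeneous {M : Type*} [AddCommGroup M] [Module ℂ M] {φ ψ : MvPolynomial ι ℂ →ₗ[ℂ] M}
    {d : ℕ} (h : ∀ α : ι →₀ ℕ, α.degree = d → φ (monomial α 1) = ψ (monomial α 1))
    {f : MvPolynomial ι ℂ} (hf : f.IsHomogeneous d) : φ f = ψ f := by
  have hs : homogDeg ι 0 d ≤ LinearMap.eqLocus φ ψ := by
    rw [homogDeg, restrictSupport_eq_span, Submodule.span_le]
    rintro _ ⟨α, hα, rfl⟩
    exact h α hα
  exact hs (mem_homogDeg_zero.mpr hf)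

/-- The part of a bilinear operation which lowers the total degree by `k`. -/
def gradedPart (k : ℕ) (B : MvPolynomial ι ℂ →ₗ[ℂ] MvPolynomial ι ℂ →ₗ[ℂ] MvPolynomial ι ℂ) :
    MvPolynomial ι ℂ →ₗ[ℂ] MvPolynomial ι ℂ →ₗ[ℂ] MvPolynomial ι ℂ :=
  (basisMonomials ι ℂ).constr ℂ fun α => (basisMonomials ι ℂ).constr ℂ fun γ =>
    part ι k (α.degree + γ.degree) (B (monomial α 1) (monomial γ 1))

lemma gradedPart_monomial (k : ℕ)
    (B : MvPolynomial ι ℂ →ₗ[ℂ] MvPolynomial ι ℂ →ₗ[ℂ] MvPolynomial ι ℂ) (α γ : ι →₀ ℕ) :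
    gradedPart k B (monomial α 1) (monomial γ 1)
      = part ι k (α.degree + γ.degree) (B (monomial α 1) (monomial γ 1)) := by
  have h : ∀ α : ι →₀ ℕ, (monomial α 1 : MvPolynomial ι ℂ) = basisMonomials ι ℂ α := fun α => by
    simp
  rw [gradedPart]
  conv_lhs => rw [h α, h γ]
  rw [Basis.constr_basis, Basis.constr_basis]

lemma gradedPart_apply (k : ℕ)
    (B : MvPolynomial ι ℂ →ₗ[ℂ] MvPolynomial ι ℂ →ₗ[ℂ] MvPolynomial ι ℂ)
    {m n : ℕ} {f h : MvPolynomial ι ℂ} (hf : f.IsHomogeneous m) (hh : h.IsHomogeneous n) :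
    gradedPart k B f h = part ι k (m + n) (B f h) := by
  refine eqOn_homogeneous (φ := (gradedPart k B).flip h)
    (ψ := part ι k (m + n) ∘ₗ B.flip h) (fun α hα => ?_) hf
  refine eqOn_homogeneous (φ := gradedPart k B (monomial α 1))
    (ψ := part ι k (m + n) ∘ₗ B (monomial α 1)) (fun γ hγ => ?_) hh
  rw [gradedPart_monomial, hα, hγ]
  rfl

end HomogeneousParts

namespace IsLinearAction

variable {ι V Γ : Type*} [AddCommGroup V] [Module ℂ V] [Group Γ]
  [MulSemiringAction Γ (MvPolynomial ι ℂ)] [SMulCommClass Γ ℂ (MvPolynomial ι ℂ)]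
  {act : Γ →* (V ≃ₗ[ℂ] V)} {lin : V →ₗ[ℂ] MvPolynomial ι ℂ}

lemma smul_isHomogeneous (H : IsLinearAction act lin) (g : Γ) {f : MvPolynomial ι ℂ} {d : ℕ}
    (hf : f.IsHomogeneous d) : (g • f).IsHomogeneous d := by
  have e : MulSemiringAction.toAlgHom ℂ (MvPolynomial ι ℂ) g = aeval fun i => g • X i :=
    MvPolynomial.algHom_ext fun i => by simp
  have h := hf.aeval (fun i => g • (X i : MvPolynomial ι ℂ)) (n := 1) fun i => by
    obtain ⟨x, hx⟩ := H.X_mem_range i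
    rw [← hx, H.smul_lin]
    exact H.lin_isHomogeneous _
  rw [← e, one_mul] at h
  exact h

lemma homogeneousComponent_smul (H : IsLinearAction act lin) (g : Γ) (f : MvPolynomial ι ℂ)
    (i : ℕ) : homogeneousComponent i (g • f) = g • homogeneousComponent i f := by
  conv_lhs => rw [← sum_homogeneousComponent f]
  rw [Finset.smul_sum, map_sum]
  have h : ∀ j, homogeneousComponent i (g • homogeneousComponent j f)
      = if j = i then g • homogeneousComponent i f else 0 := by
    intro j
    rw [homogeneousComponent_of_mem ((mem_homogeneousSubmodule _ _).mpr
      (H.smul_isHomogeneous g (homogeneousComponent_isHomogeneous j f)))]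
    by_cases hij : j = i
    · rw [if_pos hij, if_pos hij.symm, hij]
    · rw [if_neg hij, if_neg (Ne.symm hij)]
  simp only [h]
  rw [Finset.sum_ite_eq']
  split_ifs with hi
  · rfl
  · rw [Finset.mem_range, not_lt, Nat.succ_le_iff] at hi
    rw [homogeneousComponent_eq_zero _ _ hi, smul_zero]

/-- Invariants are sums of homogeneous invariants. -/
lemma inv_induction (H : IsLinearAction act lin) {p : MvPolynomial ι ℂ → Prop} (h0 : p 0)
    (hadd : ∀ f h, p f → p h → p (f + h)) {d : ℕ}
    (hhom : ∀ m ≤ d, ∀ f ∈ FixedPoints.subalgebra ℂ (MvPolynomial ι ℂ) Γ,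
      f.IsHomogeneous m → p f) {f : MvPolynomial ι ℂ}
    (hf : f ∈ FixedPoints.subalgebra ℂ (MvPolynomial ι ℂ) Γ) (hd : f ∈ lowDeg ι 0 d) : p f := by
  rw [← sum_homogeneousComponent f]
  refine Finset.sum_induction _ p hadd h0 fun i hi => hhom i ?_ _ ?_
    (homogeneousComponent_isHomogeneous i f)
  · have := mem_lowDeg_zero.mp hd
    rw [Finset.mem_range] at hi
    omega
  · intro g
    rw [← H.homogeneousComponent_smul, hf g]

end IsLinearAction

/-- A product on the invariants `(SV)^Γ`, given as the restriction of a bilinear operation on `SV`,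
which is associative, agrees with the commutative product up to terms of lower degree, and whose
commutator agrees with the bracket `pb` up to terms of degree at least three less than the
product. -/
structure IsDeformedProduct {ι : Type*} (Γ : Type*) [Group Γ]
    [MulSemiringAction Γ (MvPolynomial ι ℂ)] [SMulCommClass Γ ℂ (MvPolynomial ι ℂ)]
    (star pb : MvPolynomial ι ℂ →ₗ[ℂ] MvPolynomial ι ℂ →ₗ[ℂ] MvPolynomial ι ℂ) : Prop where
  star_mem : ∀ f ∈ FixedPoints.subalgebra ℂ (MvPolynomial ι ℂ) Γ,
    ∀ h ∈ FixedPoints.subalgebra ℂ (MvPolynomial ι ℂ) Γ,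
      star f h ∈ FixedPoints.subalgebra ℂ (MvPolynomial ι ℂ) Γ
  assoc : ∀ f ∈ FixedPoints.subalgebra ℂ (MvPolynomial ι ℂ) Γ,
    ∀ h ∈ FixedPoints.subalgebra ℂ (MvPolynomial ι ℂ) Γ,
    ∀ l ∈ FixedPoints.subalgebra ℂ (MvPolynomial ι ℂ) Γ,
      star (star f h) l = star f (star h l)
  symbol : ∀ f ∈ FixedPoints.subalgebra ℂ (MvPolynomial ι ℂ) Γ,
    ∀ h ∈ FixedPoints.subalgebra ℂ (MvPolynomial ι ℂ) Γ, ∀ m n, f ∈ lowDeg ι 0 m →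
      h ∈ lowDeg ι 0 n → star f h - f * h ∈ lowDeg ι 1 (m + n)
  bracket : ∀ f ∈ FixedPoints.subalgebra ℂ (MvPolynomial ι ℂ) Γ,
    ∀ h ∈ FixedPoints.subalgebra ℂ (MvPolynomial ι ℂ) Γ, ∀ m n, f ∈ lowDeg ι 0 m →
      h ∈ lowDeg ι 0 n → star f h - star h f - pb f h ∈ lowDeg ι 3 (m + n)

namespace IsDeformedProduct

variable {ι V Γ : Type*} [AddCommGroup V] [Module ℂ V] [Group Γ]
  [MulSemiringAction Γ (MvPolynomial ι ℂ)] [SMulCommClass Γ ℂ (MvPolynomial ι ℂ)]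
  {act : Γ →* (V ≃ₗ[ℂ] V)} {lin : V →ₗ[ℂ] MvPolynomial ι ℂ}
  {star pb : MvPolynomial ι ℂ →ₗ[ℂ] MvPolynomial ι ℂ →ₗ[ℂ] MvPolynomial ι ℂ}

/-- A bilinear operation on `R` which lowers the total degree by `k` does so for arguments in any
step of the degree filtration. -/
lemma shift {R : Subalgebra ℂ (MvPolynomial ι ℂ)}
    {B : MvPolynomial ι ℂ →ₗ[ℂ] MvPolynomial ι ℂ →ₗ[ℂ] MvPolynomial ι ℂ} {k : ℕ}
    (hB : ∀ f ∈ R, ∀ h ∈ R, ∀ m n, f ∈ lowDeg ι 0 m → h ∈ lowDeg ι 0 n →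
      B f h ∈ lowDeg ι k (m + n)) {i j m n : ℕ} {f h : MvPolynomial ι ℂ} (hf : f ∈ R) (hh : h ∈ R)
    (hfm : f ∈ lowDeg ι i m) (hhn : h ∈ lowDeg ι j n) : B f h ∈ lowDeg ι (k + i + j) (m + n) := by
  rcases Nat.lt_or_ge m i with hi | hi
  · rw [eq_zero_of_mem_lowDeg hi hfm, map_zero, LinearMap.zero_apply]
    exact zero_mem _
  rcases Nat.lt_or_ge n j with hj | hj
  · rw [eq_zero_of_mem_lowDeg hj hhn, map_zero]
    exact zero_mem _
  exact lowDeg_le (by omega) (hB f hf h hh (m - i) (n - j) (lowDeg_le (by omega) hfm)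
    (lowDeg_le (by omega) hhn))

/-- The commutator of `star`. -/
def commutator (star : MvPolynomial ι ℂ →ₗ[ℂ] MvPolynomial ι ℂ →ₗ[ℂ] MvPolynomial ι ℂ) :
    MvPolynomial ι ℂ →ₗ[ℂ] MvPolynomial ι ℂ →ₗ[ℂ] MvPolynomial ι ℂ := star - star.flip

lemma commutator_apply (f h : MvPolynomial ι ℂ) : commutator star f h = star f h - star h f := rfl

variable [Fintype Γ] [Finite ι]

/-- If all commutators lower the degree by `k ≥ 3`, they lower it by `k + 1`: the leading parts
form a biderivation, which vanishes by `bracket_eq_zero`. -/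
lemma comm_lowers (h : IsDeformedProduct Γ star pb) (H : IsLinearAction act lin)
    (hcodim : ∀ g, g ≠ 1 → ∀ v : V, ¬ LinearMap.range (idSub (act g)) ≤ Submodule.span ℂ {v})
    {k : ℕ} (hk : 3 ≤ k)
    (hC : ∀ f ∈ FixedPoints.subalgebra ℂ (MvPolynomial ι ℂ) Γ,
      ∀ l ∈ FixedPoints.subalgebra ℂ (MvPolynomial ι ℂ) Γ, ∀ m n, f ∈ lowDeg ι 0 m →
      l ∈ lowDeg ι 0 n → commutator star f l ∈ lowDeg ι k (m + n)) :
    ∀ f ∈ FixedPoints.subalgebra ℂ (MvPolynomial ι ℂ) Γ,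
      ∀ l ∈ FixedPoints.subalgebra ℂ (MvPolynomial ι ℂ) Γ, ∀ m n, f ∈ lowDeg ι 0 m →
      l ∈ lowDeg ι 0 n → commutator star f l ∈ lowDeg ι (k + 1) (m + n) := by
  set R := FixedPoints.subalgebra ℂ (MvPolynomial ι ℂ) Γ with hR
  set β := gradedPart k (commutator star) with hβ
  have hlow : ∀ f : MvPolynomial ι ℂ, f ∈ lowDeg ι 0 f.totalDegree := fun f =>
    mem_lowDeg_zero.mpr le_rfl
  have hhom : ∀ {f : MvPolynomial ι ℂ} {m}, f.IsHomogeneous m → f ∈ lowDeg ι 0 m := fun hf =>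
    mem_lowDeg_of_isHomogeneous hf
  -- `β` is the leading part of the commutator
  have hlead : ∀ f ∈ R, ∀ l ∈ R, ∀ m n, f ∈ lowDeg ι 0 m → l ∈ lowDeg ι 0 n →
      commutator star f l - β f l ∈ lowDeg ι (k + 1) (m + n) := by
    intro f hf l hl m n hfm hln
    refine H.inv_induction (p := fun f => commutator star f l - β f l ∈ lowDeg ι (k + 1) (m + n))
      (by simp) (fun f f' h h' => ?_) (fun i hi f hf hfi => ?_) hf hfm
    · have := add_mem h h'
      rw [map_add, map_add, LinearMap.add_apply, LinearMap.add_apply]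
      convert this using 1
      ring
    refine H.inv_induction (p := fun l => commutator star f l - β f l ∈ lowDeg ι (k + 1) (m + n))
      (by simp) (fun f f' h h' => ?_) (fun j hj l hl hlj => ?_) hl hln
    · have := add_mem h h'
      rw [map_add, map_add]
      convert this using 1
      ring
    rw [hβ, gradedPart_apply k _ hfi hlj]
    exact lowDeg_le (by omega) (sub_part_mem_lowDeg (hC f hf l hl i j (hhom hfi) (hhom hlj)))
  have hβhom : ∀ {f l : MvPolynomial ι ℂ} {m n : ℕ}, f.IsHomogeneous m → l.IsHomogeneous n →
      β f l ∈ homogDeg ι k (m + n) := fun hf hl => by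
    rw [hβ, gradedPart_apply k _ hf hl]
    exact part_mem_homogDeg _ _ _
  have hskew : ∀ f ∈ R, ∀ l ∈ R, β f l = -β l f := by
    intro f hf l hl
    refine H.inv_induction (p := fun f => β f l = -β l f) (by simp) (fun f f' h h' => ?_)
      (fun i hi f hf hfi => ?_) hf (hlow f)
    · rw [map_add, map_add, LinearMap.add_apply, h, h', neg_add]
    refine H.inv_induction (p := fun l => β f l = -β l f) (by simp) (fun f f' h h' => ?_)
      (fun j hj l hl hlj => ?_) hl (hlow l)
    · rw [map_add, map_add, LinearMap.add_apply, h, h', neg_add]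
    rw [hβ, gradedPart_apply k _ hfi hlj, gradedPart_apply k _ hlj hfi, ← map_neg, add_comm i j]
    congr 1
    rw [commutator_apply, commutator_apply, neg_sub]
  have hleib : ∀ f ∈ R, ∀ f' ∈ R, ∀ l ∈ R, β (f * f') l = f * β f' l + f' * β f l := by
    intro f hf f' hf' l hl
    refine H.inv_induction (p := fun f => β (f * f') l = f * β f' l + f' * β f l) (by simp)
      (fun x y h h' => ?_) (fun p _ f hf hfp => ?_) hf (hlow f)
    · rw [add_mul, map_add, LinearMap.add_apply, h, h', map_add, LinearMap.add_apply]
      ring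
    refine H.inv_induction (p := fun f' => β (f * f') l = f * β f' l + f' * β f l) (by simp)
      (fun x y h h' => ?_) (fun q _ f' hf' hfq => ?_) hf' (hlow f')
    · rw [mul_add, map_add, LinearMap.add_apply, h, h', map_add, LinearMap.add_apply]
      ring
    refine H.inv_induction (p := fun l => β (f * f') l = f * β f' l + f' * β f l) (by simp)
      (fun x y h h' => ?_) (fun r _ l hl hlr => ?_) hl (hlow l)
    · rw [map_add, h, h', map_add, map_add]
      ring
    rw [← sub_eq_zero]
    refine eq_zero_of_mem_homogDeg (k := k) (d := p + q + r) ?_ ?_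
    · have h1 := hβhom (hfp.mul hfq) hlr
      have h2 := mul_mem_homogDeg (mem_homogDeg_zero.mpr hfp) (hβhom hfq hlr)
      have h3 := mul_mem_homogDeg (mem_homogDeg_zero.mpr hfq) (hβhom hfp hlr)
      rw [zero_add, ← add_assoc] at h2
      rw [zero_add, ← add_assoc, add_comm q p] at h3
      exact sub_mem h1 (add_mem h2 h3)
    · have hsym : ∀ f ∈ R, ∀ l ∈ R, ∀ m n, f ∈ lowDeg ι 0 m → l ∈ lowDeg ι 0 n →
          (star - LinearMap.mul ℂ (MvPolynomial ι ℂ)) f l ∈ lowDeg ι 1 (m + n) := h.symbol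
      have c1 : commutator star f' l ∈ R :=
        sub_mem (h.star_mem f' hf' l hl) (h.star_mem l hl f' hf')
      have c2 : commutator star f l ∈ R := sub_mem (h.star_mem f hf l hl) (h.star_mem l hl f hf)
      have c3 : f * f' - star f f' ∈ R := sub_mem (mul_mem hf hf') (h.star_mem f hf f' hf')
      have d1 := hC f' hf' l hl q r (hhom hfq) (hhom hlr)
      have d2 := hC f hf l hl p r (hhom hfp) (hhom hlr)
      have d3 : f * f' - star f f' ∈ lowDeg ι 1 (p + q) := by
        rw [← neg_sub]
        exact neg_mem (h.symbol f hf f' hf' p q (hhom hfp) (hhom hfq))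
      have e1 := hlead _ (mul_mem hf hf') l hl (p + q) r (hhom (hfp.mul hfq)) (hhom hlr)
      have e2 := mul_mem_lowDeg (hhom hfp) (hlead f' hf' l hl q r (hhom hfq) (hhom hlr))
      have e3 := mul_mem_lowDeg (hhom hfq) (hlead f hf l hl p r (hhom hfp) (hhom hlr))
      have e4 := shift hC c3 hl d3 (hhom hlr)
      have e5 := shift hsym hf c1 (hhom hfp) d1
      have e6 := shift hsym c2 hf' d2 (hhom hfq)
      have e2' := lowDeg_le (k' := k + 1) (d' := p + q + r) (by omega) e2
      have e3' := lowDeg_le (k' := k + 1) (d' := p + q + r) (by omega) e3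
      have e4' := lowDeg_le (k' := k + 1) (d' := p + q + r) (by omega) e4
      have e5' := lowDeg_le (k' := k + 1) (d' := p + q + r) (by omega) e5
      have e6' := lowDeg_le (k' := k + 1) (d' := p + q + r) (by omega) e6
      -- the commutator with `l` is a derivation of `star`
      have hder : commutator star (star f f') l
          = star f (commutator star f' l) + star (commutator star f l) f' := by
        simp only [commutator_apply, map_sub, LinearMap.sub_apply]
        rw [h.assoc f hf f' hf' l hl, h.assoc f hf l hl f' hf', h.assoc l hl f hf f' hf']
        abel
      have := sub_mem (add_mem (add_mem e2' e3') (add_mem (add_mem e4' e5') e6')) e1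
      convert this using 1
      rw [map_sub (commutator star), LinearMap.sub_apply, hder]
      simp only [LinearMap.sub_apply, LinearMap.mul_apply']
      ring
  intro f hf l hl m n hfm hln
  have := hlead f hf l hl m n hfm hln
  rwa [H.bracket_eq_zero hcodim β hk hskew hleib (fun f hf l hl m n hfm hln => by
    have h1 := lowDeg_le (k' := k) (d' := m + n) (by omega) (hlead f hf l hl m n hfm hln)
    have h2 := sub_mem (hC f hf l hl m n hfm hln) h1
    rwa [sub_sub_cancel] at h2) hf hl, sub_zero] at this

/-- If the bracket vanishes, the deformed product is commutative: by `comm_lowers` its commutators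
lower the degree by any amount. -/
theorem star_comm (h : IsDeformedProduct Γ star 0) (H : IsLinearAction act lin)
    (hcodim : ∀ g, g ≠ 1 → ∀ v : V, ¬ LinearMap.range (idSub (act g)) ≤ Submodule.span ℂ {v})
    {f l : MvPolynomial ι ℂ} (hf : f ∈ FixedPoints.subalgebra ℂ (MvPolynomial ι ℂ) Γ)
    (hl : l ∈ FixedPoints.subalgebra ℂ (MvPolynomial ι ℂ) Γ) : star f l = star l f := by
  have key : ∀ k, ∀ f ∈ FixedPoints.subalgebra ℂ (MvPolynomial ι ℂ) Γ,
      ∀ l ∈ FixedPoints.subalgebra ℂ (MvPolynomial ι ℂ) Γ, ∀ m n, f ∈ lowDeg ι 0 m →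
      l ∈ lowDeg ι 0 n → commutator star f l ∈ lowDeg ι (k + 3) (m + n) := by
    intro k
    induction k with
    | zero =>
      intro f hf l hl m n hfm hln
      have := h.bracket f hf l hl m n hfm hln
      rwa [LinearMap.zero_apply, LinearMap.zero_apply, sub_zero] at this
    | succ k ih =>
      have := h.comm_lowers H hcodim (by omega) ih
      simpa only [Nat.add_right_comm k 3 1] using this
  refine sub_eq_zero.mp (eq_zero_of_mem_lowDeg ?_ (key (f.totalDegree + l.totalDegree) f hf l hl _ _
    (mem_lowDeg_zero.mpr le_rfl) (mem_lowDeg_zero.mpr le_rfl)))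
  omega

end IsDeformedProduct

end

end SymplecticReflection

/-! ### Lifting polynomials to the smash product -/

namespace SymplecticReflection

noncomputable section

open Module MvPolynomial

namespace SmashData

variable {ι V Γ A : Type*} [AddCommGroup V] [Module ℂ V] [Group Γ] [Ring A] [Algebra ℂ A]
variable (S : SmashData ι V Γ A)

lemma σ_σ_inv (g : Γ) (f : MvPolynomial ι ℂ) : S.σ g (S.σ g⁻¹ f) = f := by
  have := AlgHom.congr_fun (S.σ_mul g g⁻¹) f
  rw [mul_inv_cancel, σ_one] at this
  exact this.symm

lemma gr_mul_inv (g : Γ) : S.gr g * S.gr g⁻¹ = 1 := by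
  rw [← map_mul, mul_inv_cancel, map_one]

lemma gr_inv_mul (g : Γ) : S.gr g⁻¹ * S.gr g = 1 := by
  rw [← map_mul, inv_mul_cancel, map_one]

lemma word_mem_W {w : List ι} {n : ℕ} (h : w.length ≤ n) : S.word w ∈ S.W n :=
  Submodule.subset_span ⟨w, h, rfl⟩

lemma vec_mul_mem_W {n : ℕ} {y : A} (hy : y ∈ S.W n) (x : V) : S.vec x * y ∈ S.W (n + 1) := by
  refine S.vec_mem_of_basis (LinearMap.mulRight ℂ y) (fun i => ?_) x
  refine Submodule.span_induction (p := fun y _ => S.vec (S.b i) * y ∈ S.W (n + 1)) ?_ (by simp)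
    (fun x y _ _ hx hy => by rw [mul_add]; exact add_mem hx hy)
    (fun r x _ hx => by rw [mul_smul_comm]; exact Submodule.smul_mem _ _ hx) hy
  rintro _ ⟨w, hw, rfl⟩
  rw [← word_cons]
  exact S.word_mem_W (Nat.succ_le_succ hw)

lemma W_mono {m n : ℕ} (h : m ≤ n) : S.W m ≤ S.W n :=
  Submodule.span_mono (Set.image_mono fun _ hw => le_trans hw h)

lemma lp_mem_W (l : List V) : S.lp l ∈ S.W l.length := by
  induction l with
  | nil => exact S.word_mem_W (w := []) le_rfl
  | cons x l ih => simpa [lp] using S.vec_mul_mem_W ih x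

lemma conj_mem_W {n : ℕ} {y : A} (hy : y ∈ S.W n) (g : Γ) :
    S.gr g * y * S.gr g⁻¹ ∈ S.W n := by
  refine Submodule.span_induction (p := fun y _ => S.gr g * y * S.gr g⁻¹ ∈ S.W n) ?_ (by simp)
    (fun x y _ _ hx hy => by rw [mul_add, add_mul]; exact add_mem hx hy)
    (fun r x _ hx => by rw [mul_smul_comm, smul_mul_assoc]; exact Submodule.smul_mem _ _ hx) hy
  rintro _ ⟨w, hw, rfl⟩
  rw [word_eq_lp, gr_mul_lp, mul_assoc, gr_mul_inv, mul_one]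
  refine S.W_mono ?_ (S.lp_mem_W _)
  simpa using hw

lemma Θ_conj (g : Γ) (y : A) : S.Θ (S.gr g * y * S.gr g⁻¹) = S.σ g (S.Θ y) := by
  rw [Θ_mul_gr, Θ_gr_mul]

/-- The elements of `A` of tensor degree less than `n`. -/
def below : ℕ → Submodule ℂ A
  | 0 => ⊥
  | n + 1 => S.F n

lemma below_mono {m n : ℕ} (h : m ≤ n) : S.below m ≤ S.below n := by
  cases m with
  | zero => exact bot_le
  | succ m =>
    cases n with
    | zero => omega
    | succ n => exact S.F_mono (by omega)

section Lift

variable [LinearOrder ι]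

/-- The sorted word of a monomial. -/
def sortedWord (α : ι →₀ ℕ) : List ι := α.toMultiset.sort (· ≤ ·)

lemma mon_sortedWord (α : ι →₀ ℕ) : mon (sortedWord α) = monomial α (1 : ℂ) := by
  have h : (mon (sortedWord α) : MvPolynomial ι ℂ) = (α.toMultiset.map X).prod := by
    rw [mon, ← Multiset.prod_coe, ← Multiset.map_coe, sortedWord, Multiset.sort_eq]
  rw [h, Finsupp.toMultiset_map, Finsupp.prod_toMultiset, monomial_eq, C_1, one_mul,
    Finsupp.prod_mapDomain_index (by simp) (by intros; rw [pow_add])]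

lemma length_sortedWord (α : ι →₀ ℕ) : (sortedWord α).length = α.degree := by
  rw [sortedWord, Multiset.length_sort, Finsupp.card_toMultiset, Finsupp.degree_apply]
  rfl

lemma exists_mon_eq (w : List ι) : ∃ α : ι →₀ ℕ,
    (mon w : MvPolynomial ι ℂ) = monomial α 1 ∧ sortedWord α = w.insertionSort (· ≤ ·) := by
  have h : sortedWord (Multiset.toFinsupp (w : Multiset ι)) = w.insertionSort (· ≤ ·) := by
    rw [sortedWord, Multiset.toFinsupp_toMultiset]
    refine List.Perm.eq_of_pairwise (le := (· ≤ ·)) (fun a b _ _ => le_antisymm)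
      (Multiset.pairwise_sort _ _) (List.pairwise_insertionSort _ _) ?_
    rw [← Multiset.coe_eq_coe, Multiset.sort_eq, Multiset.coe_eq_coe]
    exact (List.perm_insertionSort _ _).symm
  refine ⟨Multiset.toFinsupp (w : Multiset ι), ?_, h⟩
  rw [← mon_sortedWord, h, mon, mon]
  exact ((List.perm_insertionSort _ w).symm.map _).prod_eq

/-- The lift `SV → A` which sends a monomial to its sorted word. -/
def ordLift : MvPolynomial ι ℂ →ₗ[ℂ] A :=
  (basisMonomials ι ℂ).constr ℂ fun α => S.word (sortedWord α)

lemma ordLift_monomial (α : ι →₀ ℕ) : S.ordLift (monomial α 1) = S.word (sortedWord α) := by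
  rw [ordLift, show (monomial α (1 : ℂ) : MvPolynomial ι ℂ) = basisMonomials ι ℂ α by simp,
    Basis.constr_basis]

lemma Θ_ordLift (f : MvPolynomial ι ℂ) : S.Θ (S.ordLift f) = f := by
  have : S.Θ ∘ₗ S.ordLift = LinearMap.id := (basisMonomials ι ℂ).ext fun α => by
    rw [coe_basisMonomials, LinearMap.comp_apply, ordLift_monomial, Θ_word, mon_sortedWord]
    rfl
  exact LinearMap.congr_fun this f

lemma ordLift_mem_W {n : ℕ} {f : MvPolynomial ι ℂ} (hf : f ∈ lowDeg ι 0 n) :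
    S.ordLift f ∈ S.W n := by
  have h : lowDeg ι 0 n ≤ (S.W n).comap S.ordLift := by
    rw [lowDeg, restrictSupport_eq_span, Submodule.span_le]
    rintro _ ⟨α, hα, rfl⟩
    rw [SetLike.mem_coe, Submodule.mem_comap, ordLift_monomial]
    exact S.word_mem_W (by rw [length_sortedWord]; exact hα)
  exact h hf

lemma σ_mem_lowDeg (g : Γ) {n : ℕ} {f : MvPolynomial ι ℂ} (hf : f ∈ lowDeg ι 0 n) :
    S.σ g f ∈ lowDeg ι 0 n := by
  rw [← S.Θ_ordLift f, ← Θ_conj]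
  exact mem_lowDeg_zero.mpr (S.Θ_totalDegree (S.W_le_F n (S.conj_mem_W (S.ordLift_mem_W hf) g)))

variable [Fintype Γ]

/-- An element of degree `n` is represented, modulo the relations and up to terms of lower degree,
by the ordered lift of its symbol. -/
lemma sub_ordLift_mem {n : ℕ} {y : A} (hy : y ∈ S.W n) :
    y - S.ordLift (S.Θ y) ∈ S.J n ⊔ S.below n := by
  refine Submodule.span_induction (p := fun y _ => y - S.ordLift (S.Θ y) ∈ S.J n ⊔ S.below n) ?_
    (by simp) (fun x y _ _ hx hy => ?_) (fun r x _ hx => ?_) hy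
  · rintro _ ⟨w, hw, rfl⟩
    obtain ⟨α, h1, h2⟩ := exists_mon_eq w
    rw [Θ_word, h1, ordLift_monomial, h2]
    have h3 := S.J_mono hw (S.word_sub_sort_mem_J w)
    have h4 : S.psi w ∈ S.below n := by
      refine S.below_mono hw ?_
      cases w with
      | nil => exact zero_mem _
      | cons i w => exact S.psi_mem_F (i :: w) w.length (by simp)
    have := add_mem (Submodule.mem_sup_left h3) (Submodule.mem_sup_right h4)
    rwa [sub_add_cancel] at this
  · have := add_mem hx hy
    rw [map_add, map_add]
    convert this using 1
    abel
  · rw [map_smul, map_smul, ← smul_sub]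
    exact Submodule.smul_mem _ _ hx

/-- The `Γ`-equivariant lift `SV → A`, the average of the conjugates of the ordered lift. -/
def lift : MvPolynomial ι ℂ →ₗ[ℂ] A :=
  (Fintype.card Γ : ℂ)⁻¹ • ∑ g, LinearMap.mulRight ℂ (S.gr g⁻¹) ∘ₗ LinearMap.mulLeft ℂ (S.gr g) ∘ₗ
    S.ordLift ∘ₗ (S.σ g⁻¹).toLinearMap

lemma lift_apply (f : MvPolynomial ι ℂ) : S.lift f
    = (Fintype.card Γ : ℂ)⁻¹ • ∑ g, S.gr g * S.ordLift (S.σ g⁻¹ f) * S.gr g⁻¹ := by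
  simp [lift]

lemma Θ_lift (f : MvPolynomial ι ℂ) : S.Θ (S.lift f) = f := by
  have h0 : (Fintype.card Γ : ℂ) ≠ 0 := Nat.cast_ne_zero.mpr Fintype.card_ne_zero
  rw [lift_apply, map_smul, map_sum]
  simp only [Θ_conj, Θ_ordLift, σ_σ_inv]
  rw [Finset.sum_const, Finset.card_univ, ← Nat.cast_smul_eq_nsmul ℂ, smul_smul,
    inv_mul_cancel₀ h0, one_smul]

lemma lift_mem_W {n : ℕ} {f : MvPolynomial ι ℂ} (hf : f ∈ lowDeg ι 0 n) : S.lift f ∈ S.W n := by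
  rw [lift_apply]
  exact Submodule.smul_mem _ _ (Submodule.sum_mem _ fun g _ =>
    S.conj_mem_W (S.ordLift_mem_W (S.σ_mem_lowDeg g⁻¹ hf)) g)

lemma gr_mul_lift (h : Γ) (f : MvPolynomial ι ℂ) :
    S.gr h * S.lift f = S.lift (S.σ h f) * S.gr h := by
  rw [lift_apply, lift_apply, mul_smul_comm, smul_mul_assoc, Finset.mul_sum, Finset.sum_mul]
  congr 1
  refine Fintype.sum_equiv (Equiv.mulLeft h) _ _ fun g => ?_
  have e : S.σ (h * g)⁻¹ (S.σ h f) = S.σ g⁻¹ f := by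
    rw [← AlgHom.comp_apply, ← σ_mul]
    congr 2
    group
  rw [Equiv.coe_mulLeft, e, mul_inv_rev, map_mul, map_mul]
  simp only [mul_assoc]
  rw [gr_inv_mul, mul_one]

/-- The symmetriser `e = |Γ|⁻¹ ∑_g g` in `A`. -/
def sym : A := (Fintype.card Γ : ℂ)⁻¹ • ∑ g, S.gr g

omit [LinearOrder ι] in
lemma gr_mul_sym (g : Γ) : S.gr g * S.sym = S.sym := by
  rw [sym, mul_smul_comm, Finset.mul_sum]
  congr 1
  exact Fintype.sum_equiv (Equiv.mulLeft g) _ _ fun h => by simp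

omit [LinearOrder ι] in
lemma sym_mul_sym : S.sym * S.sym = S.sym := by
  have h0 : (Fintype.card Γ : ℂ) ≠ 0 := Nat.cast_ne_zero.mpr Fintype.card_ne_zero
  conv_lhs => enter [1]; rw [sym]
  rw [smul_mul_assoc, Finset.sum_mul]
  simp only [gr_mul_sym]
  rw [Finset.sum_const, Finset.card_univ, ← Nat.cast_smul_eq_nsmul ℂ, smul_smul,
    inv_mul_cancel₀ h0, one_smul]

omit [LinearOrder ι] in
lemma Θ_mul_sym (y : A) : S.Θ (y * S.sym) = S.Θ y := by
  have h0 : (Fintype.card Γ : ℂ) ≠ 0 := Nat.cast_ne_zero.mpr Fintype.card_ne_zero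
  rw [sym, mul_smul_comm, map_smul, Finset.mul_sum, map_sum]
  simp only [Θ_mul_gr]
  rw [Finset.sum_const, Finset.card_univ, ← Nat.cast_smul_eq_nsmul ℂ, smul_smul,
    inv_mul_cancel₀ h0, one_smul]

omit [LinearOrder ι] in
lemma sym_mem_F : S.sym ∈ S.F 0 :=
  Submodule.smul_mem _ _ (Submodule.sum_mem _ fun g _ => S.gr_mem_F g)

lemma sym_mul_lift {f : MvPolynomial ι ℂ} (hf : ∀ g, S.σ g f = f) :
    S.sym * S.lift f = S.lift f * S.sym := by
  rw [sym, smul_mul_assoc, mul_smul_comm, Finset.mul_sum, Finset.sum_mul]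
  congr 1
  exact Finset.sum_congr rfl fun g _ => by rw [gr_mul_lift, hf]

omit [LinearOrder ι] in
lemma exists_W_mul_sym {n : ℕ} {z : A} (hz : z ∈ S.F n) :
    ∃ y ∈ S.W n, z * S.sym = y * S.sym ∧ S.Θ y = S.Θ z := by
  refine S.F_induction (p := fun z => ∃ y ∈ S.W n, z * S.sym = y * S.sym ∧ S.Θ y = S.Θ z)
    ⟨0, zero_mem _, rfl, rfl⟩ ?_ ?_ ?_ hz
  · rintro x x' ⟨y, hy, h1, h2⟩ ⟨y', hy', h1', h2'⟩
    exact ⟨y + y', add_mem hy hy', by rw [add_mul, add_mul, h1, h1'], by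
      rw [map_add, map_add, h2, h2']⟩
  · rintro r x ⟨y, hy, h1, h2⟩
    exact ⟨r • y, Submodule.smul_mem _ _ hy, by rw [smul_mul_assoc, smul_mul_assoc, h1], by
      rw [map_smul, map_smul, h2]⟩
  · intro w g hw
    exact ⟨S.word w, S.word_mem_W hw, by rw [mul_assoc, gr_mul_sym], by simp⟩

variable {Q : Type*} [Ring Q] [Algebra ℂ Q] (mk : A →ₐ[ℂ] Q)

/-- Every element of `H e` is represented by the lift of a polynomial, whose leading part is the
symbol of any representative. The degree filtration makes this an induction on `n`. -/
lemma exists_lift_eq (hmk : ∀ n, ∀ z ∈ S.J n, mk z = 0) : ∀ n, ∀ z ∈ S.F n,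
    ∃ f ∈ lowDeg ι 0 n, mk z * mk S.sym = mk (S.lift f) * mk S.sym ∧
      f - S.Θ z ∈ lowDeg ι 1 n := by
  intro n
  induction n with
  | zero =>
    intro z hz
    obtain ⟨y, hy, h1, h2⟩ := S.exists_W_mul_sym hz
    have hd : S.Θ z ∈ lowDeg ι 0 0 := mem_lowDeg_zero.mpr (S.Θ_totalDegree hz)
    have h3 := S.sub_ordLift_mem (sub_mem hy (S.lift_mem_W hd))
    rw [map_sub S.Θ, Θ_lift, h2, sub_self, map_zero, sub_zero] at h3
    rw [below, sup_bot_eq] at h3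
    refine ⟨S.Θ z, hd, ?_, by rw [sub_self]; exact zero_mem _⟩
    have h4 := hmk _ _ h3
    rw [map_sub, sub_eq_zero] at h4
    rw [← map_mul, h1, map_mul, h4]
  | succ n ih =>
    intro z hz
    obtain ⟨y, hy, h1, h2⟩ := S.exists_W_mul_sym hz
    have hd : S.Θ z ∈ lowDeg ι 0 (n + 1) := mem_lowDeg_zero.mpr (S.Θ_totalDegree hz)
    have h3 := S.sub_ordLift_mem (sub_mem hy (S.lift_mem_W hd))
    rw [map_sub S.Θ, Θ_lift, h2, sub_self, map_zero, sub_zero] at h3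
    obtain ⟨a, ha, b, hb, hab⟩ := Submodule.mem_sup.mp h3
    obtain ⟨f, hf, hf1, -⟩ := ih b hb
    have hf' : f ∈ lowDeg ι 1 (n + 1) := lowDeg_le (by omega) hf
    refine ⟨S.Θ z + f, add_mem hd (lowDeg_le (by omega) hf), ?_, by rwa [add_sub_cancel_left]⟩
    have h4 : mk y = mk (S.lift (S.Θ z)) + mk b := by
      have := congrArg mk hab
      rw [map_add, hmk _ _ ha, zero_add, map_sub] at this
      rw [this]
      abel
    rw [← map_mul, h1, map_mul, h4, add_mul, hf1, map_add, map_add, add_mul]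

/-- The parametrisation `f ↦ f e` of `H e` by polynomials. -/
def toHe : MvPolynomial ι ℂ →ₗ[ℂ] Q := LinearMap.mulRight ℂ (mk S.sym) ∘ₗ mk.toLinearMap ∘ₗ S.lift

lemma toHe_apply (f : MvPolynomial ι ℂ) : S.toHe mk f = mk (S.lift f) * mk S.sym := rfl

/-- The parametrisation of `H e` is injective: this is the Poincaré-Birkhoff-Witt property. -/
lemma toHe_injective (hker : ∀ z, mk z = 0 → ∃ n, z ∈ S.J n) :
    Function.Injective (S.toHe mk) := by
  refine (injective_iff_map_eq_zero _).mpr fun f hf => ?_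
  rw [toHe_apply, ← map_mul] at hf
  obtain ⟨m, hm⟩ := hker _ hf
  by_contra h0
  have hF : S.lift f * S.sym ∈ S.F (f.totalDegree + 0) :=
    S.mul_mem_F (S.W_le_F _ (S.lift_mem_W (mem_lowDeg_zero.mpr le_rfl))) S.sym_mem_F
  have h1 := S.Θ_J (S.J_inf_F hm hF)
  rw [Θ_mul_sym, Θ_lift, add_zero] at h1
  have h2 : f ∈ lowDeg ι 1 f.totalDegree := by
    rw [mem_lowDeg_iff_homogeneousComponent]
    intro j hj
    rcases (Nat.lt_succ_iff.mp hj).eq_or_lt with rfl | h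
    · exact h1
    · exact homogeneousComponent_eq_zero _ _ h
  have := (mem_lowDeg_iff h0).mp h2
  omega

lemma gr_mul_toHe (g : Γ) (f : MvPolynomial ι ℂ) :
    mk (S.gr g) * S.toHe mk f = S.toHe mk (S.σ g f) := by
  rw [toHe_apply, toHe_apply, ← mul_assoc, ← map_mul, gr_mul_lift, map_mul, mul_assoc,
    ← map_mul mk (S.gr g), gr_mul_sym]

lemma toHe_mul_toHe (f : MvPolynomial ι ℂ) {h : MvPolynomial ι ℂ} (hh : ∀ g, S.σ g h = h) :
    S.toHe mk f * S.toHe mk h = mk (S.lift f * S.lift h) * mk S.sym := by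
  rw [toHe_apply, toHe_apply, mul_assoc, ← mul_assoc (mk S.sym), ← map_mul mk S.sym,
    S.sym_mul_lift hh, map_mul, mul_assoc, ← map_mul mk S.sym, sym_mul_sym, map_mul, mul_assoc]

/-- The action of `Γ` on `SV`. -/
@[reducible] def polyAction : MulSemiringAction Γ (MvPolynomial ι ℂ) where
  smul g f := S.σ g f
  one_smul f := by
    change S.σ 1 f = f
    rw [σ_one]
    rfl
  mul_smul g h f := by
    change S.σ (g * h) f = S.σ g (S.σ h f)
    rw [σ_mul]
    rfl
  smul_zero g := map_zero (S.σ g)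
  smul_add g := map_add (S.σ g)
  smul_one g := map_one (S.σ g)
  smul_mul g := map_mul (S.σ g)

end Lift

end SmashData

end

end SymplecticReflection

/-! ### Commutativity of the spherical subalgebra -/

namespace SymplecticReflection

noncomputable section

open Module MvPolynomial

namespace SmashData

variable {ι V Γ A : Type*} [AddCommGroup V] [Module ℂ V] [Group Γ] [Ring A] [Algebra ℂ A]
variable (S : SmashData ι V Γ A)

section Homogeneity

lemma pderiv_mem_homogDeg {n : ℕ} {f : MvPolynomial ι ℂ} (hf : f.IsHomogeneous n) (i : ι) :
    pderiv i f ∈ homogDeg ι 1 n := by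
  rcases Nat.eq_zero_or_pos n with rfl | hn
  · rw [(totalDegree_eq_zero_iff_eq_C.mp (Nat.le_zero.mp hf.totalDegree_le)), pderiv_C]
    exact zero_mem _
  · have h := mem_homogDeg_zero.mpr (hf.pderiv (i := i))
    refine mem_homogDeg.mpr fun α hα => ?_
    have := mem_homogDeg.mp h α hα
    omega

variable [Fintype ι]

lemma ham_apply (x : V) (f : MvPolynomial ι ℂ) :
    S.ham x f = ∑ j, C (S.k 1 x (S.b j)) * pderiv j f := by
  classical
  have hsum : ∀ f : MvPolynomial ι ℂ, (∑ j, (C (S.k 1 x (S.b j)) : MvPolynomial ι ℂ) • pderiv j :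
      Derivation ℂ (MvPolynomial ι ℂ) (MvPolynomial ι ℂ)) f
      = ∑ j, C (S.k 1 x (S.b j)) * pderiv j f := fun f =>
    (congrFun (map_sum (Derivation.coeFnAddMonoidHom (R := ℂ) (A := MvPolynomial ι ℂ)
      (M := MvPolynomial ι ℂ)) _ _) f).trans (Finset.sum_apply _ _ _)
  rw [← hsum]
  refine congrArg (fun D : Derivation ℂ (MvPolynomial ι ℂ) (MvPolynomial ι ℂ) => D f)
    (MvPolynomial.derivation_ext fun i => ?_)
  rw [ham_X, hsum, Finset.sum_eq_single i]
  · simp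
  · intro j _ hj
    rw [pderiv_X_of_ne hj.symm, mul_zero]
  · simp

lemma pois_mem_homogDeg {m n : ℕ} {f h : MvPolynomial ι ℂ} (hf : f.IsHomogeneous m)
    (hh : h.IsHomogeneous n) : S.pois f h ∈ homogDeg ι 2 (m + n) := by
  rw [pois_apply]
  refine Submodule.sum_mem _ fun i _ => mul_mem_homogDeg (j := 1) (k := 1)
    (pderiv_mem_homogDeg hf i) ?_
  rw [ham_apply]
  refine Submodule.sum_mem _ fun j _ => ?_
  rw [← smul_eq_C_mul]
  exact Submodule.smul_mem _ _ (pderiv_mem_homogDeg hh j)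

end Homogeneity

lemma smulCommClass_polyAction :
    letI := S.polyAction
    SMulCommClass Γ ℂ (MvPolynomial ι ℂ) := by
  let := S.polyAction
  exact ⟨fun g r f => map_smul (S.σ g) r f⟩

lemma isLinearAction (hinj : Function.Injective S.act) :
    letI := S.polyAction
    IsLinearAction S.act S.lin := by
  let := S.polyAction
  refine ⟨S.σ_lin, S.lin_injective, fun x => ?_, fun i => ⟨S.b i, S.lin_basis i⟩, hinj⟩
  have h : (⊤ : Submodule ℂ V) ≤ (homogeneousSubmodule ι ℂ 1).comap S.lin := by
    rw [← S.b.span_eq, Submodule.span_le]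
    rintro _ ⟨i, rfl⟩
    rw [SetLike.mem_coe, Submodule.mem_comap, lin_basis]
    exact isHomogeneous_X ℂ i
  exact h (Submodule.mem_top (x := x))

/-- The Poisson bracket vanishes if it vanishes on the invariants: apply `derivation_eq` in each
argument. -/
lemma k_one_eq_zero [Fintype ι] [Fintype Γ] (hinj : Function.Injective S.act)
    (h : ∀ f, (∀ g, S.σ g f = f) → ∀ l, (∀ g, S.σ g l = l) → S.pois f l = 0) : S.k 1 = 0 := by
  let := S.polyAction
  have H := S.isLinearAction hinj
  have h1 : ∀ f, (∀ g, S.σ g f = f) → ∀ l, S.pois l f = 0 := by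
    intro f hf l
    let D : Derivation ℂ (MvPolynomial ι ℂ) (MvPolynomial ι ℂ) :=
      Derivation.mk' (S.pois.flip f) fun a b => by
        rw [LinearMap.flip_apply, pois_mul]
        rfl
    have hD : D = 0 := H.derivation_eq fun l hl => h l hl f hf
    exact DFunLike.congr_fun hD l
  have h2 : ∀ i, S.ham (S.b i) = 0 := fun i => H.derivation_eq fun f hf => by
    rw [← pois_X]
    exact h1 f hf _
  refine S.b.ext fun i => S.b.ext fun j => ?_
  have h3 := S.ham_X (S.b i) j
  rw [h2, Derivation.zero_apply] at h3
  exact (C_eq_zero.mp h3.symm)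

section Product

variable [LinearOrder ι] [Fintype Γ] {Q : Type*} [Ring Q] [Algebra ℂ Q]

/-- The product on `SV` transported from `e H e` by `toHe`, where `L` is a left inverse
of `toHe`; only its restriction to the invariants is meaningful. -/
def star (mk : A →ₐ[ℂ] Q) (L : Q →ₗ[ℂ] MvPolynomial ι ℂ) :
    MvPolynomial ι ℂ →ₗ[ℂ] MvPolynomial ι ℂ →ₗ[ℂ] MvPolynomial ι ℂ :=
  ((LinearMap.mul ℂ Q).compl₁₂ (mk.toLinearMap ∘ₗ S.lift) (S.toHe mk)).compr₂ L

variable {mk : A →ₐ[ℂ] Q} {L : Q →ₗ[ℂ] MvPolynomial ι ℂ}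

lemma toHe_star (hmk : ∀ n, ∀ z ∈ S.J n, mk z = 0) (hL : ∀ f, L (S.toHe mk f) = f)
    (f h : MvPolynomial ι ℂ) : S.toHe mk (S.star mk L f h) = mk (S.lift f) * S.toHe mk h := by
  have e : S.star mk L f h = L (mk (S.lift f * S.lift h) * mk S.sym) := by
    rw [map_mul mk, mul_assoc]
    rfl
  obtain ⟨n, hn⟩ := S.mem_F_some (S.lift f * S.lift h)
  obtain ⟨p, -, hp, -⟩ := S.exists_lift_eq mk hmk n _ hn
  rw [e, hp, ← toHe_apply, hL, toHe_apply, ← hp, toHe_apply, map_mul, mul_assoc]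

lemma toHe_star_of_inv (hmk : ∀ n, ∀ z ∈ S.J n, mk z = 0) (hL : ∀ f, L (S.toHe mk f) = f)
    (f : MvPolynomial ι ℂ) {h : MvPolynomial ι ℂ} (hh : ∀ g, S.σ g h = h) :
    S.toHe mk (S.star mk L f h) = S.toHe mk f * S.toHe mk h := by
  rw [S.toHe_star hmk hL, toHe_mul_toHe S mk f hh, map_mul, mul_assoc, toHe_apply]

/-- If `z ∈ A` represents the image in `H e` of a polynomial, then this polynomial has the symbol
of `z` as its leading part. -/
lemma sub_Θ_mem_lowDeg (hmk : ∀ n, ∀ z ∈ S.J n, mk z = 0) (hL : ∀ f, L (S.toHe mk f) = f)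
    {n : ℕ} {z : A} (hz : z ∈ S.F n) {f : MvPolynomial ι ℂ}
    (hf : S.toHe mk f = mk z * mk S.sym) : f - S.Θ z ∈ lowDeg ι 1 n := by
  obtain ⟨p, -, hp, hp'⟩ := S.exists_lift_eq mk hmk n z hz
  rwa [← hL f, hf, hp, ← toHe_apply, hL]

lemma isDeformedProduct [Fintype ι] (hmk : ∀ n, ∀ z ∈ S.J n, mk z = 0)
    (hL : ∀ f, L (S.toHe mk f) = f) (hinj : Function.Injective S.act) :
    letI := S.polyAction
    letI := S.smulCommClass_polyAction
    IsDeformedProduct Γ (S.star mk L) S.pois := by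
  let := S.polyAction
  let := S.smulCommClass_polyAction
  have hi : Function.Injective (S.toHe mk) := Function.LeftInverse.injective hL
  have hmem : ∀ f, (∀ g, S.σ g f = f) → ∀ h, (∀ g, S.σ g h = h) → ∀ g,
      S.σ g (S.star mk L f h) = S.star mk L f h := by
    intro f hf h hh g
    apply hi
    rw [← gr_mul_toHe, S.toHe_star hmk hL, ← mul_assoc, ← map_mul, gr_mul_lift, hf, map_mul,
      mul_assoc, gr_mul_toHe, hh]
  refine ⟨hmem, ?_, ?_, ?_⟩
  · intro f hf h hh l hl
    apply hi
    rw [S.toHe_star_of_inv hmk hL _ hl, S.toHe_star_of_inv hmk hL _ hh,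
      S.toHe_star_of_inv hmk hL _ (hmem h hh l hl), S.toHe_star_of_inv hmk hL _ hl, mul_assoc]
  · intro f hf h hh m n hfm hhn
    have hW := S.lift_mem_W hfm
    have h1 := S.sub_Θ_mem_lowDeg hmk hL
      (S.mul_mem_F (S.W_le_F _ hW) (S.W_le_F _ (S.lift_mem_W hhn)))
      (f := S.star mk L f h) (by rw [S.toHe_star hmk hL, toHe_apply, map_mul, mul_assoc])
    rwa [S.Θ_W_mul hW, Θ_lift, Θ_lift] at h1
  · intro f hf h hh m n hfm hhn
    obtain ⟨K, hK, hKJ, hKΘ⟩ := S.exists_commutator hinj (d := m + n - 2) (by omega)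
      (S.lift_mem_W hfm) (S.lift_mem_W hhn) (by rw [Θ_lift]; exact hf) (by rw [Θ_lift]; exact hh)
    have e := hmk _ _ hKJ
    rw [map_sub, sub_eq_zero] at e
    have h1 := S.sub_Θ_mem_lowDeg hmk hL hK (f := S.star mk L f h - S.star mk L h f) (by
      rw [map_sub, S.toHe_star hmk hL, S.toHe_star hmk hL, ← e, map_sub, map_mul, map_mul,
        sub_mul, toHe_apply, toHe_apply, mul_assoc, mul_assoc])
    rw [hKΘ, Θ_lift, Θ_lift] at h1
    rcases Nat.lt_or_ge (m + n) 2 with hlt | hge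
    · rw [eq_zero_of_mem_lowDeg (by omega) h1]
      exact zero_mem _
    · exact lowDeg_le (by omega) h1

/-- The spherical subalgebra is commutative if and only if the form `k_1` vanishes. -/
theorem spherical_comm_iff [Fintype ι] (hmk : ∀ n, ∀ z ∈ S.J n, mk z = 0)
    (hker : ∀ z, mk z = 0 → ∃ n, z ∈ S.J n) (hsurj : Function.Surjective mk)
    (hinj : Function.Injective S.act)
    (hcodim : ∀ g, g ≠ 1 → ∀ v : V,
      ¬ LinearMap.range (idSub (S.act g)) ≤ Submodule.span ℂ {v}) :
    (∀ x y, (mk S.sym * x * mk S.sym) * (mk S.sym * y * mk S.sym)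
      = (mk S.sym * y * mk S.sym) * (mk S.sym * x * mk S.sym)) ↔ S.k 1 = 0 := by
  let := S.polyAction
  let := S.smulCommClass_polyAction
  have H := S.isLinearAction hinj
  obtain ⟨L, hL'⟩ := (S.toHe mk).exists_leftInverse_of_injective
    (LinearMap.ker_eq_bot.mpr (S.toHe_injective mk hker))
  have hL : ∀ f, L (S.toHe mk f) = f := LinearMap.congr_fun hL'
  have hi : Function.Injective (S.toHe mk) := S.toHe_injective mk hker
  have hD := S.isDeformedProduct hmk hL hinj
  have hee : mk S.sym * mk S.sym = mk S.sym := by rw [← map_mul, sym_mul_sym]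
  -- the elements of `e H e` are the images of the invariants
  have hto : ∀ f, (∀ g, S.σ g f = f) →
      S.toHe mk f = mk S.sym * mk (S.lift f) * mk S.sym := by
    intro f hf
    rw [toHe_apply, ← map_mul mk S.sym, S.sym_mul_lift hf, map_mul, mul_assoc, hee]
  have hfrom : ∀ x, ∃ f, (∀ g, S.σ g f = f) ∧ mk S.sym * x * mk S.sym = S.toHe mk f := by
    intro x
    obtain ⟨z, rfl⟩ := hsurj x
    obtain ⟨n, hn⟩ := S.mem_F_some (S.sym * z)
    obtain ⟨f, -, hf, -⟩ := S.exists_lift_eq mk hmk n _ hn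
    rw [map_mul] at hf
    refine ⟨f, fun g => hi ?_, hf⟩
    rw [← gr_mul_toHe, toHe_apply, ← hf, ← mul_assoc, ← mul_assoc, ← map_mul mk (S.gr g),
      gr_mul_sym]
  constructor
  · intro hcomm
    have hstar : ∀ f, (∀ g, S.σ g f = f) → ∀ l, (∀ g, S.σ g l = l) →
        S.star mk L f l = S.star mk L l f := by
      intro f hf l hl
      apply hi
      rw [S.toHe_star_of_inv hmk hL _ hl, S.toHe_star_of_inv hmk hL _ hf, hto f hf, hto l hl,
        hcomm]
    refine S.k_one_eq_zero hinj fun f hf l hl => ?_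
    refine H.inv_induction (p := fun f => S.pois f l = 0) (by simp) (fun a b ha hb => ?_)
      (fun m _ f hf hfm => ?_) hf (mem_lowDeg_zero.mpr le_rfl)
    · rw [map_add, LinearMap.add_apply, ha, hb, add_zero]
    refine H.inv_induction (p := fun l => S.pois f l = 0) (by simp) (fun a b ha hb => ?_)
      (fun n _ l hl hln => ?_) hl (mem_lowDeg_zero.mpr le_rfl)
    · rw [map_add, ha, hb, add_zero]
    have h1 := hD.bracket f hf l hl m n (mem_lowDeg_of_isHomogeneous hfm)
      (mem_lowDeg_of_isHomogeneous hln)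
    rw [hstar f hf l hl, sub_self, zero_sub, neg_mem_iff] at h1
    exact eq_zero_of_mem_homogDeg (S.pois_mem_homogDeg hfm hln) h1
  · intro hk x y
    have hp : S.pois = 0 := by
      refine LinearMap.ext fun f => LinearMap.ext fun h => ?_
      rw [pois_apply]
      simp [ham_apply, hk]
    rw [hp] at hD
    obtain ⟨f, hf, ef⟩ := hfrom x
    obtain ⟨l, hl, el⟩ := hfrom y
    rw [ef, el, ← S.toHe_star_of_inv hmk hL _ hl, ← S.toHe_star_of_inv hmk hL _ hf,
      hD.star_comm H hcodim hf hl]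

end Product

end SmashData

end

end SymplecticReflection

/-! ### The symplectic reflection algebra -/

namespace SymplecticReflection

noncomputable section

open Module

section SmashProduct

variable {V : Type*} [AddCommGroup V] [Module ℂ V] (Γ : Subgroup (V ≃ₗ[ℂ] V))

/-- The inclusion of `V` in `TV # Γ`, as a linear map. -/
def vecLin : V →ₗ[ℂ] Smash Γ where
  toFun := vec Γ
  map_add' x y := by rw [vec, map_add, SkewMonoidAlgebra.single_add]; rfl
  map_smul' r x := by
    rw [vec, map_smul, ← SkewMonoidAlgebra.smul_single]
    rfl

lemma of_mul_vecLin (g : Γ) (x : V) :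
    SkewMonoidAlgebra.of (TensorAlgebra ℂ V) Γ g * vecLin Γ x
      = vecLin Γ ((g : V ≃ₗ[ℂ] V) x) * SkewMonoidAlgebra.of (TensorAlgebra ℂ V) Γ g := by
  have h : g • TensorAlgebra.ι ℂ x = TensorAlgebra.ι ℂ ((g : V ≃ₗ[ℂ] V) x) :=
    TensorAlgebra.lift_ι_apply _ _
  change SkewMonoidAlgebra.single _ _ * SkewMonoidAlgebra.single _ _
    = SkewMonoidAlgebra.single _ _ * SkewMonoidAlgebra.single _ _
  rw [SkewMonoidAlgebra.single_mul_single, SkewMonoidAlgebra.single_mul_single, h, smul_one,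
    one_mul, mul_one, mul_one, one_mul]

/-- The elements of the basis of `TV` are the words in the basis of `V`. -/
lemma tensorAlgebra_basis_apply {ι : Type*} (b : Basis ι ℂ V) (w : List ι) :
    b.tensorAlgebra (FreeMonoid.ofList w) = (w.map fun i => TensorAlgebra.ι ℂ (b i)).prod := by
  have h1 : FreeAlgebra.basisFreeMonoid ℂ ι (FreeMonoid.ofList w)
      = FreeMonoid.lift (FreeAlgebra.ι ℂ) (FreeMonoid.ofList w) := by
    change FreeAlgebra.equivMonoidAlgebraFreeMonoid.symm
      (MonoidAlgebra.of ℂ _ (FreeMonoid.ofList w)) = _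
    rw [AlgEquiv.symm_apply_eq]
    change _ = FreeAlgebra.lift ℂ (fun x => MonoidAlgebra.of ℂ (FreeMonoid ι) (.of x)) _
    rw [← AlgHom.coe_toMonoidHom, ← MonoidHom.comp_apply]
    congr 1
    ext i : 1
    simp
  rw [Basis.tensorAlgebra, Basis.map_apply, h1, FreeMonoid.lift_apply]
  simp [map_list_prod, Function.comp_def]

/-- The basis of `TV # Γ` formed by the products of a word in a basis of `V` and a group
element. -/
def smashBasis {ι : Type*} (b : Basis ι ℂ V) : Basis (List ι × Γ) ℂ (Smash Γ) :=
  ((Finsupp.basis fun _ : Γ => b.tensorAlgebra).map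
    (SkewMonoidAlgebra.coeffLinearEquiv (S := ℂ)).symm).reindex
    (((Equiv.sigmaEquivProd Γ (FreeMonoid ι)).trans (Equiv.prodComm _ _)).trans
      (Equiv.prodCongr FreeMonoid.toList (Equiv.refl Γ)))

lemma smashBasis_apply {ι : Type*} (b : Basis ι ℂ V) (w : List ι) (g : Γ) :
    smashBasis Γ b (w, g) = (w.map fun i => vecLin Γ (b i)).prod
      * SkewMonoidAlgebra.of (TensorAlgebra ℂ V) Γ g := by
  have h1 : smashBasis Γ b (w, g)
      = SkewMonoidAlgebra.single g (b.tensorAlgebra (FreeMonoid.ofList w)) := by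
    rw [smashBasis, Basis.reindex_apply, Basis.map_apply, Finsupp.coe_basis]
    rfl
  have h2 : (w.map fun i => vecLin Γ (b i)).prod
      = SkewMonoidAlgebra.single 1 (w.map fun i => TensorAlgebra.ι ℂ (b i)).prod := by
    clear h1
    induction w with
    | nil => rfl
    | cons i w ih =>
      rw [List.map_cons, List.prod_cons, ih, List.map_cons, List.prod_cons]
      change SkewMonoidAlgebra.single _ _ * _ = _
      rw [SkewMonoidAlgebra.single_mul_single, one_smul, one_mul]
  rw [h1, h2, tensorAlgebra_basis_apply]
  change _ = _ * SkewMonoidAlgebra.single _ _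
  rw [SkewMonoidAlgebra.single_mul_single, one_smul, one_mul, mul_one]

end SmashProduct

section Reflections

variable {V : Type*} [AddCommGroup V] [Module ℂ V] {ω : LinearMap.BilinForm ℂ V}

lemma idSub_conj (g h : V ≃ₗ[ℂ] V) (y : V) : idSub (h * g * h⁻¹) (h y) = h (idSub g y) := by
  have : h⁻¹ (h y) = y := h.symm_apply_apply y
  rw [idSub_apply, idSub_apply, LinearEquiv.mul_apply, LinearEquiv.mul_apply, this, map_sub]

lemma finrank_range_idSub_conj (g h : V ≃ₗ[ℂ] V) :
    finrank ℂ (LinearMap.range (idSub (h * g * h⁻¹))) = finrank ℂ (LinearMap.range (idSub g)) := by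
  have : idSub (h * g * h⁻¹) ∘ₗ (h : V →ₗ[ℂ] V) = (h : V →ₗ[ℂ] V) ∘ₗ idSub g :=
    LinearMap.ext (idSub_conj g h)
  rw [← LinearEquiv.range_comp h (idSub (h * g * h⁻¹)), this, LinearMap.range_comp]
  exact LinearEquiv.finrank_map_eq h _

lemma projection_conj {g h : V ≃ₗ[ℂ] V} (hg : IsOfFinOrder g) (hg' : IsOfFinOrder (h * g * h⁻¹))
    (x : V) :
    Submodule.projection _ _ (isCompl_range_ker (h * g * h⁻¹) hg') (h x)
      = h (Submodule.projection _ _ (isCompl_range_ker g hg) x) := by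
  have hx : x ∈ LinearMap.range (idSub g) ⊔ LinearMap.ker (idSub g) := by
    rw [(isCompl_range_ker g hg).sup_eq_top]
    trivial
  obtain ⟨_, ⟨y, rfl⟩, b, hb, rfl⟩ := Submodule.mem_sup.mp hx
  have hb' : h b ∈ LinearMap.ker (idSub (h * g * h⁻¹)) := by
    rw [LinearMap.mem_ker, idSub_conj, LinearMap.mem_ker.mp hb, map_zero]
  rw [map_add, map_add, map_add, ← idSub_conj,
    Submodule.projection_apply_of_mem_left _ (LinearMap.mem_range_self _ _),
    Submodule.projection_apply_of_mem_left _ (LinearMap.mem_range_self _ _),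
    Submodule.projection_apply_of_mem_right _ hb, Submodule.projection_apply_of_mem_right _ hb',
    add_zero, add_zero, idSub_conj]

lemma reflForm_conj {g h : V ≃ₗ[ℂ] V} (hg : IsOfFinOrder g) (hg' : IsOfFinOrder (h * g * h⁻¹))
    (hh : h ∈ Sp ω) (x y : V) :
    reflForm ω (h * g * h⁻¹) hg' (h x) (h y) = reflForm ω g hg x y := by
  simp only [reflForm, LinearMap.compl₁₂_apply]
  rw [projection_conj hg hg', projection_conj hg hg']
  exact hh _ _

/-- On a plane, the cyclic sum of `ω(x, y) z` vanishes. -/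
lemma cyclic_sum_eq_zero (hω : ω.IsAlt) {R : Submodule ℂ V} (hR : finrank ℂ R = 2) {x y z : V}
    (hx : x ∈ R) (hy : y ∈ R) (hz : z ∈ R) : ω x y • z + ω y z • x + ω z x • y = 0 := by
  have : Module.Finite ℂ R := Module.finite_of_finrank_pos (by omega)
  let b := finBasisOfFinrankEq ℂ R hR
  have h : ∀ x ∈ R, ∃ p q : ℂ, x = p • (b 0 : V) + q • (b 1 : V) := fun x hx => by
    have := congrArg (Subtype.val) (b.sum_repr ⟨x, hx⟩)
    rw [Fin.sum_univ_two] at this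
    exact ⟨_, _, this.symm⟩
  obtain ⟨p, q, rfl⟩ := h x hx
  obtain ⟨p', q', rfl⟩ := h y hy
  obtain ⟨p'', q'', rfl⟩ := h z hz
  have h0 : ∀ x, ω x x = 0 := hω
  have h1 : ω (b 1 : V) (b 0 : V) = -ω (b 0 : V) (b 1 : V) := (LinearMap.IsAlt.neg hω _ _).symm
  simp only [map_add, map_smul, LinearMap.add_apply, LinearMap.smul_apply, h0, h1, smul_eq_mul]
  module

/-- The Jacobi identity for `ω_s`: the range of `Id - s` is a plane, on which the cyclic sum of
`ω(x, y) z` vanishes. -/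
lemma reflForm_jacobi (hω : ω.IsAlt) {s : V ≃ₗ[ℂ] V} (hs : IsOfFinOrder s)
    (hr : finrank ℂ (LinearMap.range (idSub s)) = 2) (x y z : V) :
    reflForm ω s hs x y • (s z - z) + reflForm ω s hs y z • (s x - x)
      + reflForm ω s hs z x • (s y - y) = 0 := by
  set p := Submodule.projection _ _ (isCompl_range_ker s hs) with hp
  have h1 : ∀ z, s z - z = -idSub s (p z) := fun z => by
    have h2 : z - p z ∈ LinearMap.ker (idSub s) := by
      rw [← Submodule.projection_apply_eq_zero_iff (isCompl_range_ker s hs), map_sub, ← hp, hp,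
        Submodule.projection_apply_of_mem_left _ (Submodule.projection_apply_mem _ _), sub_self]
    rw [LinearMap.mem_ker, map_sub, sub_eq_zero] at h2
    rw [← h2, idSub_apply, neg_sub]
  have h3 := cyclic_sum_eq_zero hω hr (Submodule.projection_apply_mem (isCompl_range_ker s hs) x)
    (Submodule.projection_apply_mem (isCompl_range_ker s hs) y)
    (Submodule.projection_apply_mem (isCompl_range_ker s hs) z)
  rw [h1, h1, h1]
  have h4 := congrArg (idSub s) h3
  simp only [map_add, map_smul, map_zero] at h4
  simp only [smul_neg, ← neg_add]
  rw [neg_eq_zero]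
  exact h4

/-- A nontrivial symplectic transformation of finite order is not a reflection in a hyperplane:
the form is nondegenerate on `Im (Id - g)`, which therefore is not a line. -/
lemma not_range_le_span (hω : ω.IsAlt) (hω' : ω.Nondegenerate) {g : V ≃ₗ[ℂ] V}
    (hg : IsOfFinOrder g) (hgω : g ∈ Sp ω) (hg1 : g ≠ 1) (v : V) :
    ¬ LinearMap.range (idSub g) ≤ Submodule.span ℂ {v} := by
  intro h
  apply hg1
  refine LinearEquiv.ext fun x => ?_
  have hx : ∀ y, reflForm ω g hg x y = 0 := fun y => by
    simp only [reflForm, LinearMap.compl₁₂_apply]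
    obtain ⟨p, hp⟩ := Submodule.mem_span_singleton.mp
      (h (Submodule.projection_apply_mem (isCompl_range_ker g hg) x))
    obtain ⟨q, hq⟩ := Submodule.mem_span_singleton.mp
      (h (Submodule.projection_apply_mem (isCompl_range_ker g hg) y))
    have h0 : ω v v = 0 := hω v
    rw [← hp, ← hq]
    simp [h0]
  have := LinearMap.mem_ker.mp ((reflForm_radical ω hω' g hg hgω x).mp hx)
  rw [idSub_apply, sub_eq_zero] at this
  exact this.symm

lemma one_notMem_reflections (Γ : Subgroup (V ≃ₗ[ℂ] V)) : (1 : Γ) ∉ reflections Γ := by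
  have h : idSub ((1 : Γ) : V ≃ₗ[ℂ] V) = 0 := by
    ext x
    exact sub_self x
  intro h1
  have h2 : finrank ℂ (LinearMap.range (idSub ((1 : Γ) : V ≃ₗ[ℂ] V))) = 2 := h1
  rw [h, LinearMap.range_zero, finrank_bot] at h2
  omega

end Reflections

namespace SmashData

variable {ι V Γ A : Type*} [AddCommGroup V] [Module ℂ V] [Group Γ] [Ring A] [Algebra ℂ A]
  [Fintype Γ] (S : SmashData ι V Γ A) {r : A → A → Prop}

lemma rel_mem_J (x y : V) : S.rel x y ∈ S.J 2 := by
  have h1 : (1 : A) ∈ S.F 0 := S.word_mem_F' (w := []) le_rfl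
  simpa using S.mul_rel_mul_mem_J (n := 2) le_rfl h1 h1 x y

lemma mk_eq_zero_of_mem_J (h : ∀ x y, r (S.vec x * S.vec y - S.vec y * S.vec x) (S.κ x y))
    (n : ℕ) (z : A) (hz : z ∈ S.J n) : RingQuot.mkAlgHom ℂ r z = 0 := by
  have h1 : ∀ x y, RingQuot.mkAlgHom ℂ r (S.rel x y) = 0 := fun x y => by
    rw [rel_apply, map_sub, RingQuot.mkAlgHom_rel ℂ (h x y), sub_self]
  have h2 : S.J n ≤ LinearMap.ker (RingQuot.mkAlgHom ℂ r).toLinearMap := by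
    rw [J, Submodule.span_le]
    rintro _ ⟨u, i, j, w, g, -, rfl⟩
    rw [SetLike.mem_coe, LinearMap.mem_ker, AlgHom.toLinearMap_apply, map_mul, map_mul, h1,
      mul_zero, zero_mul]
  exact h2 hz

/-- The union of the `J n` is a two-sided ideal, so it contains the kernel of the quotient map. -/
lemma exists_mem_J_of_mk_eq_zero (h : ∀ a a', r a a' → ∃ x y, a - a' = S.rel x y)
    (z : A) (hz : RingQuot.mkAlgHom ℂ r z = 0) : ∃ n, z ∈ S.J n := by
  have hadd : ∀ {a a' : A}, (∃ n, a ∈ S.J n) → (∃ n, a' ∈ S.J n) → ∃ n, a + a' ∈ S.J n := by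
    rintro a a' ⟨m, hm⟩ ⟨n, hn⟩
    exact ⟨max m n, add_mem (S.J_mono (le_max_left _ _) hm) (S.J_mono (le_max_right _ _) hn)⟩
  have hl : ∀ (y : A) {a : A}, (∃ n, a ∈ S.J n) → ∃ n, y * a ∈ S.J n := by
    rintro y a ⟨n, hn⟩
    obtain ⟨p, hp⟩ := S.mem_F_some y
    exact ⟨p + n, S.mul_J hp hn le_rfl⟩
  have hr : ∀ (y : A) {a : A}, (∃ n, a ∈ S.J n) → ∃ n, a * y ∈ S.J n := by
    rintro y a ⟨n, hn⟩
    obtain ⟨p, hp⟩ := S.mem_F_some y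
    exact ⟨n + p, S.J_mul hp hn le_rfl⟩
  let c : RingCon A :=
    { r := fun a a' => ∃ n, a - a' ∈ S.J n
      iseqv := ⟨fun a => ⟨0, by rw [sub_self]; exact zero_mem _⟩,
        fun ⟨n, hn⟩ => ⟨n, by rw [← neg_sub]; exact neg_mem hn⟩,
        fun h1 h2 => by simpa using hadd h1 h2⟩
      add' := fun h1 h2 => by simpa only [add_sub_add_comm] using hadd h1 h2
      mul' := fun {a b a' b'} h1 h2 => by
        have := hadd (hr a' h1) (hl b h2)
        rwa [show (a - b) * a' + b * (a' - b') = a * a' - b * b' by noncomm_ring] at this }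
  let φ : RingQuot r →+* c.Quotient := RingQuot.lift ⟨c.mk', fun a a' haa' => by
    obtain ⟨x, y, e⟩ := h a a' haa'
    exact c.eq.mpr ⟨2, e ▸ S.rel_mem_J x y⟩⟩
  have h1 : φ (RingQuot.mkRingHom r z) = c.mk' z := RingQuot.lift_mkRingHom_apply _ _ _
  have h2 : RingQuot.mkRingHom r z = 0 := by
    rw [← RingQuot.mkAlgHom_coe ℂ]
    exact hz
  rw [h2, map_zero, ← map_zero c.mk'] at h1
  obtain ⟨n, hn⟩ := c.eq.mp h1.symm
  exact ⟨n, by simpa using hn⟩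

end SmashData

section SymplecticReflectionAlgebra

variable {V : Type*} [AddCommGroup V] [Module ℂ V] (ω : LinearMap.BilinForm ℂ V)
  (Γ : Subgroup (V ≃ₗ[ℂ] V)) [Finite Γ] (t : ℂ) (c : reflParams Γ)

open Classical in
/-- The component `k_g` of the pairing `κ = ∑ k_g g` of the symplectic reflection algebra. -/
def kappaCoeff (g : Γ) : LinearMap.BilinForm ℂ V :=
  (if g = 1 then t • ω else 0) +
    if h : g ∈ reflections Γ then (c : reflections Γ → ℂ) ⟨g, h⟩ •
      reflForm ω (g : V ≃ₗ[ℂ] V) (Γ.subtype.isOfFinOrder (isOfFinOrder_of_finite g)) else 0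

lemma kappaCoeff_one : kappaCoeff ω Γ t c 1 = t • ω := by
  rw [kappaCoeff, if_pos rfl, dif_neg (one_notMem_reflections Γ), add_zero]

lemma grp_kappa [Fintype Γ] (x y : V) : grp Γ (kappa ω Γ t c x y)
    = ∑ g, kappaCoeff ω Γ t c g x y • SkewMonoidAlgebra.of (TensorAlgebra ℂ V) Γ g := by
  classical
  have hof : ∀ g : Γ, grp Γ (MonoidAlgebra.of ℂ Γ g)
      = SkewMonoidAlgebra.of (TensorAlgebra ℂ V) Γ g := fun g => MonoidAlgebra.lift_of _ _
  rw [kappa, map_add, map_smul, map_one, finsum_eq_sum_of_fintype, map_sum]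
  simp only [map_smul, hof, kappaCoeff, LinearMap.add_apply, add_smul, Finset.sum_add_distrib]
  congr 1
  · rw [Finset.sum_eq_single 1 (fun g _ hg => by rw [if_neg hg]; simp) (by simp), if_pos rfl,
      map_one]
    rfl
  · rw [← Fintype.sum_subtype_add_sum_subtype (fun g : Γ => g ∈ reflections Γ),
      Finset.sum_eq_zero (s := (Finset.univ : Finset {g : Γ // g ∉ reflections Γ}))
        (fun g _ => by rw [dif_neg g.2]; simp), add_zero]
    refine Finset.sum_congr rfl fun g _ => ?_
    rw [dif_pos g.2]
    rfl

variable {ω Γ} in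
lemma kappaCoeff_conj (hΓ : Γ ≤ Sp ω) (h g : Γ) (x y : V) :
    kappaCoeff ω Γ t c (h * g * h⁻¹) ((h : V ≃ₗ[ℂ] V) x) ((h : V ≃ₗ[ℂ] V) y)
      = kappaCoeff ω Γ t c g x y := by
  have hg : h * g * h⁻¹ = 1 ↔ g = 1 := conj_eq_one_iff
  have hf : ∀ g : Γ, IsOfFinOrder (g : V ≃ₗ[ℂ] V) := fun g =>
    Γ.subtype.isOfFinOrder (isOfFinOrder_of_finite g)
  have hr : h * g * h⁻¹ ∈ reflections Γ ↔ g ∈ reflections Γ :=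
    Eq.congr_left (finrank_range_idSub_conj (g : V ≃ₗ[ℂ] V) h)
  simp only [kappaCoeff, LinearMap.add_apply]
  congr 1
  · by_cases h1 : g = 1
    · rw [if_pos h1, if_pos (hg.mpr h1), LinearMap.smul_apply, LinearMap.smul_apply,
        LinearMap.smul_apply, LinearMap.smul_apply, hΓ h.2]
    · rw [if_neg h1, if_neg (mt hg.mp h1)]
      rfl
  · by_cases h1 : g ∈ reflections Γ
    · rw [dif_pos h1, dif_pos (hr.mpr h1), c.2 h ⟨g, h1⟩ ⟨h * g * h⁻¹, hr.mpr h1⟩ rfl]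
      simp only [LinearMap.smul_apply]
      congr 1
      exact reflForm_conj (hf g) (hf (h * g * h⁻¹)) (hΓ h.2) x y
    · rw [dif_neg h1, dif_neg (mt hr.mp h1)]
      rfl

/-- The smash product `TV # Γ` with the pairing `κ` of the symplectic reflection algebra
`H_{t,c}`. -/
def reflectionData [FiniteDimensional ℂ V] (hω : ω.IsAlt) (hΓ : Γ ≤ Sp ω) :
    SmashData (Fin (finrank ℂ V)) V Γ (Smash Γ) where
  b := finBasis ℂ V
  act := Γ.subtype
  vec := vecLin Γ
  gr := SkewMonoidAlgebra.of (TensorAlgebra ℂ V) Γ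
  gr_vec := of_mul_vecLin Γ
  basis := smashBasis Γ (finBasis ℂ V)
  basis_apply := smashBasis_apply Γ (finBasis ℂ V)
  k := kappaCoeff ω Γ t c
  k_self g x := by
    have h0 : ∀ x, ω x x = 0 := hω
    rw [kappaCoeff]
    split_ifs <;> simp [h0, reflForm]
  jacobi s x y z := by
    rw [kappaCoeff]
    split_ifs with h1 h2 h2
    · exact absurd h2 (h1 ▸ one_notMem_reflections Γ)
    · subst h1
      simp
    · have := reflForm_jacobi hω (Γ.subtype.isOfFinOrder (isOfFinOrder_of_finite s)) h2 x y z
      simp only [zero_add, LinearMap.smul_apply, smul_assoc, ← smul_add]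
      exact (congrArg _ this).trans (smul_zero _)
    · simp
  k_conj := kappaCoeff_conj t c hΓ

end SymplecticReflectionAlgebra

end

end SymplecticReflection

theorem theorem1p7 {V : Type*} [AddCommGroup V] [Module ℂ V] [FiniteDimensional ℂ V]
    [Nontrivial V] (ω : LinearMap.BilinForm ℂ V) (hω : ω.IsAlt) (hω' : ω.Nondegenerate)
    (Γ : Subgroup (V ≃ₗ[ℂ] V)) [Finite Γ] (hΓ : Γ ≤ SymplecticReflection.Sp ω)
    (t : ℂ) (c : SymplecticReflection.reflParams Γ) :
    (∀ a ∈ SymplecticReflection.sphericalSubalgebra ω Γ t c,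
      ∀ b ∈ SymplecticReflection.sphericalSubalgebra ω Γ t c, a * b = b * a) ↔ t = 0 := by
  have : Fintype Γ := Fintype.ofFinite Γ
  let S := SymplecticReflection.reflectionData ω Γ t c hω hΓ
  have hκ : ∀ x y, SymplecticReflection.grp Γ (SymplecticReflection.kappa ω Γ t c x y) = S.κ x y :=
    fun x y => (SymplecticReflection.grp_kappa ω Γ t c x y).trans (S.κ_apply x y).symm
  have hsym : SymplecticReflection.grp Γ (SymplecticReflection.symmetriser Γ) = S.sym := by
    rw [SymplecticReflection.symmetriser, map_smul, finsum_eq_sum_of_fintype, map_sum,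
      Nat.card_eq_fintype_card]
    exact congrArg _ (Finset.sum_congr rfl fun g _ => MonoidAlgebra.lift_of _ _)
  have key := S.spherical_comm_iff
    (Q := SymplecticReflection.SRAlg ω Γ t c)
    (mk := RingQuot.mkAlgHom ℂ (SymplecticReflection.Rel Γ (SymplecticReflection.kappa ω Γ t c)))
    (S.mk_eq_zero_of_mem_J fun x y => by rw [← hκ]; exact .comm x y)
    (S.exists_mem_J_of_mk_eq_zero fun a a' h => by
      obtain ⟨x, y⟩ := h
      exact ⟨x, y, by rw [S.rel_apply, hκ]; rfl⟩)
    (RingQuot.mkAlgHom_surjective ℂ _) Γ.subtype_injective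
    fun g hg v => SymplecticReflection.not_range_le_span hω hω'
      (Γ.subtype.isOfFinOrder (isOfFinOrder_of_finite g)) (hΓ g.2)
      (fun h => hg (Subtype.ext h)) v
  rw [← hsym] at key
  have hS : S.k 1 = t • ω := SymplecticReflection.kappaCoeff_one ω Γ t c
  have hω0 : ω ≠ 0 := by
    rintro rfl
    obtain ⟨x, hx⟩ := exists_ne (0 : V)
    exact hx (hω'.1 x fun y => rfl)
  rw [hS, smul_eq_zero, or_iff_left hω0] at key
  rw [← key]
  constructor
  · exact fun h x y => h _ ⟨x, rfl⟩ _ ⟨y, rfl⟩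
  · rintro h _ ⟨x, rfl⟩ _ ⟨y, rfl⟩
    exact h x y
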